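/- Let $(X,d)$ be a proper metric space (closed bounded sets are compact), let $\mathcal H_X$ be an infinite-dimensional separable complex Hilbert space, and let $\rho\colon C_0(X)\to\mathfrak B(\mathcal H_X)$ be an ample $X$-module, i.e. a nondegenerate $*$-representation such that $\rho(f)$ is not compact for any $f\neq 0$. For a Borel set $E\subseteq X$ let $\chi_E$ be the corresponding projection on $\mathcal H_X$, obtained by extending $\rho$ to bounded Borel functions. Fix an infinite-dimensional separable complex Hilbert space $\mathscr H$, let $\mathfrak K$ be the algebra of compact operators on $\mathscr H$, and let $\mathfrak K_1$ be its closed unit ball. An operator $T\in\mathfrak B(\mathcal H_X)$ is * *locally compact* if $\rho(f)T$ and $T\rho(f)$ are compact for all $f\in C_0(X)$; * *of finite propagation* if $\sup\{d(y,x):(y,x)\in\operatorname{supp}T\}<\infty$, where $(y,x)\in\operatorname{supp}T$ means that $\chi_VT\chi_U\ne0$ for all open neighbourhoods $U$ of $x$ and $V$ of $y$; * *quasi-local* if for every $\varepsilon>0$ there is $R>0$ such that $\|\chi_AT\chi_B\|<\varepsilon$ for all Borel sets $A,B\subseteq X$ with $d(A,B)>R$; * *strongly quasi-local* if for every $\varepsilon>0$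 there are $\delta,R>0$ such that $\|[T\otimes\mathrm{Id}_{\mathscr H},\Lambda(g)]\|<\varepsilon$ in $\mathfrak B(\mathcal H_X\otimes\mathscr H)$ for every strongly measurable $g\colon X\to\mathfrak K_1$ satisfying $\|g(x)-g(y)\|<\delta$ whenever $d(x,y)<R$. Here $\Lambda(g)=\sum_n\chi_{E_n}\otimes a_n$ (strong operator convergence) if $g$ is bounded and equal to $a_n\in\mathfrak K$ on $E_n$ for a countable Borel partition $(E_n)$ of $X$, and in general $\Lambda(g)=\lim_k\Lambda(g_k)$ in norm for any sequence of such maps $g_k$ that converges to $g$ uniformly. Let $C^*(\mathcal H_X)$ be the norm closure of the set of locally compact operators of finite propagation, let $C^*_q(\mathcal H_X)$ be the set of locally compact quasi-local operators, and let $C^*_{sq}(\mathcal H_X)$ be the set of locally compact strongly quasi-local operators. Then: 1. $C^*_{sq}(\mathcal H_X)\subseteq C^*_q(\mathcal H_X)$. 2. If $X$ has bounded geometry, then $C^*(\mathcal H_X)\subseteq C^*_{sq}(\mathcal H_X)$. 3. If $X$ has bounded geometry and Property A, then $C^*(\mathcal H_X)=C^*_{sq}(\mathcal H_X)=C^*_q(\mathcal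 H_X)$. *Bounded geometry* means that there are a subset $\Gamma\subseteq X$ and constants $c,C>0$ such that distinct points of $\Gamma$ are at distance at least $c$, every point of $X$ is within distance $C$ of $\Gamma$, and for every $R\ge0$ there is $N\in\mathbb N$ with $\#(B(x,R)\cap\Gamma)\le N$ for all $x\in\Gamma$. *Property A* means that for all $r,\varepsilon>0$ there are $S>0$ and finite sets $A_x\subseteq X\times\mathbb N$ $(x\in X)$ such that $(x,1)\in A_x$ for all $x$; $\#(A_x\,\triangle\,A_y)<\varepsilon\,\#(A_x\cap A_y)$ whenever $d(x,y)\le r$; and $d(y,y')\le S$ whenever $(y,n),(y',n')\in A_x$ for some $x$. -/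

import Mathlib

open scoped ZeroAtInfty TensorProduct ENNReal Topology symmDiff

namespace CoarseRoe

noncomputable section

/-! ### Coarse geometry -/

section Geometry

variable (X : Type*) [MetricSpace X]

/-- `Γ` is a net in `X`: for some `C > 0` every point of `X` is within distance `C` of `Γ`. -/
def IsNet {X : Type*} [MetricSpace X] (Γ : Set X) : Prop :=
  ∃ C : ℝ, 0 < C ∧ ∀ x : X, ∃ y ∈ Γ, dist x y ≤ C

/-- `Γ` is uniformly discrete: distinct points of `Γ` are at distance at least some `C > 0`. -/
def IsUniformlyDiscrete {X : Type*} [MetricSpace X] (Γ : Set X) : Prop :=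
  ∃ C : ℝ, 0 < C ∧ ∀ x ∈ Γ, ∀ y ∈ Γ, x ≠ y → C ≤ dist x y

/-- `X` has bounded geometry: it contains a uniformly discrete net `Γ` such that, for each `R`,
the balls of radius `R` centred in `Γ` contain a uniformly bounded number of points of `Γ`. -/
def BoundedGeometry : Prop :=
  ∃ Γ : Set X, IsUniformlyDiscrete Γ ∧ IsNet Γ ∧
    ∀ R : ℝ, 0 ≤ R → ∃ N : ℕ, ∀ x ∈ Γ, (Metric.ball x R ∩ Γ).encard ≤ N

open Classical in
/-- Yu's Property A.  The condition `#(A x ∆ A y) / #(A x ∩ A y) < ε` is written in multiplied-out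
form, which (by strictness) includes that `A x ∩ A y` is nonempty. -/
def PropertyA : Prop :=
  ∀ r : ℝ, 0 < r → ∀ ε : ℝ, 0 < ε → ∃ A : X → Finset (X × ℕ),
    (∀ x, (x, 1) ∈ A x) ∧
    (∀ x y, dist x y ≤ r → ((A x ∆ A y).card : ℝ) < ε * ((A x ∩ A y).card : ℝ)) ∧
    ∃ S : ℝ, 0 < S ∧ ∀ z, ∀ p ∈ A z, ∀ q ∈ A z, dist p.1 q.1 ≤ S

end Geometry

/-! ### Modules over a proper metric space -/

section Modules

variable {X : Type*} [MetricSpace X]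
  {H : Type*} [NormedAddCommGroup H] [InnerProductSpace ℂ H] [CompleteSpace H]

/-- An `X`-module: a nondegenerate `*`-representation of `C₀(X)` on an infinite-dimensional
separable Hilbert space. -/
structure IsModule (ρ : C₀(X, ℂ) →⋆ₙₐ[ℂ] (H →L[ℂ] H)) : Prop where
  separable : TopologicalSpace.SeparableSpace H
  infinite_dimensional : ¬ FiniteDimensional ℂ H
  nondegenerate :
    (Submodule.span ℂ {w : H | ∃ f v, ρ f v = w}).topologicalClosure = ⊤

/-- An ample `X`-module: no nonzero element of `C₀(X)` acts as a compact operator. -/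
structure IsAmpleModule (ρ : C₀(X, ℂ) →⋆ₙₐ[ℂ] (H →L[ℂ] H)) : Prop extends IsModule ρ where
  ample : ∀ f : C₀(X, ℂ), f ≠ 0 → ¬ IsCompactOperator (ρ f)

/-- The closed subspace `closure (ρ(C₀(U)) H)` attached to an open set `U`, where `C₀(U)` is the
ideal of functions in `C₀(X)` that vanish outside `U`. -/
def openRange (ρ : C₀(X, ℂ) →⋆ₙₐ[ℂ] (H →L[ℂ] H)) (U : Set X) : Submodule ℂ H :=
  (Submodule.span ℂ {w : H | ∃ f : C₀(X, ℂ), (∀ x, x ∉ U → f x = 0) ∧ ∃ v, ρ f v = w}).topologicalClosure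

/-- The range of the spectral projection of `E`: by outer regularity of the spectral measure, it is
the intersection of the subspaces attached to the open sets that contain `E`. -/
def borelRange (ρ : C₀(X, ℂ) →⋆ₙₐ[ℂ] (H →L[ℂ] H)) (E : Set X) : Submodule ℂ H :=
  ⨅ U : {U : Set X // IsOpen U ∧ E ⊆ U}, openRange ρ U

instance borelRange_completeSpace (ρ : C₀(X, ℂ) →⋆ₙₐ[ℂ] (H →L[ℂ] H)) (E : Set X) :
    CompleteSpace (borelRange ρ E) := by
  have h : IsClosed (borelRange ρ E : Set H) := by
    rw [borelRange, Submodule.coe_iInf]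
    exact isClosed_iInter fun U => Submodule.isClosed_topologicalClosure _
  exact h.completeSpace_coe

/-- The projection `χ_E` on `H`, i.e. the value at the indicator function of the Borel set `E` of
the extension of the representation `ρ` to bounded Borel functions. -/
def chi (ρ : C₀(X, ℂ) →⋆ₙₐ[ℂ] (H →L[ℂ] H)) (E : Set X) : H →L[ℂ] H :=
  (borelRange ρ E).starProjection

section Spectral
open MeasureTheory

theorem exists_bump [ProperSpace X] {K U : Set X} (hK : IsCompact K) (hU : IsOpen U) (hKU : K ⊆ U) :
    ∃ (f : C₀(X, ℂ)) (r : X → ℝ), Continuous r ∧ (∀ x, f x = r x) ∧ (∀ x, 0 ≤ r x ∧ r x ≤ 1) ∧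
      (∀ x ∈ K, r x = 1) ∧ ∀ x, x ∉ U → r x = 0 := by
  obtain ⟨g, hg1, hg0, hgc, hg⟩ := exists_continuous_one_zero_of_isCompact hK hU.isClosed_compl
    (Set.disjoint_compl_right_iff_subset.mpr hKU)
  refine ⟨⟨⟨fun x => (g x : ℂ), by fun_prop⟩, ?_⟩, g, g.continuous, fun x => rfl, fun x => hg x,
    fun x hx => hg1 hx, fun x hx => hg0 hx⟩
  have h : HasCompactSupport fun x => (g x : ℂ) := hgc.comp_left (g := fun t : ℝ => (t : ℂ)) rfl
  exact h.is_zero_at_infty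

variable (ρ : C₀(X, ℂ) →⋆ₙₐ[ℂ] (H →L[ℂ] H))

instance openRange_completeSpace (U : Set X) : CompleteSpace (openRange ρ U) :=
  (Submodule.isClosed_topologicalClosure _).completeSpace_coe

theorem inner_rep_left (f : C₀(X, ℂ)) (v w : H) : inner ℂ (ρ f v) w = inner ℂ v (ρ (star f) w) := by
  rw [map_star, ContinuousLinearMap.star_eq_adjoint, ContinuousLinearMap.adjoint_inner_right]

theorem rep_mem_openRange {U : Set X} {f : C₀(X, ℂ)} (hf : ∀ x, x ∉ U → f x = 0) (v : H) :
    ρ f v ∈ openRange ρ U :=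
  Submodule.le_topologicalClosure _ (Submodule.subset_span ⟨f, hf, v, rfl⟩)

theorem openRange_mono {U V : Set X} (h : U ⊆ V) : openRange ρ U ≤ openRange ρ V := by
  refine Submodule.topologicalClosure_mono (Submodule.span_mono ?_)
  rintro w ⟨f, hf, v, rfl⟩
  exact ⟨f, fun x hx => hf x fun hxU => hx (h hxU), v, rfl⟩

theorem rep_openProj {U : Set X} {f : C₀(X, ℂ)} (hf : ∀ x, x ∉ U → f x = 0) (v : H) :
    ρ f ((openRange ρ U).starProjection v) = ρ f v := by
  rw [← sub_eq_zero, ← map_sub]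
  set u := (openRange ρ U).starProjection v - v with hu
  have hort : ∀ w ∈ openRange ρ U, inner ℂ w u = 0 := by
    intro w hw
    have := Submodule.starProjection_inner_eq_zero (K := openRange ρ U) v w hw
    have h2 := inner_eq_zero_symm.mp this
    rw [hu, ← neg_sub, inner_neg_right, h2, neg_zero]
  rw [← inner_self_eq_zero (𝕜 := ℂ)]
  have h3 := inner_rep_left ρ (star f) (ρ f u) u
  rw [star_star] at h3
  rw [← h3]
  exact hort _ (rep_mem_openRange ρ (fun x hx => by simp [hf x hx]) _)

theorem openRange_approx {U : Set X} {w : H} (hw : w ∈ openRange ρ U) {ε : ℝ} (hε : 0 < ε) :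
    ∃ K : Set X, IsCompact K ∧ K ⊆ U ∧ ∀ (f : C₀(X, ℂ)) (r : X → ℝ), (∀ x, f x = r x) →
      (∀ x, 0 ≤ r x ∧ r x ≤ 1) → (∀ x ∈ K, r x = 1) → ‖ρ f w - w‖ ≤ ε := by
  have hnorm : ∀ (f : C₀(X, ℂ)) (r : X → ℝ), (∀ x, f x = r x) →
      (∀ x, 0 ≤ r x ∧ r x ≤ 1) → ‖ρ f‖ ≤ 1 := by
    intro f r hfr hr
    refine (NonUnitalStarAlgHom.norm_apply_le ρ f).trans ?_
    rw [← ZeroAtInftyContinuousMap.norm_toBCF_eq_norm]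
    refine (BoundedContinuousFunction.norm_le zero_le_one).mpr fun x => ?_
    change ‖f x‖ ≤ 1
    rw [hfr, Complex.norm_real, Real.norm_of_nonneg (hr x).1]
    exact (hr x).2
  have hspan : ∀ w ∈ Submodule.span ℂ {w : H | ∃ f : C₀(X, ℂ), (∀ x, x ∉ U → f x = 0) ∧
      ∃ v, ρ f v = w}, ∀ ε : ℝ, 0 < ε →
      ∃ K : Set X, IsCompact K ∧ K ⊆ U ∧ ∀ (f : C₀(X, ℂ)) (r : X → ℝ), (∀ x, f x = r x) →
      (∀ x, 0 ≤ r x ∧ r x ≤ 1) → (∀ x ∈ K, r x = 1) → ‖ρ f w - w‖ ≤ ε := by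
    intro w hw
    induction hw using Submodule.span_induction with
    | zero => exact fun ε hε => ⟨∅, isCompact_empty, by simp, fun f r _ _ _ => by simpa using hε.le⟩
    | add a b _ _ iha ihb =>
      intro ε hε
      obtain ⟨K, hK, hKU, h1⟩ := iha (ε / 2) (by linarith)
      obtain ⟨L, hL, hLU, h2⟩ := ihb (ε / 2) (by linarith)
      refine ⟨K ∪ L, hK.union hL, Set.union_subset hKU hLU, fun f r hfr hr h => ?_⟩
      have e1 := h1 f r hfr hr fun x hx => h x (Or.inl hx)
      have e2 := h2 f r hfr hr fun x hx => h x (Or.inr hx)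
      calc ‖ρ f (a + b) - (a + b)‖ = ‖(ρ f a - a) + (ρ f b - b)‖ := by rw [map_add]; congr 1; abel
        _ ≤ _ := norm_add_le _ _
        _ ≤ ε := by linarith
    | smul c a _ ih =>
      intro ε hε
      obtain ⟨K, hK, hKU, h1⟩ := ih (ε / (‖c‖ + 1)) (by positivity)
      refine ⟨K, hK, hKU, fun f r hfr hr h => ?_⟩
      have e1 := h1 f r hfr hr h
      rw [map_smul, ← smul_sub, norm_smul]
      calc ‖c‖ * ‖ρ f a - a‖ ≤ (‖c‖ + 1) * (ε / (‖c‖ + 1)) := by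
            gcongr; linarith
        _ = ε := by field_simp
    | mem w hw =>
      obtain ⟨g, hg, v, rfl⟩ := hw
      intro ε hε
      set η := ε / (‖v‖ + 1) with hη
      have hη0 : 0 < η := by positivity
      refine ⟨{x | η ≤ ‖g x‖}, ?_, ?_, fun f r hfr hr h => ?_⟩
      · have h0 := g.zero_at_infty'
        have h1 : ∀ᶠ x in Filter.cocompact X, ‖g x‖ < η := by
          have := (tendsto_zero_iff_norm_tendsto_zero.mp h0)
          exact this.eventually (gt_mem_nhds hη0)
        obtain ⟨t, ht, hts⟩ := Filter.mem_cocompact.mp h1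
        refine ht.of_isClosed_subset (isClosed_le continuous_const (by fun_prop)) fun x hx => ?_
        by_contra hxt
        have := hts hxt
        simp only [Set.mem_ofPred_eq] at this hx
        linarith
      · intro x hx
        by_contra hxU
        have : η ≤ ‖g x‖ := hx
        rw [hg x hxU, norm_zero] at this
        linarith
      · have e1 : ρ f (ρ g v) - ρ g v = ρ (f * g - g) v := by
          rw [map_sub, map_mul]; rfl
        have e2 : ‖f * g - g‖ ≤ η := by
          rw [← ZeroAtInftyContinuousMap.norm_toBCF_eq_norm]
          refine (BoundedContinuousFunction.norm_le hη0.le).mpr fun x => ?_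
          change ‖f x * g x - g x‖ ≤ η
          by_cases hx : η ≤ ‖g x‖
          · rw [hfr, h x hx]; simpa using hη0.le
          · have : f x * g x - g x = -(((1 - r x : ℝ) : ℂ) * g x) := by
              rw [hfr]; push_cast; ring
            rw [this, norm_neg, norm_mul, Complex.norm_real,
              Real.norm_of_nonneg (by linarith [(hr x).2])]
            have := (hr x).1
            have h3 := norm_nonneg (g x)
            nlinarith
        rw [e1]
        calc ‖ρ (f * g - g) v‖ ≤ ‖ρ (f * g - g)‖ * ‖v‖ := ContinuousLinearMap.le_opNorm _ _
          _ ≤ η * (‖v‖ + 1) := by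
            gcongr
            · exact (NonUnitalStarAlgHom.norm_apply_le ρ _).trans e2
            · linarith
          _ = ε := by rw [hη]; field_simp
  obtain ⟨w', hw', hd⟩ := Metric.mem_closure_iff.mp hw (ε / 3) (by linarith)
  rw [dist_eq_norm] at hd
  obtain ⟨K, hK, hKU, h1⟩ := hspan w' hw' (ε / 3) (by linarith)
  refine ⟨K, hK, hKU, fun f r hfr hr h => ?_⟩
  have e1 := h1 f r hfr hr h
  have e2 : ‖ρ f (w - w')‖ ≤ ‖w - w'‖ := by
    refine (ContinuousLinearMap.le_opNorm _ _).trans ?_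
    have := hnorm f r hfr hr
    have h3 := norm_nonneg (w - w')
    nlinarith
  calc ‖ρ f w - w‖ = ‖ρ f (w - w') + (ρ f w' - w') - (w - w')‖ := by rw [map_sub]; congr 1; abel
    _ ≤ ‖ρ f (w - w')‖ + ‖ρ f w' - w'‖ + ‖w - w'‖ :=
      (norm_sub_le _ _).trans (add_le_add_left (norm_add_le _ _) _)
    _ ≤ ε := by linarith

variable [MeasurableSpace X] (μ : Measure X)

theorem norm_rep_sq {v : H} (hμ : ∀ f : C₀(X, ℂ), inner ℂ v (ρ f v) = ∫ x, f x ∂μ)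
    {f : C₀(X, ℂ)} {r : X → ℝ} (hfr : ∀ x, f x = r x) : ‖ρ f v‖ ^ 2 = ∫ x, r x ^ 2 ∂μ := by
  have h1 : (inner ℂ (ρ f v) (ρ f v) : ℂ) = ∫ x, ((r x ^ 2 : ℝ) : ℂ) ∂μ := by
    rw [inner_rep_left, ← mul_apply_eq_comp, ← map_mul, hμ]
    refine integral_congr_ae (Filter.Eventually.of_forall fun x => ?_)
    change star (f x) * f x = _
    rw [hfr]
    simp [pow_two]
  rw [integral_complex_ofReal, inner_self_eq_norm_sq_to_K] at h1
  apply Complex.ofReal_injective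
  rw [← h1]
  push_cast
  rfl

variable [ProperSpace X] [BorelSpace X] [IsFiniteMeasure μ]

theorem norm_openProj_sq {v : H} (hμ : ∀ f : C₀(X, ℂ), inner ℂ v (ρ f v) = ∫ x, f x ∂μ)
    {U : Set X} (hU : IsOpen U) : ‖(openRange ρ U).starProjection v‖ ^ 2 = μ.real U := by
  set p := (openRange ρ U).starProjection v with hp
  have hint : ∀ r : X → ℝ, Continuous r → (∀ x, 0 ≤ r x ∧ r x ≤ 1) →
      Integrable (fun x => r x ^ 2) μ := by
    intro r hrc hr
    refine Integrable.of_bound (hrc.pow 2).aestronglyMeasurable 1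
      (Filter.Eventually.of_forall fun x => ?_)
    rw [Real.norm_of_nonneg (sq_nonneg _)]
    nlinarith [hr x]
  apply le_antisymm
  · have h1 : ∀ ε : ℝ, 0 < ε → ‖p‖ ≤ ε + Real.sqrt (μ.real U) := by
      intro ε hε
      obtain ⟨K, hK, hKU, h⟩ := openRange_approx ρ
        (Submodule.starProjection_apply_mem (openRange ρ U) v) hε
      obtain ⟨f, r, hrc, hfr, hr, hr1, hr0⟩ := exists_bump hK hU hKU
      have h2 := h f r hfr hr hr1
      rw [rep_openProj ρ (fun x hx => by rw [hfr, hr0 x hx]; simp)] at h2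
      have h3 : ‖ρ f v‖ ≤ Real.sqrt (μ.real U) := by
        apply Real.le_sqrt_of_sq_le
        rw [norm_rep_sq ρ μ hμ hfr, ← integral_indicator_one hU.measurableSet]
        refine integral_mono (hint r hrc hr) ((integrable_const 1).indicator hU.measurableSet)
          fun x => ?_
        by_cases hx : x ∈ U
        · simp only [Set.indicator_of_mem hx, Pi.one_apply]; nlinarith [hr x]
        · simp [Set.indicator_of_notMem hx, hr0 x hx]
      calc ‖p‖ = ‖ρ f v - (ρ f v - p)‖ := by congr 1; abel
        _ ≤ ‖ρ f v‖ + ‖ρ f v - p‖ := norm_sub_le _ _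
        _ ≤ _ := by linarith
    have h2 : ‖p‖ ≤ Real.sqrt (μ.real U) := le_of_forall_pos_le_add fun ε hε => by
      linarith [h1 ε hε]
    calc ‖p‖ ^ 2 ≤ Real.sqrt (μ.real U) ^ 2 := by gcongr
      _ = _ := Real.sq_sqrt measureReal_nonneg
  · have h1 : ∀ K, IsCompact K → K ⊆ U → μ.real K ≤ ‖p‖ ^ 2 := by
      intro K hK hKU
      obtain ⟨f, r, hrc, hfr, hr, hr1, hr0⟩ := exists_bump hK hU hKU
      have h2 : ‖ρ f v‖ ≤ ‖p‖ := by
        rw [← rep_openProj ρ (U := U) (fun x hx => by rw [hfr, hr0 x hx]; simp)]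
        refine (ContinuousLinearMap.le_opNorm _ _).trans ?_
        have : ‖ρ f‖ ≤ 1 := by
          refine (NonUnitalStarAlgHom.norm_apply_le ρ f).trans ?_
          rw [← ZeroAtInftyContinuousMap.norm_toBCF_eq_norm]
          refine (BoundedContinuousFunction.norm_le zero_le_one).mpr fun x => ?_
          change ‖f x‖ ≤ 1
          rw [hfr, Complex.norm_real, Real.norm_of_nonneg (hr x).1]
          exact (hr x).2
        have h3 := norm_nonneg p
        nlinarith
      calc μ.real K ≤ ∫ x, r x ^ 2 ∂μ := by
            rw [← integral_indicator_one hK.measurableSet]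
            refine integral_mono ((integrable_const 1).indicator hK.measurableSet) (hint r hrc hr)
              fun x => ?_
            by_cases hx : x ∈ K
            · simp [Set.indicator_of_mem hx, hr1 x hx]
            · simp only [Set.indicator_of_notMem hx]; positivity
        _ = ‖ρ f v‖ ^ 2 := (norm_rep_sq ρ μ hμ hfr).symm
        _ ≤ _ := by gcongr
    have h2 : μ U ≤ ENNReal.ofReal (‖p‖ ^ 2) := by
      rw [hU.measure_eq_iSup_isCompact]
      refine iSup₂_le fun K hKU => iSup_le fun hK => ?_
      rw [← ofReal_measureReal]
      exact ENNReal.ofReal_le_ofReal (h1 K hK hKU)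
    exact ENNReal.toReal_le_of_le_ofReal (sq_nonneg _) h2

theorem norm_sub_openProj_sq {v : H} (hμ : ∀ f : C₀(X, ℂ), inner ℂ v (ρ f v) = ∫ x, f x ∂μ)
    {U V : Set X} (hU : IsOpen U) (hV : IsOpen V) (h : U ⊆ V) :
    ‖(openRange ρ V).starProjection v - (openRange ρ U).starProjection v‖ ^ 2
      = μ.real V - μ.real U := by
  have h1 : (openRange ρ U).starProjection ((openRange ρ V).starProjection v)
      = (openRange ρ U).starProjection v :=
    congrArg (fun T : H →L[ℂ] H => T v)
      (Submodule.starProjection_comp_starProjection_of_le (openRange_mono ρ h))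
  have h2 := Submodule.norm_sq_eq_add_norm_sq_starProjection
    ((openRange ρ V).starProjection v) (openRange ρ U)
  rw [Submodule.starProjection_orthogonal_val, h1, norm_openProj_sq ρ μ hμ hU,
    norm_openProj_sq ρ μ hμ hV] at h2
  linarith

/-- The projections `χ_E` are the spectral projections of `ρ`: if `μ` is the spectral measure of
`v`, then `⟪v, χ_E v⟫ = ‖χ_E v‖² = μ(E)` (for a non-Borel set, `μ(E)` is the outer measure). -/
theorem norm_chi_sq {v : H} (hμ : ∀ f : C₀(X, ℂ), inner ℂ v (ρ f v) = ∫ x, f x ∂μ)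
    (E : Set X) : ‖chi ρ E v‖ ^ 2 = μ.real E := by
  have hle : ∀ U : Set X, IsOpen U → E ⊆ U → borelRange ρ E ≤ openRange ρ U :=
    fun U hU hEU => iInf_le _ (⟨U, hU, hEU⟩ : {U : Set X // IsOpen U ∧ E ⊆ U})
  choose U0 hEU0 hU0 hμU0 using fun n : ℕ =>
    E.exists_isOpen_le_add μ (ε := ENNReal.ofReal (1 / ((n : ℝ) + 1)))
      (by simp only [ne_eq, ENNReal.ofReal_eq_zero, not_le]; positivity)
  set W : ℕ → Set X := fun n => ⋂ k ∈ Finset.range (n + 1), U0 k with hW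
  have hWo : ∀ n, IsOpen (W n) := fun n => isOpen_biInter_finset fun k _ => hU0 k
  have hEW : ∀ n, E ⊆ W n := fun n => Set.subset_iInter₂ fun k _ => hEU0 k
  have hWanti : ∀ n m, n ≤ m → W m ⊆ W n := fun n m hnm =>
    Set.biInter_subset_biInter_left fun k hk => by
      simp only [Finset.coe_range, Set.mem_Iio] at hk ⊢
      omega
  have hWE : ∀ n, μ.real (W n) ≤ μ.real E + 1 / ((n : ℝ) + 1) := by
    intro n
    have h1 : μ (W n) ≤ μ E + ENNReal.ofReal (1 / ((n : ℝ) + 1)) :=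
      (measure_mono (Set.biInter_subset_of_mem (by simp))).trans (hμU0 n)
    have h2 := ENNReal.toReal_mono (by finiteness) h1
    rwa [ENNReal.toReal_add (by finiteness) (by finiteness),
      ENNReal.toReal_ofReal (by positivity)] at h2
  have hEr : ∀ U : Set X, E ⊆ U → μ.real E ≤ μ.real U := fun U h => measureReal_mono h
  set u : ℕ → H := fun n => (openRange ρ (W n)).starProjection v with hu
  have hb0 : Filter.Tendsto (fun n : ℕ => Real.sqrt (1 / ((n : ℝ) + 1))) Filter.atTop (𝓝 0) := by
    have := (Real.continuous_sqrt.tendsto 0).comp tendsto_one_div_add_atTop_nhds_zero_nat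
    simpa only [Real.sqrt_zero, Function.comp_def] using this
  have hdist : ∀ n (U : Set X), IsOpen U → E ⊆ U → U ⊆ W n →
      dist (u n) ((openRange ρ U).starProjection v) ≤ Real.sqrt (1 / ((n : ℝ) + 1)) := by
    intro n U hU hEU hUW
    rw [dist_eq_norm]
    apply Real.le_sqrt_of_sq_le
    rw [norm_sub_openProj_sq ρ μ hμ hU (hWo n) hUW]
    linarith [hWE n, hEr U hEU]
  have hcau : CauchySeq u := cauchySeq_of_le_tendsto_0' _
    (fun n m hnm => hdist n (W m) (hWo m) (hEW m) (hWanti n m hnm)) hb0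
  obtain ⟨q, hq⟩ := cauchySeq_tendsto_of_complete hcau
  have hqmem : q ∈ borelRange ρ E := by
    rw [borelRange, Submodule.mem_iInf]
    rintro ⟨U, hU, hEU⟩
    have h1 : Filter.Tendsto (fun n => (openRange ρ (W n ∩ U)).starProjection v)
        Filter.atTop (𝓝 q) := by
      refine tendsto_of_tendsto_of_dist hq (squeeze_zero (fun _ => dist_nonneg) (fun n => ?_) hb0)
      exact hdist n _ ((hWo n).inter hU) (Set.subset_inter (hEW n) hEU) Set.inter_subset_left
    refine (Submodule.isClosed_topologicalClosure _).mem_of_tendsto h1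
      (Filter.Eventually.of_forall fun n => ?_)
    exact openRange_mono ρ Set.inter_subset_right (Submodule.starProjection_apply_mem _ _)
  have ha : Filter.Tendsto (fun n => μ.real (W n)) Filter.atTop (𝓝 (μ.real E)) := by
    refine tendsto_of_tendsto_of_tendsto_of_le_of_le tendsto_const_nhds ?_
      (fun n => hEr _ (hEW n)) hWE
    simpa using (tendsto_const_nhds (x := μ.real E)).add tendsto_one_div_add_atTop_nhds_zero_nat
  have hqn : ‖q‖ ^ 2 = μ.real E := by
    refine tendsto_nhds_unique ((hq.norm).pow 2) ?_
    simpa only [hu, norm_openProj_sq ρ μ hμ (hWo _)] using ha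
  have hqv : inner ℂ (v - q) q = 0 := by
    refine tendsto_nhds_unique ((tendsto_const_nhds (x := v)).sub hq |>.inner hq) ?_
    refine tendsto_const_nhds.congr fun n => ?_
    exact (Submodule.starProjection_inner_eq_zero v _ (Submodule.starProjection_apply_mem _ _)).symm
  apply le_antisymm
  · refine ge_of_tendsto' ha fun n => ?_
    rw [← norm_openProj_sq ρ μ hμ (hWo n)]
    have h1 : (borelRange ρ E).starProjection ((openRange ρ (W n)).starProjection v)
        = (borelRange ρ E).starProjection v :=
      congrArg (fun T : H →L[ℂ] H => T v)
        (Submodule.starProjection_comp_starProjection_of_le (hle _ (hWo n) (hEW n)))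
    rw [chi, ← h1]
    gcongr
    exact Submodule.norm_starProjection_apply_le _ _
  · rw [← hqn]
    have h1 : inner ℂ (chi ρ E v) q = inner ℂ q q := by
      have h2 := Submodule.starProjection_inner_eq_zero (K := borelRange ρ E) v q hqmem
      rw [inner_sub_left, sub_eq_zero] at h2 hqv
      rw [← hqv, h2, chi]
    have h3 : ‖q‖ * ‖q‖ ≤ ‖chi ρ E v‖ * ‖q‖ := by
      have := norm_inner_le_norm (𝕜 := ℂ) (chi ρ E v) q
      rwa [h1, inner_self_eq_norm_sq_to_K, norm_pow, RCLike.norm_ofReal, abs_norm, pow_two] at this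
    have h4 : ‖q‖ ≤ ‖chi ρ E v‖ := by
      rcases (norm_nonneg q).eq_or_lt with h | h
      · rw [← h]; positivity
      · exact le_of_mul_le_mul_right h3 h
    gcongr
end Spectral

/-! ### Roe algebras and quasi-local algebras -/

/-- `T` is locally compact: `ρ(f) T` and `T ρ(f)` are compact for all `f ∈ C₀(X)`. -/
def IsLocallyCompact (ρ : C₀(X, ℂ) →⋆ₙₐ[ℂ] (H →L[ℂ] H)) (T : H →L[ℂ] H) : Prop :=
  ∀ f : C₀(X, ℂ), IsCompactOperator (ρ f * T) ∧ IsCompactOperator (T * ρ f)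

/-- The support of `T`: the pairs `(y, x)` such that `χ_V T χ_U ≠ 0` for all (open) neighbourhoods
`U` of `x` and `V` of `y`. -/
def opSupport (ρ : C₀(X, ℂ) →⋆ₙₐ[ℂ] (H →L[ℂ] H)) (T : H →L[ℂ] H) : Set (X × X) :=
  {p | ∀ U V : Set X, IsOpen U → p.2 ∈ U → IsOpen V → p.1 ∈ V → chi ρ V * T * chi ρ U ≠ 0}

/-- The propagation of `T`, with values in `[0, ∞]`. -/
def propagation (ρ : C₀(X, ℂ) →⋆ₙₐ[ℂ] (H →L[ℂ] H)) (T : H →L[ℂ] H) : ℝ≥0∞ :=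
  ⨆ p ∈ opSupport ρ T, edist p.1 p.2

/-- The Roe algebra `C*(H_X)`: the norm closure of the set of locally compact operators of finite
propagation. -/
def roeAlgebra (ρ : C₀(X, ℂ) →⋆ₙₐ[ℂ] (H →L[ℂ] H)) : Set (H →L[ℂ] H) :=
  closure {T | IsLocallyCompact ρ T ∧ propagation ρ T < ⊤}

/-- The distance between two subsets, `∞` if one of them is empty. -/
def setDist (A B : Set X) : ℝ≥0∞ := ⨅ a ∈ A, ⨅ b ∈ B, edist a b

variable [MeasurableSpace X]

/-- `T` is quasi-local: for every `ε > 0` there is `R > 0` with `‖χ_A T χ_B‖ < ε` for all Borel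
sets `A`, `B` with `d(A, B) > R`. -/
def IsQuasiLocal (ρ : C₀(X, ℂ) →⋆ₙₐ[ℂ] (H →L[ℂ] H)) (T : H →L[ℂ] H) : Prop :=
  ∀ ε : ℝ, 0 < ε → ∃ R : ℝ, 0 < R ∧ ∀ A B : Set X, MeasurableSet A → MeasurableSet B →
    ENNReal.ofReal R < setDist A B → ‖chi ρ A * T * chi ρ B‖ < ε

/-- The quasi-local algebra `C*_q(H_X)`. -/
def quasiLocalAlgebra (ρ : C₀(X, ℂ) →⋆ₙₐ[ℂ] (H →L[ℂ] H)) : Set (H →L[ℂ] H) :=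
  {T | IsLocallyCompact ρ T ∧ IsQuasiLocal ρ T}

/-! ### Strongly quasi-local algebras -/

section Strong

variable {K : Type*} [NormedAddCommGroup K] [InnerProductSpace ℂ K] [CompleteSpace K]

/-- The space of compact operators on `K`, with the operator norm. -/
abbrev Compacts (K : Type*) [NormedAddCommGroup K] [InnerProductSpace ℂ K] :
    Submodule ℂ (K →L[ℂ] K) :=
  compactOperator (RingHom.id ℂ) K K

/-- The Hilbert space tensor product: the completion of the algebraic tensor product. -/
abbrev HTensor (H K : Type*) [NormedAddCommGroup H] [InnerProductSpace ℂ H]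
    [NormedAddCommGroup K] [InnerProductSpace ℂ K] : Type _ :=
  UniformSpace.Completion (H ⊗[ℂ] K)

/-- The operator `S ⊗ a` on the Hilbert space tensor product. -/
def opTensor (S : H →L[ℂ] H) (a : K →L[ℂ] K) : HTensor H K →L[ℂ] HTensor H K :=
  (TensorProduct.mapL S a).completion

/-- `L` is the operator `Λ(g) = (SOT) ∑ₙ χ_{Eₙ} ⊗ aₙ` of the bounded countably-valued map
`g = ∑ₙ aₙ χ_{Eₙ}`, where `(Eₙ)` is a Borel partition of `X`. -/
def IsCountableLambda (ρ : C₀(X, ℂ) →⋆ₙₐ[ℂ] (H →L[ℂ] H)) (g : X → Compacts K)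
    (L : HTensor H K →L[ℂ] HTensor H K) : Prop :=
  ∃ (E : ℕ → Set X) (a : ℕ → Compacts K),
    (∀ n, MeasurableSet (E n)) ∧ Pairwise (fun m n => Disjoint (E m) (E n)) ∧
    (⋃ n, E n) = Set.univ ∧ (∀ n, ∀ x ∈ E n, g x = a n) ∧
    BddAbove (Set.range fun n => ‖a n‖) ∧
    ∀ ξ, HasSum (fun n => opTensor (chi ρ (E n)) (a n : K →L[ℂ] K) ξ) (L ξ)

/-- `L` is a norm limit of the operators `Λ(gₙ)` for a sequence of bounded countably-valued maps
`gₙ` that converges to `g` uniformly. -/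
def IsLambda (ρ : C₀(X, ℂ) →⋆ₙₐ[ℂ] (H →L[ℂ] H)) (g : X → Compacts K)
    (L : HTensor H K →L[ℂ] HTensor H K) : Prop :=
  ∃ (gs : ℕ → X → Compacts K) (Ls : ℕ → HTensor H K →L[ℂ] HTensor H K),
    (∀ n, IsCountableLambda ρ (gs n) (Ls n)) ∧ TendstoUniformly gs g Filter.atTop ∧
    Filter.Tendsto Ls Filter.atTop (𝓝 L)

open Classical in
/-- The operator `Λ(g)` of a bounded strongly measurable map `g`: the operator `L` with
`IsLambda ρ g L`, which exists and is unique for such `g`. -/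
def Lambda (ρ : C₀(X, ℂ) →⋆ₙₐ[ℂ] (H →L[ℂ] H)) (g : X → Compacts K) :
    HTensor H K →L[ℂ] HTensor H K :=
  if h : ∃ L, IsLambda ρ g L then h.choose else 0

/-- `g` has `(δ, R)`-variation. -/
def HasVariation (g : X → Compacts K) (δ R : ℝ) : Prop :=
  ∀ x y, dist x y < R → ‖g x - g y‖ < δ

variable (K) in
/-- `T` is strongly quasi-local: for every `ε > 0` there are `δ, R > 0` such that
`‖[T ⊗ 1, Λ(g)]‖ < ε` for every strongly measurable map `g` from `X` to the closed unit ball of the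
compact operators on `K` that has `(δ, R)`-variation. -/
def IsStronglyQuasiLocal (ρ : C₀(X, ℂ) →⋆ₙₐ[ℂ] (H →L[ℂ] H)) (T : H →L[ℂ] H) : Prop :=
  ∀ ε : ℝ, 0 < ε → ∃ δ : ℝ, 0 < δ ∧ ∃ R : ℝ, 0 < R ∧ ∀ g : X → Compacts K,
    MeasureTheory.StronglyMeasurable g → (∀ x, ‖g x‖ ≤ 1) → HasVariation g δ R →
      ‖opTensor T (1 : K →L[ℂ] K) * Lambda ρ g - Lambda ρ g * opTensor T (1 : K →L[ℂ] K)‖ < ε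

variable (K) in
/-- The strongly quasi-local algebra `C*_sq(H_X)`, formed with the auxiliary Hilbert space `K`. -/
def stronglyQuasiLocalAlgebra (ρ : C₀(X, ℂ) →⋆ₙₐ[ℂ] (H →L[ℂ] H)) : Set (H →L[ℂ] H) :=
  {T | IsLocallyCompact ρ T ∧ IsStronglyQuasiLocal K ρ T}

end Strong

end Modules

end

end CoarseRoe

/-!
The inclusions form a cycle: `C*_sq ⊆ C*_q` always, `C* ⊆ C*_sq` under bounded geometry, and
`C*_q ⊆ C*` under bounded geometry and Property A.

* The projections `χ_E` form a spectral measure: the vector states of `ρ` are given by finite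
  measures (`exists_spectralMeasure`), so countable Borel partitions give resolutions of the
  identity (`isResolution_chi`).  Norm estimates are made block by block over such resolutions.
  Of the operator `Λ(g)` only one property is used, `isLocalized_Lambda`: it commutes with every
  `χ_E ⊗ 1`, and it is within `η` of `1 ⊗ a` over a Borel set on which `g` is within `η` of `a`.

* `C*_sq ⊆ C*_q` (`IsStronglyQuasiLocal.isQuasiLocal`): if `d(A, B)` is large, there is a slowly
  varying function `f` with `f = 1` on `A` and `f = 0` on `B`.  For a rank one projection `p`, the
  corner of `[T ⊗ 1, Λ(f p)]` at `(A, B)` is, up to sign, `χ_A T χ_B ⊗ p`.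

* `C* ⊆ C*_sq` (`roeAlgebra_subset_stronglyQuasiLocalAlgebra`): `X` is partitioned into cells of
  bounded radius.  If `T` has finite propagation, then the block matrix of `[T ⊗ 1, Λ(g)]` over the
  cells has uniformly few nonzero entries in each row and column, and they are small since `g`
  hardly varies over neighbouring cells.  Strong quasi-locality and local compactness pass to norm
  limits.

* `C*_q ⊆ C*` (`quasiLocalAlgebra_subset_roeAlgebra`): the sets `A x` of Property A yield slowly
  varying unit vectors `e γ`, which are orthogonal for distant `γ`.  The operator `T'` with entries
  `⟪e γ, e γ'⟫ χ_γ T χ_γ'` is a compression of `T ⊗ 1`.  Hence it is bounded, it is locally compact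
  of finite propagation, its off-diagonal corners are bounded by those of `T`, and `(T - T') χ_E` is
  small for each `E` of bounded diameter (`norm_sub_compression_mul_chi_le`).  These two smallness
  properties bound `‖T - T'‖` by `exists_norm_le_of_forall_norm_mul_chi_le`.  Indeed, Property A
  splits off from every vector at most a small part such that the rest is supported on far apart
  sets of bounded diameter (`exists_sparse_subset`); over these sets `T - T'` is block diagonal up
  to an error that an average over subsets controls (`norm_sum_offDiag_le`).
-/

namespace CoarseRoe

/-! ### Orthogonal resolutions of the identity -/

section Resolution

variable {ι : Type*} {G G' : Type*} [NormedAddCommGroup G] [InnerProductSpace ℂ G]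
  [NormedAddCommGroup G'] [InnerProductSpace ℂ G']

/-- A family of pairwise orthogonal projections whose strong sum is the identity. -/
structure IsResolution (P : ι → G →L[ℂ] G) : Prop where
  symm : ∀ i u v, inner ℂ (P i u) v = inner ℂ u (P i v)
  idem : ∀ i u, P i (P i u) = P i u
  orth : ∀ i j, i ≠ j → ∀ u, P i (P j u) = 0
  hasSum : ∀ u, HasSum (fun i => P i u) u

theorem norm_sum_sq_of_inner_eq_zero {x : ι → G} {s : Finset ι}
    (h : ∀ i ∈ s, ∀ j ∈ s, i ≠ j → inner ℂ (x i) (x j) = 0) :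
    ‖∑ i ∈ s, x i‖ ^ 2 = ∑ i ∈ s, ‖x i‖ ^ 2 := by
  classical
  induction s using Finset.induction_on with
  | empty => simp
  | insert a s ha ih =>
    rw [Finset.sum_insert ha, Finset.sum_insert ha, ← ih fun i hi j hj => h i
      (Finset.mem_insert_of_mem hi) j (Finset.mem_insert_of_mem hj)]
    have h0 : inner ℂ (x a) (∑ i ∈ s, x i) = 0 := by
      rw [inner_sum]
      refine Finset.sum_eq_zero fun i hi => h a (Finset.mem_insert_self _ _) i
        (Finset.mem_insert_of_mem hi) ?_
      rintro rfl
      exact ha hi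
    have := norm_add_sq_eq_norm_sq_add_norm_sq_of_inner_eq_zero (𝕜 := ℂ) _ _ h0
    simpa only [pow_two] using this

namespace IsResolution

variable {P : ι → G →L[ℂ] G} {Q : ι → G' →L[ℂ] G'}

theorem inner_eq_zero (hP : IsResolution P) {i j : ι} (hij : i ≠ j) (u v : G) :
    inner ℂ (P i u) (P j v) = 0 := by
  rw [hP.symm, hP.orth i j hij, inner_zero_right]

theorem inner_self_apply (hP : IsResolution P) (i : ι) (u : G) :
    (inner ℂ u (P i u)).re = ‖P i u‖ ^ 2 := by
  rw [← hP.idem, ← hP.symm, hP.idem]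
  exact inner_self_eq_norm_sq (𝕜 := ℂ) _

theorem hasSum_norm_sq (hP : IsResolution P) (u : G) :
    HasSum (fun i => ‖P i u‖ ^ 2) (‖u‖ ^ 2) := by
  have h := Complex.hasSum_re ((hP.hasSum u).mapL (innerSL ℂ u))
  simp only [innerSL_apply_apply, hP.inner_self_apply] at h
  rwa [show (inner ℂ u u).re = ‖u‖ ^ 2 from inner_self_eq_norm_sq (𝕜 := ℂ) _] at h

/-- A vector is controlled by another one as soon as its components are. -/
theorem norm_le_of_forall (hP : IsResolution P) (hQ : IsResolution Q) {c : ℝ} (hc : 0 ≤ c)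
    {x : G} {y : G'} (h : ∀ i, ‖P i x‖ ≤ c * ‖Q i y‖) : ‖x‖ ≤ c * ‖y‖ := by
  refine le_of_sq_le_sq ?_ (by positivity)
  rw [mul_pow]
  refine hasSum_le (fun i => ?_) (hP.hasSum_norm_sq x) ((hQ.hasSum_norm_sq y).mul_left (c ^ 2))
  rw [← mul_pow]
  gcongr
  exact h i

/-- An operator that commutes with all projections is as large as its largest diagonal block. -/
theorem norm_le_of_commute (hP : IsResolution P) {c : ℝ} (hc : 0 ≤ c) {D : G →L[ℂ] G}
    (hD : ∀ i, P i * D = D * P i) (h : ∀ i, ‖D * P i‖ ≤ c) : ‖D‖ ≤ c := by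
  refine D.opNorm_le_bound hc fun u => hP.norm_le_of_forall hP hc fun i => ?_
  calc ‖P i (D u)‖ = ‖(D * P i) (P i u)‖ := by
        change ‖(P i * D) u‖ = ‖D (P i (P i u))‖
        rw [hD, hP.idem]
        rfl
    _ ≤ ‖D * P i‖ * ‖P i u‖ := ContinuousLinearMap.le_opNorm _ _
    _ ≤ c * ‖P i u‖ := by gcongr; exact h i

theorem ext_right (hP : IsResolution P) {S T : G →L[ℂ] G'} (h : ∀ i u, S (P i u) = T (P i u)) :
    S = T := by
  ext u
  refine ((hP.hasSum u).mapL S).unique ?_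
  simpa only [h] using (hP.hasSum u).mapL T

theorem ext_left (hP : IsResolution P) {S T : G' →L[ℂ] G} (h : ∀ i u, P i (S u) = P i (T u)) :
    S = T := by
  ext u
  refine (hP.hasSum (S u)).unique ?_
  simpa only [h] using hP.hasSum (T u)

theorem eq_sum_of_forall_notMem (hP : IsResolution P) {s : Finset ι} {x : G}
    (h : ∀ i ∉ s, P i x = 0) : x = ∑ i ∈ s, P i x :=
  (hP.hasSum x).unique (hasSum_sum_of_ne_finset_zero h)

/-- A bounded block diagonal family of operators has a strong sum. -/
theorem exists_strongSum [CompleteSpace G] (hP : IsResolution P) (hQ : IsResolution Q)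
    {S : ι → G' →L[ℂ] G} {M : ℝ} (hPS : ∀ i u, P i (S i u) = S i u)
    (hSQ : ∀ i u, S i (Q i u) = S i u) (hM : ∀ i, ‖S i‖ ≤ M) :
    ∃ L : G' →L[ℂ] G, ∀ u, HasSum (fun i => S i u) (L u) := by
  classical
  have hb : ∀ i u, ‖S i u‖ ≤ M * ‖Q i u‖ := fun i u => by
    rw [← hSQ]
    exact ((S i).le_opNorm _).trans (by gcongr; exact hM i)
  have hsum : ∀ u, Summable fun i => S i u := by
    intro u
    have h2 : Summable fun i => ‖S i u‖ ^ 2 := by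
      refine Summable.of_nonneg_of_le (fun _ => sq_nonneg _) (fun i => ?_)
        ((hQ.hasSum_norm_sq u).summable.mul_left (M ^ 2))
      rw [← mul_pow]
      gcongr
      exact hb i u
    rw [summable_iff_vanishing_norm] at h2 ⊢
    intro ε hε
    obtain ⟨s, hs⟩ := h2 (ε ^ 2) (by positivity)
    refine ⟨s, fun t ht => ?_⟩
    have h3 := hs t ht
    rw [Real.norm_of_nonneg (Finset.sum_nonneg fun _ _ => sq_nonneg _),
      ← norm_sum_sq_of_inner_eq_zero] at h3
    · exact lt_of_pow_lt_pow_left₀ 2 hε.le h3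
    · intro i _ j _ hij
      rw [← hPS i, ← hPS j]
      exact hP.inner_eq_zero hij _ _
  have hPL : ∀ i u, P i (∑' j, S j u) = S i u := by
    intro i u
    have h1 := (hsum u).hasSum.mapL (P i)
    refine h1.unique ?_
    rw [← hPS i u]
    refine hasSum_single i fun j hj => ?_
    rw [← hPS j, hP.orth i j hj.symm]
  rcases isEmpty_or_nonempty ι with hι | ⟨⟨i₀⟩⟩
  · exact ⟨0, fun u => by simp [hasSum_empty]⟩
  have hM0 : 0 ≤ M := (norm_nonneg _).trans (hM i₀)
  refine ⟨LinearMap.mkContinuous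
    { toFun := fun u => ∑' i, S i u
      map_add' := fun u v => by simp only [map_add]; exact (hsum u).tsum_add (hsum v)
      map_smul' := fun c u => by
        simp only [map_smul, RingHom.id_apply]; exact (hsum u).tsum_const_smul c } M fun u => ?_,
    fun u => (hsum u).hasSum⟩
  refine hP.norm_le_of_forall hQ hM0 fun i => ?_
  change ‖P i (∑' j, S j u)‖ ≤ _
  rw [hPL]
  exact hb i u

/-- A Schur test: a block matrix with blocks of norm at most `c` and at most `N` nonzero blocks in
each row and column has norm at most `N * c`. -/
theorem norm_le_of_sparse (hP : IsResolution P) {D : G →L[ℂ] G} {c : ℝ}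
    (hc : 0 ≤ c) {N : ℕ} (nbr : ι → Finset ι) (hcard : ∀ i, (nbr i).card ≤ N)
    (hsymm : ∀ i j, j ∈ nbr i → i ∈ nbr j) (h0 : ∀ i, ∀ j ∉ nbr i, P i * D * P j = 0)
    (hD : ∀ i, ∀ j ∈ nbr i, ‖P i * D * P j‖ ≤ c) : ‖D‖ ≤ N * c := by
  classical
  refine D.opNorm_le_bound (by positivity) fun u => ?_
  refine le_of_sq_le_sq ?_ (by positivity)
  have hrow : ∀ i, ‖P i (D u)‖ ^ 2 ≤ c ^ 2 * N * ∑ j ∈ nbr i, ‖P j u‖ ^ 2 := by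
    intro i
    have h1 : P i (D u) = ∑ j ∈ nbr i, (P i * D * P j) (P j u) := by
      have h2 := (hP.hasSum u).mapL (P i * D)
      refine h2.unique ?_
      have h3 : ∀ j, (P i * D) (P j u) = (P i * D * P j) (P j u) := fun j => by
        change _ = (P i * D) (P j (P j u))
        rw [hP.idem]
      simp only [h3]
      refine hasSum_sum_of_ne_finset_zero fun j hj => ?_
      rw [h0 i j hj]
      rfl
    have h4 : ‖P i (D u)‖ ≤ c * ∑ j ∈ nbr i, ‖P j u‖ := by
      rw [h1, Finset.mul_sum]
      refine (norm_sum_le _ _).trans (Finset.sum_le_sum fun j hj => ?_)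
      exact (ContinuousLinearMap.le_opNorm _ _).trans (by gcongr; exact hD i j hj)
    calc ‖P i (D u)‖ ^ 2 ≤ (c * ∑ j ∈ nbr i, ‖P j u‖) ^ 2 := by gcongr
      _ = c ^ 2 * (∑ j ∈ nbr i, ‖P j u‖) ^ 2 := by ring
      _ ≤ c ^ 2 * ((nbr i).card * ∑ j ∈ nbr i, ‖P j u‖ ^ 2) := by
        gcongr; exact sq_sum_le_card_mul_sum_sq
      _ ≤ c ^ 2 * (N * ∑ j ∈ nbr i, ‖P j u‖ ^ 2) := by
        gcongr
        exact hcard i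
      _ = _ := by ring
  refine hasSum_le_of_sum_le (hP.hasSum_norm_sq (D u)) fun s => ?_
  have hswap : ∑ i ∈ s, ∑ j ∈ nbr i, ‖P j u‖ ^ 2 ≤ N * ‖u‖ ^ 2 := by
    calc ∑ i ∈ s, ∑ j ∈ nbr i, ‖P j u‖ ^ 2
        = ∑ j ∈ s.biUnion nbr, ∑ i ∈ s with j ∈ nbr i, ‖P j u‖ ^ 2 := by
          refine Finset.sum_comm' fun i j => ?_
          simp only [Finset.mem_filter, Finset.mem_biUnion]
          exact ⟨fun h => ⟨h, i, h⟩, fun h => h.1⟩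
      _ ≤ ∑ j ∈ s.biUnion nbr, N * ‖P j u‖ ^ 2 := by
          refine Finset.sum_le_sum fun j _ => ?_
          rw [Finset.sum_const, nsmul_eq_mul]
          gcongr
          refine (Finset.card_le_card fun i hi => ?_).trans (hcard j)
          exact hsymm i j (Finset.mem_filter.mp hi).2
      _ = N * ∑ j ∈ s.biUnion nbr, ‖P j u‖ ^ 2 := by rw [Finset.mul_sum]
      _ ≤ N * ‖u‖ ^ 2 := by
          gcongr
          exact sum_le_hasSum _ (fun _ _ => sq_nonneg _) (hP.hasSum_norm_sq u)
  calc ∑ i ∈ s, ‖P i (D u)‖ ^ 2 ≤ ∑ i ∈ s, c ^ 2 * N * ∑ j ∈ nbr i, ‖P j u‖ ^ 2 :=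
        Finset.sum_le_sum fun i _ => hrow i
    _ = c ^ 2 * N * ∑ i ∈ s, ∑ j ∈ nbr i, ‖P j u‖ ^ 2 := by rw [Finset.mul_sum]
    _ ≤ c ^ 2 * N * (N * ‖u‖ ^ 2) := by gcongr
    _ = (N * c * ‖u‖) ^ 2 := by ring

end IsResolution

end Resolution

/-! ### The spectral measure of a module -/

section Spectral

open MeasureTheory

variable {X : Type*} [MetricSpace X]
  {H : Type*} [NormedAddCommGroup H] [InnerProductSpace ℂ H] [CompleteSpace H]
  (ρ : C₀(X, ℂ) →⋆ₙₐ[ℂ] (H →L[ℂ] H))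

theorem zeroAtInfty_norm_le {f : C₀(X, ℂ)} {c : ℝ} (hc : 0 ≤ c) (h : ∀ x, ‖f x‖ ≤ c) : ‖f‖ ≤ c := by
  rw [← ZeroAtInftyContinuousMap.norm_toBCF_eq_norm]
  exact (BoundedContinuousFunction.norm_le hc).mpr h

theorem zeroAtInfty_norm_apply_le (f : C₀(X, ℂ)) (x : X) : ‖f x‖ ≤ ‖f‖ := by
  rw [← ZeroAtInftyContinuousMap.norm_toBCF_eq_norm]
  exact f.toBCF.norm_coe_le_norm x

theorem continuous_rep : Continuous ρ :=
  AddMonoidHomClass.continuous_of_bound ρ 1 fun f => by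
    simpa using NonUnitalStarAlgHom.norm_apply_le ρ f

/-- A real function of compact support, as an element of `C₀(X, ℂ)`. -/
noncomputable def ofCompactSupport (f : CompactlySupportedContinuousMap X ℝ) : C₀(X, ℂ) where
  toFun x := (f x : ℂ)
  continuous_toFun := by fun_prop
  zero_at_infty' := by
    have h : HasCompactSupport fun x => (f x : ℂ) :=
      f.hasCompactSupport.comp_left (g := fun t : ℝ => (t : ℂ)) rfl
    exact h.is_zero_at_infty

@[simp]
theorem ofCompactSupport_apply (f : CompactlySupportedContinuousMap X ℝ) (x : X) :
    ofCompactSupport f x = (f x : ℂ) := rfl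

theorem exists_hasCompactSupport_norm_sub_le [ProperSpace X] (f : C₀(X, ℂ)) {ε : ℝ} (hε : 0 < ε) :
    ∃ g : C₀(X, ℂ), HasCompactSupport g ∧ ‖f - g‖ ≤ ε := by
  have hK : IsCompact {x | ε ≤ ‖f x‖} := by
    have h1 : ∀ᶠ x in Filter.cocompact X, ‖f x‖ < ε :=
      (tendsto_zero_iff_norm_tendsto_zero.mp f.zero_at_infty').eventually (gt_mem_nhds hε)
    obtain ⟨t, ht, hts⟩ := Filter.mem_cocompact.mp h1
    refine ht.of_isClosed_subset (isClosed_le continuous_const (by fun_prop)) fun x hx => ?_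
    by_contra hxt
    have h2 : ‖f x‖ < ε := hts hxt
    exact absurd hx (not_le.mpr h2)
  -- `f` is multiplied by a cutoff function that is `1` where `‖f‖ ≥ ε`.
  obtain ⟨r, hr1, -, hrc, hr⟩ := exists_continuous_one_zero_of_isCompact hK isClosed_empty
    (Set.disjoint_empty _)
  have hrc' : HasCompactSupport fun x => (r x : ℂ) :=
    hrc.comp_left (g := fun t : ℝ => (t : ℂ)) rfl
  have hs : HasCompactSupport fun x => (r x : ℂ) * f x := hrc'.mul_right
  refine ⟨⟨⟨fun x => (r x : ℂ) * f x, by fun_prop⟩, hs.is_zero_at_infty⟩, hs,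
    zeroAtInfty_norm_le hε.le fun x => ?_⟩
  change ‖f x - (r x : ℂ) * f x‖ ≤ ε
  by_cases hx : ε ≤ ‖f x‖
  · rw [hr1 hx]
    simpa using hε.le
  · rw [show f x - (r x : ℂ) * f x = ((1 - r x : ℝ) : ℂ) * f x by push_cast; ring, norm_mul,
      Complex.norm_real, Real.norm_of_nonneg (by linarith [(hr x).2])]
    have := (hr x).1
    have h3 := norm_nonneg (f x)
    nlinarith

/-- The positive functional `f ↦ ⟪v, ρ(f) v⟫` on real functions of compact support. -/
noncomputable def vectorFunctional (v : H) : CompactlySupportedContinuousMap X ℝ →ₚ[ℝ] ℝ :=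
  PositiveLinearMap.mk₀
    { toFun := fun f => (inner ℂ v (ρ (ofCompactSupport f) v)).re
      map_add' := fun f g => by
        have : ofCompactSupport (f + g) = ofCompactSupport f + ofCompactSupport g := by
          ext x; simp
        rw [this, map_add, add_apply, inner_add_right, Complex.add_re]
      map_smul' := fun c f => by
        have : ofCompactSupport (c • f) = (c : ℂ) • ofCompactSupport f := by
          ext x; simp
        rw [this, map_smul, smul_apply, inner_smul_right, Complex.re_ofReal_mul]
        rfl }
    (by
      intro f hf
      -- `f = g* g` with `g = √f`.
      set g : CompactlySupportedContinuousMap X ℝ :=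
        ⟨⟨fun x => Real.sqrt (f x), by fun_prop⟩,
          f.hasCompactSupport.comp_left (g := Real.sqrt) Real.sqrt_zero⟩ with hg
      have h1 : ofCompactSupport f = star (ofCompactSupport g) * ofCompactSupport g := by
        ext x
        have hx : Real.sqrt (f x) * Real.sqrt (f x) = f x := Real.mul_self_sqrt (hf x)
        simp only [ofCompactSupport_apply, ZeroAtInftyContinuousMap.mul_apply,
          ZeroAtInftyContinuousMap.star_apply, Complex.star_def, Complex.conj_ofReal, hg,
          CompactlySupportedContinuousMap.coe_mk, ContinuousMap.coe_mk]
        rw [← Complex.ofReal_mul, hx]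
      have h2 : inner ℂ v (ρ (ofCompactSupport f) v)
          = inner ℂ (ρ (ofCompactSupport g) v) (ρ (ofCompactSupport g) v) := by
        rw [inner_rep_left, h1, map_mul]
        rfl
      change 0 ≤ (inner ℂ v (ρ (ofCompactSupport f) v)).re
      rw [h2]
      exact inner_self_nonneg (𝕜 := ℂ))

theorem vectorFunctional_apply (v : H) (f : CompactlySupportedContinuousMap X ℝ) :
    vectorFunctional ρ v f = (inner ℂ v (ρ (ofCompactSupport f) v)).re := rfl

theorem coe_vectorFunctional (v : H) (f : CompactlySupportedContinuousMap X ℝ) :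
    (vectorFunctional ρ v f : ℂ) = inner ℂ v (ρ (ofCompactSupport f) v) := by
  rw [vectorFunctional_apply]
  refine Complex.conj_eq_iff_re.mp ?_
  rw [inner_conj_symm, inner_rep_left]
  congr 3
  ext x
  simp

theorem norm_ofCompactSupport_le {f : CompactlySupportedContinuousMap X ℝ} {c : ℝ} (hc : 0 ≤ c)
    (hf : ∀ x, |f x| ≤ c) : ‖ofCompactSupport f‖ ≤ c :=
  zeroAtInfty_norm_le hc fun x => by
    rw [ofCompactSupport_apply, Complex.norm_real]
    exact hf x

theorem norm_rep_apply_le (f : C₀(X, ℂ)) (v : H) : ‖ρ f v‖ ≤ ‖f‖ * ‖v‖ :=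
  ((ρ f).le_opNorm v).trans (by gcongr; exact NonUnitalStarAlgHom.norm_apply_le ρ f)

theorem integrable_zeroAtInfty [MeasurableSpace X] [BorelSpace X] (μ : Measure X)
    [IsFiniteMeasure μ] (f : C₀(X, ℂ)) :
    Integrable f μ := by
  have hf : Continuous f := f.continuous
  refine ⟨(hf.measurable).aestronglyMeasurable, ?_⟩
  exact HasFiniteIntegral.of_bounded (C := ‖f‖)
    (Filter.Eventually.of_forall fun x => zeroAtInfty_norm_apply_le f x)

/-- Every vector has a finite spectral measure, by the Riesz–Markov–Kakutani theorem. -/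
theorem exists_spectralMeasure [ProperSpace X] [MeasurableSpace X] [BorelSpace X] (v : H) :
    ∃ μ : Measure X, IsFiniteMeasure μ ∧
      ∀ f : C₀(X, ℂ), inner ℂ v (ρ f v) = ∫ x, f x ∂μ := by
  set μ := RealRMK.rieszMeasure (vectorFunctional ρ v) with hμ
  have hfin : μ Set.univ ≤ ENNReal.ofReal (‖v‖ ^ 2) := by
    rw [isOpen_univ.measure_eq_iSup_isCompact]
    refine iSup₂_le fun K _ => iSup_le fun hK => ?_
    obtain ⟨r, hr1, -, hrc, hr⟩ := exists_continuous_one_zero_of_isCompact hK isClosed_empty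
      (Set.disjoint_empty _)
    refine (RealRMK.rieszMeasure_le_of_eq_one (vectorFunctional ρ v) (f := ⟨r, hrc⟩)
      (fun x => (hr x).1) hK hr1).trans (ENNReal.ofReal_le_ofReal ?_)
    rw [vectorFunctional_apply]
    have h1 : ‖ofCompactSupport (⟨r, hrc⟩ : CompactlySupportedContinuousMap X ℝ)‖ ≤ 1 :=
      norm_ofCompactSupport_le zero_le_one fun x => abs_le.mpr
        ⟨by have := (hr x).1; simp only [CompactlySupportedContinuousMap.coe_mk]; linarith,
          (hr x).2⟩
    calc _ ≤ ‖(inner ℂ v (ρ (ofCompactSupport ⟨r, hrc⟩) v) : ℂ)‖ := Complex.re_le_norm _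
      _ ≤ ‖v‖ * ‖ρ (ofCompactSupport ⟨r, hrc⟩) v‖ := norm_inner_le_norm _ _
      _ ≤ ‖v‖ * (1 * ‖v‖) := by
        gcongr
        exact (norm_rep_apply_le ρ _ _).trans (by gcongr)
      _ = ‖v‖ ^ 2 := by ring
  have hμfin : IsFiniteMeasure μ := ⟨hfin.trans_lt ENNReal.ofReal_lt_top⟩
  refine ⟨μ, hμfin, ?_⟩
  -- The formula passes from real functions of compact support to complex ones, and then to all of
  -- `C₀(X)` by density.
  have hreal : ∀ f : CompactlySupportedContinuousMap X ℝ,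
      inner ℂ v (ρ (ofCompactSupport f) v) = ∫ x, ofCompactSupport f x ∂μ := by
    intro f
    rw [← coe_vectorFunctional, ← RealRMK.integral_rieszMeasure (vectorFunctional ρ v) f,
      ← integral_complex_ofReal]
    rfl
  have hcs : ∀ f : C₀(X, ℂ), HasCompactSupport f →
      inner ℂ v (ρ f v) = ∫ x, f x ∂μ := by
    intro f hf
    set f₁ : CompactlySupportedContinuousMap X ℝ :=
      ⟨⟨fun x => (f x).re, by fun_prop⟩, hf.comp_left (g := Complex.re) rfl⟩
    set f₂ : CompactlySupportedContinuousMap X ℝ :=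
      ⟨⟨fun x => (f x).im, by fun_prop⟩, hf.comp_left (g := Complex.im) rfl⟩
    have hf12 : f = ofCompactSupport f₁ + Complex.I • ofCompactSupport f₂ := by
      ext x
      change f x = ((f x).re : ℂ) + Complex.I * ((f x).im : ℂ)
      rw [mul_comm, Complex.re_add_im]
    rw [hf12, map_add, map_smul, add_apply, smul_apply, inner_add_right,
      inner_smul_right, hreal, hreal, ← integral_const_mul, ← integral_add]
    · rfl
    · exact integrable_zeroAtInfty μ _
    · exact (integrable_zeroAtInfty μ _).const_mul _
  intro f
  refine eq_of_forall_dist_le fun ε hε => ?_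
  set M : ℝ := ‖v‖ ^ 2 + μ.real Set.univ + 1 with hM
  have hM0 : 0 < M := by positivity
  obtain ⟨g, hg, hfg⟩ := exists_hasCompactSupport_norm_sub_le f (ε := ε / M) (by positivity)
  have h1 : ‖inner ℂ v (ρ f v) - inner ℂ v (ρ g v)‖ ≤ ‖v‖ ^ 2 * (ε / M) := by
    rw [← inner_sub_right, ← sub_apply, ← map_sub]
    calc _ ≤ ‖v‖ * ‖ρ (f - g) v‖ := norm_inner_le_norm _ _
      _ ≤ ‖v‖ * (ε / M * ‖v‖) := by
        gcongr
        exact (norm_rep_apply_le ρ _ _).trans (by gcongr)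
      _ = _ := by ring
  have h2 : ‖∫ x, f x ∂μ - ∫ x, g x ∂μ‖ ≤ ε / M * μ.real Set.univ := by
    rw [← integral_sub (integrable_zeroAtInfty μ f) (integrable_zeroAtInfty μ g)]
    refine norm_integral_le_of_norm_le_const (Filter.Eventually.of_forall fun x => ?_)
    exact (zeroAtInfty_norm_apply_le (f - g) x).trans hfg
  rw [dist_eq_norm]
  calc ‖inner ℂ v (ρ f v) - ∫ x, f x ∂μ‖
      = ‖(inner ℂ v (ρ f v) - inner ℂ v (ρ g v)) - (∫ x, f x ∂μ - ∫ x, g x ∂μ)‖ := by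
        rw [hcs g hg]; congr 1; ring
    _ ≤ ‖v‖ ^ 2 * (ε / M) + ε / M * μ.real Set.univ :=
        (norm_sub_le _ _).trans (add_le_add h1 h2)
    _ ≤ (ε / M) * M := by
        have : 0 < ε / M := by positivity
        rw [hM]
        nlinarith
    _ = ε := by field_simp

/-! ### The projection-valued measure -/

theorem chi_inner (E : Set X) (u v : H) : inner ℂ (chi ρ E u) v = inner ℂ u (chi ρ E v) :=
  Submodule.inner_starProjection_left_eq_right _ _ _

theorem chi_chi_of_subset {E F : Set X} (h : E ⊆ F) (v : H) :
    chi ρ E (chi ρ F v) = chi ρ E v := by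
  have hle : borelRange ρ E ≤ borelRange ρ F := le_iInf fun U =>
    iInf_le (fun U : {U : Set X // IsOpen U ∧ E ⊆ U} => openRange ρ U)
      ⟨U.1, U.2.1, h.trans U.2.2⟩
  exact congrArg (fun T : H →L[ℂ] H => T v)
    (Submodule.starProjection_comp_starProjection_of_le hle)

theorem chi_idem (E : Set X) (v : H) : chi ρ E (chi ρ E v) = chi ρ E v :=
  chi_chi_of_subset ρ subset_rfl v

theorem norm_chi_le (E : Set X) : ‖chi ρ E‖ ≤ 1 := Submodule.starProjection_norm_le _

theorem norm_chi_apply_le (E : Set X) (v : H) : ‖chi ρ E v‖ ≤ ‖v‖ :=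
  Submodule.norm_starProjection_apply_le _ _

theorem inner_chi_self (E : Set X) (v : H) : inner ℂ (chi ρ E v) v = (‖chi ρ E v‖ ^ 2 : ℝ) := by
  rw [← chi_idem, chi_inner, inner_self_eq_norm_sq_to_K, chi_idem]
  push_cast
  rfl

theorem adjoint_chi (E : Set X) : ContinuousLinearMap.adjoint (chi ρ E) = chi ρ E := by
  symm
  exact (ContinuousLinearMap.eq_adjoint_iff _ _).mpr fun u v => chi_inner ρ E u v

variable {ρ}

theorem chi_univ (hρ : IsModule ρ) : chi ρ Set.univ = 1 := by
  have h1 : borelRange ρ Set.univ = ⊤ := by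
    refine top_le_iff.mp (le_iInf fun U => ?_)
    rw [Set.univ_subset_iff.mp U.2.2, ← hρ.nondegenerate]
    refine Submodule.topologicalClosure_mono (Submodule.span_mono ?_)
    rintro w ⟨f, v, rfl⟩
    exact ⟨f, fun x hx => absurd (Set.mem_univ x) hx, v, rfl⟩
  ext v
  exact Submodule.starProjection_eq_self_iff.mpr (h1 ▸ Submodule.mem_top)

theorem rep_chi_of_eq_one {f : C₀(X, ℂ)} {U E : Set X} (hU : IsOpen U) (hEU : E ⊆ U)
    (hf : ∀ x ∈ U, f x = 1) : ρ f * chi ρ E = chi ρ E := by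
  ext v
  have h1 : chi ρ E v ∈ openRange ρ U := by
    have h2 : chi ρ E v ∈ borelRange ρ E := Submodule.starProjection_apply_mem _ _
    exact (Submodule.mem_iInf _).mp h2 ⟨U, hU, hEU⟩
  have h3 : openRange ρ U ≤ LinearMap.ker (ρ f - 1 : H →L[ℂ] H).toLinearMap := by
    refine Submodule.topologicalClosure_minimal _ (Submodule.span_le.mpr ?_)
      (ContinuousLinearMap.isClosed_ker (ρ f - 1 : H →L[ℂ] H))
    rintro w ⟨g, hg, v, rfl⟩
    have h4 : f * g = g := by
      ext x
      by_cases hx : x ∈ U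
      · simp [hf x hx]
      · simp [hg x hx]
    change ρ f (ρ g v) - ρ g v = 0
    rw [← mul_apply_eq_comp, ← map_mul, h4, sub_self]
  exact sub_eq_zero.mp (h3 h1)

theorem chi_rep_of_eq_zero {f : C₀(X, ℂ)} {U : Set X} (hf : ∀ x, x ∉ U → f x = 0) :
    chi ρ U * ρ f = ρ f := by
  ext v
  refine Submodule.starProjection_eq_self_iff.mpr ((Submodule.mem_iInf _).mpr fun V => ?_)
  exact rep_mem_openRange ρ (fun x hx => hf x fun hxU => hx (V.2.2 hxU)) v

theorem chi_rep_of_eq_one {f : C₀(X, ℂ)} {U E : Set X} (hU : IsOpen U) (hEU : E ⊆ U)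
    (hf : ∀ x ∈ U, f x = 1) : chi ρ E * ρ f = chi ρ E := by
  have h := rep_chi_of_eq_one (ρ := ρ) (f := star f) hU hEU fun x hx => by simp [hf x hx]
  have h2 := congrArg star h
  rwa [star_mul, map_star, star_star, ContinuousLinearMap.star_eq_adjoint, adjoint_chi] at h2

theorem rep_chi_of_eq_zero {f : C₀(X, ℂ)} {U : Set X} (hf : ∀ x, x ∉ U → f x = 0) :
    ρ f * chi ρ U = ρ f := by
  have h := chi_rep_of_eq_zero (ρ := ρ) (f := star f) (U := U) fun x hx => by simp [hf x hx]
  have h2 := congrArg star h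
  rwa [star_mul, map_star, star_star, ContinuousLinearMap.star_eq_adjoint, adjoint_chi] at h2

variable [ProperSpace X] [MeasurableSpace X] [BorelSpace X]

theorem norm_chi_union_sq {E F : Set X} (hF : MeasurableSet F) (h : Disjoint E F) (v : H) :
    ‖chi ρ (E ∪ F) v‖ ^ 2 = ‖chi ρ E v‖ ^ 2 + ‖chi ρ F v‖ ^ 2 := by
  obtain ⟨μ, _, hμ⟩ := exists_spectralMeasure ρ v
  rw [norm_chi_sq ρ μ hμ, norm_chi_sq ρ μ hμ, norm_chi_sq ρ μ hμ, measureReal_union h hF]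

theorem chi_union {E F : Set X} (hF : MeasurableSet F) (h : Disjoint E F) :
    chi ρ (E ∪ F) = chi ρ E + chi ρ F := by
  -- By polarization it is enough to compare the quadratic forms, which are values of measures.
  refine ContinuousLinearMap.coe_injective ((ext_inner_map _ _).mp fun v => ?_)
  change inner ℂ (chi ρ (E ∪ F) v) v = inner ℂ (chi ρ E v + chi ρ F v) v
  rw [inner_add_left, inner_chi_self, inner_chi_self, inner_chi_self, norm_chi_union_sq hF h]
  push_cast
  rfl

theorem chi_chi_of_disjoint {E F : Set X} (hF : MeasurableSet F)
    (h : Disjoint E F) (v : H) : chi ρ E (chi ρ F v) = 0 := by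
  have h1 := chi_chi_of_subset ρ (Set.subset_union_left (s := E) (t := F)) v
  rw [chi_union hF h, add_apply, map_add, chi_idem] at h1
  simpa using h1

theorem chi_empty : chi ρ ∅ = 0 := by
  have h := chi_union (ρ := ρ) (E := ∅) MeasurableSet.empty (Set.disjoint_empty _)
  simpa using h

theorem chi_chi {E F : Set X} (hE : MeasurableSet E) (hF : MeasurableSet F) (v : H) :
    chi ρ E (chi ρ F v) = chi ρ (E ∩ F) v := by
  have h1 : chi ρ F = chi ρ (F ∩ E) + chi ρ (F \ E) := by
    rw [← chi_union (hF.diff hE) Set.disjoint_sdiff_inter.symm, Set.inter_union_sdiff]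
  have h2 : chi ρ E = chi ρ (E ∩ F) + chi ρ (E \ F) := by
    rw [← chi_union (hE.diff hF) Set.disjoint_sdiff_inter.symm, Set.inter_union_sdiff]
  rw [h1, add_apply, map_add, chi_chi_of_disjoint (hF.diff hE) Set.disjoint_sdiff_right,
    add_zero, h2, add_apply, Set.inter_comm F E, chi_idem, chi_chi_of_disjoint (hE.inter hF)
    (Set.disjoint_sdiff_left.mono_right Set.inter_subset_right), add_zero]

theorem chi_mul_chi {E F : Set X} (hE : MeasurableSet E) (hF : MeasurableSet F) :
    chi ρ E * chi ρ F = chi ρ (E ∩ F) := by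
  ext v
  exact chi_chi hE hF v

theorem chi_compl (hρ : IsModule ρ) {E : Set X} (hE : MeasurableSet E) :
    chi ρ Eᶜ = 1 - chi ρ E := by
  rw [eq_sub_iff_add_eq, ← chi_univ hρ, ← chi_union hE disjoint_compl_left, Set.compl_union_self]

theorem chi_biUnion {ι : Type*} {E : ι → Set X} (hE : ∀ i, MeasurableSet (E i))
    (s : Finset ι) (hd : (s : Set ι).PairwiseDisjoint E) :
    chi ρ (⋃ i ∈ s, E i) = ∑ i ∈ s, chi ρ (E i) := by
  classical
  induction s using Finset.induction_on with
  | empty => simp [chi_empty]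
  | insert a s ha ih =>
    have hd' : (s : Set ι).PairwiseDisjoint E := hd.subset (by simp)
    rw [Finset.sum_insert ha, ← ih hd', Finset.set_biUnion_insert,
      chi_union (Finset.measurableSet_biUnion _ fun i _ => hE i)]
    refine Set.disjoint_iUnion₂_right.mpr fun i hi => hd (by simp) (by simp [hi]) ?_
    rintro rfl
    exact ha hi

/-- A countable Borel partition gives a resolution of the identity. -/
theorem isResolution_chi (hρ : IsModule ρ) {ι : Type*} [Countable ι] {E : ι → Set X}
    (hE : ∀ i, MeasurableSet (E i)) (hd : Pairwise (fun i j => Disjoint (E i) (E j)))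
    (hu : ⋃ i, E i = Set.univ) : IsResolution fun i => chi ρ (E i) where
  symm i u v := chi_inner ρ _ u v
  idem i u := chi_idem ρ _ u
  orth i j hij u := chi_chi_of_disjoint (hE j) (hd hij) u
  hasSum v := by
    have hnorm : HasSum (fun i => ‖chi ρ (E i) v‖ ^ 2) (‖v‖ ^ 2) := by
      obtain ⟨μ, _, hμ⟩ := exists_spectralMeasure ρ v
      have h0 : ‖v‖ ^ 2 = μ.real (⋃ i, E i) := by
        rw [hu, ← norm_chi_sq ρ μ hμ, chi_univ hρ]
        rfl
      rw [h0]
      simp only [norm_chi_sq ρ μ hμ, measureReal_def]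
      rw [measure_iUnion hd hE]
      have hne : ∀ i, μ (E i) ≠ ⊤ := fun i => measure_ne_top _ _
      have hs : ∑' i, μ (E i) ≠ ⊤ := by
        rw [← measure_iUnion hd hE]
        exact measure_ne_top _ _
      rw [ENNReal.tsum_toReal_eq hne]
      exact (ENNReal.summable_toReal hs).hasSum
    -- Partial sums are projections, so strong convergence follows from `∑ ‖χ_{E i} v‖² = ‖v‖²`.
    have hstep : ∀ s : Finset ι, ‖∑ i ∈ s, chi ρ (E i) v - v‖ ^ 2
        = ‖v‖ ^ 2 - ∑ i ∈ s, ‖chi ρ (E i) v‖ ^ 2 := by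
      intro s
      have h1 : ∑ i ∈ s, chi ρ (E i) v = chi ρ (⋃ i ∈ s, E i) v := by
        rw [chi_biUnion hE s fun i _ j _ hij => hd hij, sum_apply]
      have h2 : ∑ i ∈ s, ‖chi ρ (E i) v‖ ^ 2 = ‖chi ρ (⋃ i ∈ s, E i) v‖ ^ 2 := by
        rw [← h1, norm_sum_sq_of_inner_eq_zero]
        intro i _ j _ hij
        rw [chi_inner, chi_chi_of_disjoint (hE j) (hd hij), inner_zero_right]
      rw [h1, h2, norm_sub_rev]
      have h3 := Submodule.norm_sq_eq_add_norm_sq_starProjection v (borelRange ρ (⋃ i ∈ s, E i))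
      rw [Submodule.starProjection_orthogonal_val] at h3
      change ‖v - (borelRange ρ (⋃ i ∈ s, E i)).starProjection v‖ ^ 2
        = ‖v‖ ^ 2 - ‖(borelRange ρ (⋃ i ∈ s, E i)).starProjection v‖ ^ 2
      linarith
    have h4 : Filter.Tendsto (fun s : Finset ι => ‖∑ i ∈ s, chi ρ (E i) v - v‖ ^ 2)
        Filter.atTop (𝓝 0) := by
      simp only [hstep]
      have h := (tendsto_const_nhds (x := ‖v‖ ^ 2)).sub hnorm
      rwa [sub_self] at h
    refine tendsto_iff_norm_sub_tendsto_zero.mpr ?_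
    have h5 := (Real.continuous_sqrt.tendsto 0).comp h4
    simpa [Function.comp_def] using h5

end Spectral

/-! ### Operators on the Hilbert space tensor product -/

section Tensor

variable {H : Type*} [NormedAddCommGroup H] [InnerProductSpace ℂ H]
  {K : Type*} [NormedAddCommGroup K] [InnerProductSpace ℂ K]

/-- The map `v ↦ v ⊗ k` into the Hilbert space tensor product. -/
noncomputable def tensorRight (H : Type*) [NormedAddCommGroup H] [InnerProductSpace ℂ H] (k : K) :
    H →L[ℂ] HTensor H K :=
  UniformSpace.Completion.toComplL ∘L (TensorProduct.mkL ℂ H K).flip k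

theorem tensorRight_apply (k : K) (v : H) :
    tensorRight H k v = ((v ⊗ₜ[ℂ] k : H ⊗[ℂ] K) : HTensor H K) := rfl

theorem norm_tensorRight_apply (k : K) (v : H) : ‖tensorRight H k v‖ = ‖v‖ * ‖k‖ := by
  rw [tensorRight_apply, UniformSpace.Completion.norm_coe, TensorProduct.norm_tmul]

theorem tensorRight_sub (k l : K) : tensorRight H (k - l) = tensorRight H k - tensorRight H l := by
  rw [tensorRight, map_sub, ContinuousLinearMap.comp_sub]
  rfl

theorem inner_tensorRight (k l : K) (u v : H) :
    inner ℂ (tensorRight H k u) (tensorRight H l v) = inner ℂ u v * inner ℂ k l := by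
  rw [tensorRight_apply, tensorRight_apply, UniformSpace.Completion.inner_coe,
    TensorProduct.inner_tmul]

/-- Operators on the tensor product are determined by their values on elementary tensors. -/
theorem tensor_ext {Y : Type*} [NormedAddCommGroup Y] [NormedSpace ℂ Y]
    {S T : HTensor H K →L[ℂ] Y} (h : ∀ k v, S (tensorRight H k v) = T (tensorRight H k v)) :
    S = T := by
  ext ξ
  induction ξ using UniformSpace.Completion.induction_on with
  | hp => exact isClosed_eq S.continuous T.continuous
  | ih x =>
    induction x with
    | zero => rw [UniformSpace.Completion.coe_zero, map_zero, map_zero]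
    | tmul v k => exact h k v
    | add x y hx hy => rw [UniformSpace.Completion.coe_add, map_add, map_add, hx, hy]

theorem opTensor_tensorRight (S : H →L[ℂ] H) (a : K →L[ℂ] K) (k : K) (v : H) :
    opTensor S a (tensorRight H k v) = tensorRight H (a k) (S v) := by
  rw [opTensor, tensorRight_apply, ContinuousLinearMap.completion_apply_coe,
    TensorProduct.mapL_tmul, tensorRight_apply]

theorem opTensor_mul (S T : H →L[ℂ] H) (a b : K →L[ℂ] K) :
    opTensor (S * T) (a * b) = opTensor S a * opTensor T b :=
  tensor_ext fun k v => by
    change _ = opTensor S a (opTensor T b _)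
    simp only [opTensor_tensorRight]
    rfl

theorem opTensor_one_one : opTensor (1 : H →L[ℂ] H) (1 : K →L[ℂ] K) = 1 :=
  tensor_ext fun k v => opTensor_tensorRight _ _ k v

theorem opTensor_zero_left (a : K →L[ℂ] K) : opTensor (0 : H →L[ℂ] H) a = 0 :=
  tensor_ext fun k v => by
    rw [opTensor_tensorRight, zero_apply, map_zero, zero_apply]

theorem opTensor_zero_right (S : H →L[ℂ] H) : opTensor S (0 : K →L[ℂ] K) = 0 :=
  tensor_ext fun k v => by
    rw [opTensor_tensorRight, zero_apply, zero_apply, ← norm_eq_zero, norm_tensorRight_apply,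
      norm_zero, mul_zero]

theorem opTensor_add_left (S T : H →L[ℂ] H) (a : K →L[ℂ] K) :
    opTensor (S + T) a = opTensor S a + opTensor T a :=
  tensor_ext fun k v => by
    simp only [opTensor_tensorRight, add_apply, map_add]

theorem opTensor_sub_left (S T : H →L[ℂ] H) (a : K →L[ℂ] K) :
    opTensor (S - T) a = opTensor S a - opTensor T a :=
  tensor_ext fun k v => by
    simp only [opTensor_tensorRight, sub_apply, map_sub]

theorem opTensor_sub_right (S : H →L[ℂ] H) (a b : K →L[ℂ] K) :
    opTensor S (a - b) = opTensor S a - opTensor S b :=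
  tensor_ext fun k v => by
    simp only [opTensor_tensorRight, sub_apply, tensorRight_sub]

theorem opTensor_sum_left {ι : Type*} (s : Finset ι) (S : ι → H →L[ℂ] H) (a : K →L[ℂ] K) :
    opTensor (∑ i ∈ s, S i) a = ∑ i ∈ s, opTensor (S i) a := by
  classical
  induction s using Finset.induction_on with
  | empty => simp [opTensor_zero_left]
  | insert i s hi ih => rw [Finset.sum_insert hi, Finset.sum_insert hi, opTensor_add_left, ih]

theorem norm_opTensor_le (S : H →L[ℂ] H) (a : K →L[ℂ] K) : ‖opTensor S a‖ ≤ ‖S‖ * ‖a‖ := by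
  refine ContinuousLinearMap.opNorm_le_bound _ (by positivity) fun ξ => ?_
  induction ξ using UniformSpace.Completion.induction_on with
  | hp => exact isClosed_le (opTensor S a).continuous.norm (continuous_const.mul continuous_norm)
  | ih x =>
    rw [opTensor, ContinuousLinearMap.completion_apply_coe, UniformSpace.Completion.norm_coe,
      UniformSpace.Completion.norm_coe]
    exact (ContinuousLinearMap.le_opNorm _ _).trans
      (by gcongr; exact TensorProduct.norm_mapL_le S a)

theorem norm_opTensor_one_right_le (S : H →L[ℂ] H) : ‖opTensor S (1 : K →L[ℂ] K)‖ ≤ ‖S‖ :=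
  (norm_opTensor_le S 1).trans
    (mul_le_of_le_one_right (norm_nonneg _) ContinuousLinearMap.norm_id_le)

/-- `S'` is an adjoint of `S`. -/
def FormalAdjoint {G : Type*} [NormedAddCommGroup G] [InnerProductSpace ℂ G]
    (S S' : G →L[ℂ] G) : Prop :=
  ∀ u v, inner ℂ (S u) v = inner ℂ u (S' v)

theorem formalAdjoint_one : FormalAdjoint (1 : K →L[ℂ] K) 1 := fun _ _ => rfl

theorem formalAdjoint_mapL {S S' : H →L[ℂ] H} {a a' : K →L[ℂ] K} (hS : FormalAdjoint S S')
    (ha : FormalAdjoint a a') :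
    FormalAdjoint (TensorProduct.mapL S a) (TensorProduct.mapL S' a') := by
  intro x y
  induction x with
  | zero => simp only [map_zero, inner_zero_left]
  | add x₁ x₂ h₁ h₂ => rw [map_add, inner_add_left, inner_add_left, h₁, h₂]
  | tmul u k =>
    induction y with
    | zero => simp only [map_zero, inner_zero_right]
    | add y₁ y₂ h₁ h₂ => rw [map_add, inner_add_right, inner_add_right, h₁, h₂]
    | tmul v l =>
      rw [TensorProduct.mapL_tmul, TensorProduct.mapL_tmul, TensorProduct.inner_tmul,
        TensorProduct.inner_tmul, hS, ha]

theorem formalAdjoint_opTensor {S S' : H →L[ℂ] H} {a a' : K →L[ℂ] K} (hS : FormalAdjoint S S')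
    (ha : FormalAdjoint a a') : FormalAdjoint (opTensor S a) (opTensor S' a') := by
  intro ξ ζ
  induction ξ, ζ using UniformSpace.Completion.induction_on₂ with
  | hp =>
    exact isClosed_eq (((opTensor S a).continuous.comp continuous_fst).inner continuous_snd)
      (continuous_fst.inner ((opTensor S' a').continuous.comp continuous_snd))
  | ih x y =>
    rw [opTensor, opTensor, ContinuousLinearMap.completion_apply_coe,
      ContinuousLinearMap.completion_apply_coe, UniformSpace.Completion.inner_coe,
      UniformSpace.Completion.inner_coe]
    exact formalAdjoint_mapL hS ha x y

theorem IsResolution.norm_sum_le {ι : Type*} {P : ι → H →L[ℂ] H} (hP : IsResolution P)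
    (s : Finset ι) : ‖∑ i ∈ s, P i‖ ≤ 1 := by
  refine ContinuousLinearMap.opNorm_le_bound _ zero_le_one fun u => ?_
  rw [one_mul, sum_apply]
  refine le_of_sq_le_sq ?_ (norm_nonneg _)
  rw [norm_sum_sq_of_inner_eq_zero fun i _ j _ hij => hP.inner_eq_zero hij u u]
  exact sum_le_hasSum _ (fun _ _ => sq_nonneg _) (hP.hasSum_norm_sq u)

theorem hasSum_of_dense {ι Y : Type*} [NormedAddCommGroup Y] [NormedSpace ℂ Y] {Q : ι → Y →L[ℂ] Y}
    (hQ : ∀ s : Finset ι, ‖∑ i ∈ s, Q i‖ ≤ 1) {D : Set Y} (hD : Dense D)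
    (h : ∀ x ∈ D, HasSum (fun i => Q i x) x) (ξ : Y) : HasSum (fun i => Q i ξ) ξ := by
  simp only [HasSum, SummationFilter.unconditional_filter, Metric.tendsto_nhds] at h ⊢
  intro ε hε
  obtain ⟨x, hxD, hx⟩ := hD.exists_dist_lt ξ (show 0 < ε / 3 by linarith)
  filter_upwards [h x hxD (ε / 3) (by linarith)] with t h1
  rw [dist_eq_norm] at hx h1 ⊢
  have hF : ‖(∑ i ∈ t, Q i) (ξ - x)‖ ≤ ‖ξ - x‖ := by
    refine (ContinuousLinearMap.le_opNorm _ _).trans ?_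
    exact (mul_le_of_le_one_left (norm_nonneg _) (hQ t))
  rw [← sum_apply] at h1 ⊢
  calc ‖(∑ i ∈ t, Q i) ξ - ξ‖
      = ‖(∑ i ∈ t, Q i) (ξ - x) + ((∑ i ∈ t, Q i) x - x) - (ξ - x)‖ := by
        rw [map_sub]; congr 1; abel
    _ ≤ ‖(∑ i ∈ t, Q i) (ξ - x)‖ + ‖(∑ i ∈ t, Q i) x - x‖ + ‖ξ - x‖ := by
      exact (norm_sub_le _ _).trans (by gcongr; exact norm_add_le _ _)
    _ < ε := by linarith

theorem IsResolution.hasSum_opTensor_coe {ι : Type*} {P : ι → H →L[ℂ] H} (hP : IsResolution P)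
    (x : H ⊗[ℂ] K) :
    HasSum (fun i => opTensor (P i) (1 : K →L[ℂ] K) (x : HTensor H K)) x := by
  induction x with
  | zero =>
    simp only [UniformSpace.Completion.coe_zero, map_zero]
    exact hasSum_zero
  | add x y hx hy =>
    simp only [UniformSpace.Completion.coe_add, map_add]
    exact hx.add hy
  | tmul v k =>
    have h := (hP.hasSum v).mapL (tensorRight H k)
    have h2 : ∀ i, opTensor (P i) (1 : K →L[ℂ] K)
        ((v ⊗ₜ[ℂ] k : H ⊗[ℂ] K) : HTensor H K) = tensorRight H k (P i v) := fun i =>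
      opTensor_tensorRight (P i) 1 k v
    simp only [h2]
    exact h

/-- A resolution of the identity of `H` induces one of `H ⊗ K`. -/
theorem IsResolution.tensor {ι : Type*} {P : ι → H →L[ℂ] H} (hP : IsResolution P) :
    IsResolution fun i => opTensor (P i) (1 : K →L[ℂ] K) where
  symm i := formalAdjoint_opTensor (hP.symm i) formalAdjoint_one
  idem i ξ := by
    have h : P i * P i = P i := by
      ext u
      exact hP.idem i u
    rw [← mul_apply_eq_comp, ← opTensor_mul, h, mul_one]
  orth i j hij ξ := by
    have h : P i * P j = 0 := by
      ext u
      exact hP.orth i j hij u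
    rw [← mul_apply_eq_comp, ← opTensor_mul, h, opTensor_zero_left, zero_apply]
  hasSum ξ := by
    refine hasSum_of_dense (Q := fun i => opTensor (P i) (1 : K →L[ℂ] K)) (fun s => ?_)
      UniformSpace.Completion.denseRange_coe (Set.forall_mem_range.mpr fun x => ?_) ξ
    · rw [← opTensor_sum_left]
      exact (norm_opTensor_one_right_le _).trans (hP.norm_sum_le s)
    · exact hP.hasSum_opTensor_coe x

end Tensor

/-! ### The operators `Λ(g)` -/

section Lambda

open MeasureTheory

variable {X : Type*} [MetricSpace X]
  {H : Type*} [NormedAddCommGroup H] [InnerProductSpace ℂ H] [CompleteSpace H]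
  {K : Type*} [NormedAddCommGroup K] [InnerProductSpace ℂ K]
  {ρ : C₀(X, ℂ) →⋆ₙₐ[ℂ] (H →L[ℂ] H)}

variable (K ρ) in
/-- The projection `χ_E ⊗ 1` on `H ⊗ K`. -/
noncomputable abbrev chiTensor (E : Set X) : HTensor H K →L[ℂ] HTensor H K :=
  opTensor (chi ρ E) (1 : K →L[ℂ] K)

theorem norm_chiTensor_le (E : Set X) : ‖chiTensor K ρ E‖ ≤ 1 :=
  (norm_opTensor_one_right_le _).trans (norm_chi_le ρ E)

theorem chiTensor_commute_one (E : Set X) (a : K →L[ℂ] K) :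
    chiTensor K ρ E * opTensor 1 a = opTensor 1 a * chiTensor K ρ E := by
  rw [← opTensor_mul, ← opTensor_mul, one_mul, mul_one, one_mul, mul_one]

variable [MeasurableSpace X]

variable (ρ) in
/-- `L` commutes with the projections `χ_E ⊗ 1`, and on the range of `χ_E ⊗ 1` it is as close to
`1 ⊗ a` as `g` is to `a` on `E`.  This determines `L` if `g` is strongly measurable, and it is the
only property of `Λ(g)` that matters. -/
def IsLocalized (g : X → K →L[ℂ] K) (L : HTensor H K →L[ℂ] HTensor H K) : Prop :=
  (∀ E, MeasurableSet E → chiTensor K ρ E * L = L * chiTensor K ρ E) ∧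
  ∀ E, MeasurableSet E → ∀ (a : K →L[ℂ] K) (η : ℝ), 0 ≤ η → (∀ x ∈ E, ‖g x - a‖ ≤ η) →
    ‖(L - opTensor 1 a) * chiTensor K ρ E‖ ≤ η

theorem IsLocalized.commute {g : X → K →L[ℂ] K} {L : HTensor H K →L[ℂ] HTensor H K}
    (h : IsLocalized ρ g L) {E : Set X} (hE : MeasurableSet E) :
    chiTensor K ρ E * L = L * chiTensor K ρ E := h.1 E hE

theorem IsLocalized.norm_le {g : X → K →L[ℂ] K} {L : HTensor H K →L[ℂ] HTensor H K}
    (h : IsLocalized ρ g L) {E : Set X} (hE : MeasurableSet E) (a : K →L[ℂ] K) {η : ℝ}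
    (hη : 0 ≤ η) (hg : ∀ x ∈ E, ‖g x - a‖ ≤ η) :
    ‖(L - opTensor 1 a) * chiTensor K ρ E‖ ≤ η := h.2 E hE a η hη hg

theorem IsLocalized.norm_le_one (hρ : IsModule ρ) {g : X → K →L[ℂ] K}
    {L : HTensor H K →L[ℂ] HTensor H K} (h : IsLocalized ρ g L) (hg : ∀ x, ‖g x‖ ≤ 1) :
    ‖L‖ ≤ 1 := by
  have h1 := h.norm_le MeasurableSet.univ 0 zero_le_one fun x _ => by
    rw [sub_zero]
    exact hg x
  rwa [opTensor_zero_right, sub_zero, chiTensor, chi_univ hρ, opTensor_one_one, mul_one] at h1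

variable [ProperSpace X] [BorelSpace X]

theorem chiTensor_mul_chiTensor {E F : Set X} (hE : MeasurableSet E) (hF : MeasurableSet F) :
    chiTensor K ρ E * chiTensor K ρ F = chiTensor K ρ (E ∩ F) := by
  rw [← opTensor_mul, chi_mul_chi hE hF, mul_one]

theorem chiTensor_commute {E F : Set X} (hE : MeasurableSet E) (hF : MeasurableSet F) :
    chiTensor K ρ E * chiTensor K ρ F = chiTensor K ρ F * chiTensor K ρ E := by
  rw [chiTensor_mul_chiTensor hE hF, chiTensor_mul_chiTensor hF hE, Set.inter_comm]

theorem isResolution_chiTensor (hρ : IsModule ρ) {ι : Type*} [Countable ι] {E : ι → Set X}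
    (hE : ∀ i, MeasurableSet (E i)) (hd : Pairwise (fun i j => Disjoint (E i) (E j)))
    (hu : ⋃ i, E i = Set.univ) : IsResolution fun i => chiTensor K ρ (E i) :=
  (isResolution_chi hρ hE hd hu).tensor

/-- The strong sum `∑ χ_{Eₙ} ⊗ aₙ` is localized. -/
theorem isLocalized_of_hasSum (hρ : IsModule ρ) {ι : Type*} [Countable ι] {E : ι → Set X}
    (hE : ∀ i, MeasurableSet (E i)) (hd : Pairwise (fun i j => Disjoint (E i) (E j)))
    (hu : ⋃ i, E i = Set.univ) {a : ι → K →L[ℂ] K} {g : X → K →L[ℂ] K}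
    (hg : ∀ i, ∀ x ∈ E i, g x = a i) {L : HTensor H K →L[ℂ] HTensor H K}
    (hL : ∀ ξ, HasSum (fun i => opTensor (chi ρ (E i)) (a i) ξ) (L ξ)) : IsLocalized ρ g L := by
  have hcomm : ∀ F, MeasurableSet F → chiTensor K ρ F * L = L * chiTensor K ρ F := by
    intro F hF
    ext ξ
    have h1 := (hL ξ).mapL (chiTensor K ρ F)
    refine h1.unique ?_
    have h2 : ∀ i, chiTensor K ρ F (opTensor (chi ρ (E i)) (a i) ξ)
        = opTensor (chi ρ (E i)) (a i) (chiTensor K ρ F ξ) := by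
      intro i
      rw [← mul_apply_eq_comp, ← mul_apply_eq_comp, ← opTensor_mul, ← opTensor_mul,
        chi_mul_chi hF (hE i), chi_mul_chi (hE i) hF, Set.inter_comm, one_mul, mul_one]
    simp only [h2]
    exact hL _
  -- On the block of `E i`, the operator `L` is `χ_{E i} ⊗ a i`.
  have hLE : ∀ i, L * chiTensor K ρ (E i) = opTensor (chi ρ (E i)) (a i) := by
    intro i
    ext ξ
    refine (hL _).unique ?_
    have h1 : opTensor (chi ρ (E i)) (a i) (chiTensor K ρ (E i) ξ)
        = opTensor (chi ρ (E i)) (a i) ξ := by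
      rw [← mul_apply_eq_comp, ← opTensor_mul, chi_mul_chi (hE i) (hE i), Set.inter_self, mul_one]
    rw [← h1]
    refine hasSum_single i fun j hj => ?_
    change (opTensor (chi ρ (E j)) (a j) * chiTensor K ρ (E i)) ξ = 0
    rw [← opTensor_mul, chi_mul_chi (hE j) (hE i), (hd hj).inter_eq, chi_empty,
      opTensor_zero_left, zero_apply]
  refine ⟨hcomm, fun F hF b η hη h => ?_⟩
  refine (isResolution_chiTensor (K := K) hρ hE hd hu).norm_le_of_commute hη (fun i => ?_)
    fun i => ?_
  · rw [← mul_assoc, mul_sub, hcomm _ (hE i), chiTensor_commute_one, ← sub_mul, mul_assoc,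
      chiTensor_commute (hE i) hF, ← mul_assoc]
  · have h1 : (L - opTensor 1 b) * chiTensor K ρ F * chiTensor K ρ (E i)
        = opTensor (chi ρ (E i ∩ F)) (a i - b) := by
      rw [mul_assoc, chiTensor_commute hF (hE i), ← mul_assoc, sub_mul, hLE, ← opTensor_mul,
        one_mul, mul_one, ← opTensor_sub_right, ← opTensor_mul, chi_mul_chi (hE i) hF, mul_one]
    rw [h1]
    rcases (E i ∩ F).eq_empty_or_nonempty with h0 | ⟨x, hxE, hxF⟩
    · rw [h0, chi_empty, opTensor_zero_left, norm_zero]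
      exact hη
    · refine (norm_opTensor_le _ _).trans ?_
      rw [← hg i x hxE]
      exact (mul_le_of_le_one_left (norm_nonneg _) (norm_chi_le ρ _)).trans (h x hxF)

theorem tendsto_const_mul_clm {ι Y : Type*} [NormedAddCommGroup Y] [NormedSpace ℂ Y]
    {l : Filter ι} {S : ι → Y →L[ℂ] Y} {T : Y →L[ℂ] Y} (h : Filter.Tendsto S l (𝓝 T))
    (A : Y →L[ℂ] Y) : Filter.Tendsto (fun i => A * S i) l (𝓝 (A * T)) :=
  h.const_mul A

theorem tendsto_mul_const_clm {ι Y : Type*} [NormedAddCommGroup Y] [NormedSpace ℂ Y]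
    {l : Filter ι} {S : ι → Y →L[ℂ] Y} {T : Y →L[ℂ] Y} (h : Filter.Tendsto S l (𝓝 T))
    (A : Y →L[ℂ] Y) : Filter.Tendsto (fun i => S i * A) l (𝓝 (T * A)) :=
  h.mul_const A

theorem exists_tendsto_clm {Y : Type*} [NormedAddCommGroup Y] [NormedSpace ℂ Y] [CompleteSpace Y]
    {S : ℕ → Y →L[ℂ] Y} {b : ℕ → ℝ} (hb : Filter.Tendsto b Filter.atTop (𝓝 0))
    (h : ∀ m n N : ℕ, N ≤ m → N ≤ n → ‖S m - S n‖ ≤ b N) :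
    ∃ L, Filter.Tendsto S Filter.atTop (𝓝 L) :=
  cauchySeq_tendsto_of_complete <| cauchySeq_of_le_tendsto_0 b
    (fun m n N hm hn => by rw [dist_eq_norm]; exact h m n N hm hn) hb

theorem IsCountableLambda.isLocalized [CompleteSpace K] (hρ : IsModule ρ) {g : X → Compacts K}
    {L : HTensor H K →L[ℂ] HTensor H K} (h : IsCountableLambda ρ g L) :
    IsLocalized ρ (fun x => (g x : K →L[ℂ] K)) L := by
  obtain ⟨E, a, hE, hd, hu, hg, -, hL⟩ := h
  exact isLocalized_of_hasSum hρ hE hd hu (a := fun n => (a n : K →L[ℂ] K))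
    (fun n x hx => by rw [hg n x hx]) hL

theorem IsLambda.isLocalized [CompleteSpace K] (hρ : IsModule ρ) {g : X → Compacts K}
    {L : HTensor H K →L[ℂ] HTensor H K} (h : IsLambda ρ g L) :
    IsLocalized ρ (fun x => (g x : K →L[ℂ] K)) L := by
  obtain ⟨gs, Ls, hLs, hgs, hL⟩ := h
  refine ⟨fun E hE => ?_, fun E hE a η hη ha => ?_⟩
  · have h1 := tendsto_const_mul_clm hL (chiTensor K ρ E)
    have h2 := tendsto_mul_const_clm hL (chiTensor K ρ E)
    refine tendsto_nhds_unique h1 (h2.congr fun n => ?_)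
    exact (((hLs n).isLocalized hρ).commute hE).symm
  · refine le_of_forall_pos_le_add fun ε hε => ?_
    have h1 : Filter.Tendsto (fun n => ‖(Ls n - opTensor 1 a) * chiTensor K ρ E‖) Filter.atTop
        (𝓝 ‖(L - opTensor 1 a) * chiTensor K ρ E‖) :=
      (tendsto_mul_const_clm (hL.sub_const _) _).norm
    refine le_of_tendsto h1 ?_
    filter_upwards [Metric.tendstoUniformly_iff.mp hgs ε hε] with n hn
    refine ((hLs n).isLocalized hρ).norm_le hE a (by linarith) fun x hx => ?_
    have h2 : ‖(gs n x : K →L[ℂ] K) - (g x : K →L[ℂ] K)‖ < ε := by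
      have := hn x
      rwa [dist_comm, dist_eq_norm] at this
    calc ‖(gs n x : K →L[ℂ] K) - a‖
        = ‖((gs n x : K →L[ℂ] K) - (g x : K →L[ℂ] K)) + ((g x : K →L[ℂ] K) - a)‖ := by
          congr 1; abel
      _ ≤ ‖(gs n x : K →L[ℂ] K) - (g x : K →L[ℂ] K)‖ + ‖(g x : K →L[ℂ] K) - a‖ :=
        norm_add_le _ _
      _ ≤ η + ε := by linarith [ha x hx]

/-- `g ↦ Λ(g)` is contractive for the uniform norm. -/
theorem IsCountableLambda.norm_sub_le [CompleteSpace K] (hρ : IsModule ρ) {g g' : X → Compacts K}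
    {L L' : HTensor H K →L[ℂ] HTensor H K} (h : IsCountableLambda ρ g L)
    (h' : IsLocalized ρ (fun x => (g' x : K →L[ℂ] K)) L') {η : ℝ} (hη : 0 ≤ η)
    (hg : ∀ x, ‖g x - g' x‖ ≤ η) : ‖L - L'‖ ≤ η := by
  have hloc := h.isLocalized hρ
  obtain ⟨E, a, hE, hd, hu, ha, -, -⟩ := h
  refine (isResolution_chiTensor (K := K) hρ hE hd hu).norm_le_of_commute hη (fun n => ?_)
    fun n => ?_
  · rw [mul_sub, sub_mul, hloc.commute (hE n), h'.commute (hE n)]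
  · have h1 := hloc.norm_le (hE n) (a n) le_rfl fun x hx => by
      rw [ha n x hx, sub_self, norm_zero]
    have h2 := h'.norm_le (hE n) (a n) hη fun x hx => by
      rw [← ha n x hx, norm_sub_rev]
      exact hg x
    calc ‖(L - L') * chiTensor K ρ (E n)‖
        = ‖(L - opTensor 1 (a n : K →L[ℂ] K)) * chiTensor K ρ (E n)
            - (L' - opTensor 1 (a n : K →L[ℂ] K)) * chiTensor K ρ (E n)‖ := by
          rw [← sub_mul, sub_sub_sub_cancel_right]
      _ ≤ 0 + η := (_root_.norm_sub_le _ _).trans (add_le_add h1 h2)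
      _ = η := zero_add η

/-- Rounding `g` to a countable dense subset of its range gives uniformly close countably-valued
maps. -/
theorem exists_isCountableLambda [CompleteSpace K] (hρ : IsModule ρ) {g : X → Compacts K}
    (hg : StronglyMeasurable g) (hg1 : ∀ x, ‖g x‖ ≤ 1) {ε : ℝ} (hε : 0 < ε) :
    ∃ (g' : X → Compacts K) (L : HTensor H K →L[ℂ] HTensor H K),
      IsCountableLambda ρ g' L ∧ ∀ x, ‖g x - g' x‖ < ε := by
  obtain ⟨c, hcg, hcc, hc⟩ := hg.isSeparable_range.exists_countable_dense_subset
  rcases isEmpty_or_nonempty X with hX | ⟨⟨x₀⟩⟩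
  · refine ⟨g, 0, ⟨fun _ => ∅, fun _ => 0, fun _ => MeasurableSet.empty, fun _ _ _ => by simp,
      Subsingleton.elim _ _, fun n x => isEmptyElim x, ⟨0, by simp⟩, fun ξ => ?_⟩,
      fun x => isEmptyElim x⟩
    simp [chi_empty, opTensor_zero_left]
  have hcne : c.Nonempty := by
    by_contra h
    rw [Set.not_nonempty_iff_eq_empty.mp h, closure_empty] at hc
    exact hc ⟨x₀, rfl⟩
  obtain ⟨d, rfl⟩ := hcc.exists_eq_range hcne
  have hd1 : ∀ n, ‖d n‖ ≤ 1 := fun n => by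
    obtain ⟨x, hx⟩ := hcg ⟨n, rfl⟩
    rw [← hx]
    exact hg1 x
  set F : ℕ → Set X := fun n => {x | ‖g x - d n‖ < ε} with hF
  have hFm : ∀ n, MeasurableSet (F n) := fun n =>
    measurableSet_lt (hg.sub stronglyMeasurable_const).norm.measurable measurable_const
  have hEm : ∀ n, MeasurableSet (disjointed F n) := fun n => MeasurableSet.disjointed hFm n
  have hEd : Pairwise fun m n => Disjoint (disjointed F m) (disjointed F n) := disjoint_disjointed F
  have hEu : ⋃ n, disjointed F n = Set.univ := by
    rw [iUnion_disjointed]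
    refine Set.eq_univ_of_forall fun x => ?_
    obtain ⟨y, ⟨n, rfl⟩, hy⟩ := Metric.mem_closure_iff.mp (hc ⟨x, rfl⟩) ε hε
    rw [dist_eq_norm] at hy
    exact Set.mem_iUnion.mpr ⟨n, hy⟩
  choose idx hidx using fun x => Set.mem_iUnion.mp (hEu.ge (Set.mem_univ x))
  obtain ⟨L, hL⟩ := (isResolution_chiTensor (K := K) hρ hEm hEd hEu).exists_strongSum
    (isResolution_chiTensor (K := K) hρ hEm hEd hEu)
    (S := fun n => opTensor (chi ρ (disjointed F n)) (d n : K →L[ℂ] K)) (M := 1)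
    (fun n ξ => by
      rw [← mul_apply_eq_comp, ← opTensor_mul, chi_mul_chi (hEm n) (hEm n), Set.inter_self,
        one_mul])
    (fun n ξ => by
      rw [← mul_apply_eq_comp, ← opTensor_mul, chi_mul_chi (hEm n) (hEm n), Set.inter_self,
        mul_one])
    (fun n => (norm_opTensor_le _ _).trans
      (mul_le_one₀ (norm_chi_le ρ _) (norm_nonneg _) (hd1 n)))
  refine ⟨fun x => d (idx x), L, ⟨disjointed F, d, hEm, hEd, hEu, fun n x hx => ?_,
    ⟨1, Set.forall_mem_range.mpr hd1⟩, hL⟩, fun x => disjointed_subset F _ (hidx x)⟩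
  by_contra hne
  have hne' : idx x ≠ n := fun h => hne (congrArg d h)
  exact Set.disjoint_left.mp (hEd hne') (hidx x) hx

/-- The operators of countably-valued approximations of `g` form a Cauchy sequence. -/
theorem exists_isLambda [CompleteSpace K] (hρ : IsModule ρ) {g : X → Compacts K}
    (hg : StronglyMeasurable g) (hg1 : ∀ x, ‖g x‖ ≤ 1) :
    ∃ L : HTensor H K →L[ℂ] HTensor H K, IsLambda ρ g L := by
  have hpos : ∀ n : ℕ, (0 : ℝ) < 1 / ((n : ℝ) + 1) := fun n => by positivity
  choose gs Ls hLs hgs using fun n : ℕ => exists_isCountableLambda hρ hg hg1 (hpos n)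
  have hb : Filter.Tendsto (fun n : ℕ => 2 * (1 / ((n : ℝ) + 1))) Filter.atTop (𝓝 0) := by
    simpa using (tendsto_one_div_add_atTop_nhds_zero_nat (𝕜 := ℝ)).const_mul 2
  obtain ⟨L, hL⟩ : ∃ L, Filter.Tendsto Ls Filter.atTop (𝓝 L) := by
    refine exists_tendsto_clm hb fun m n N hm hn => ?_
    refine (hLs m).norm_sub_le hρ ((hLs n).isLocalized hρ) (by positivity) fun x => ?_
    have h1 := hgs m x
    have h2 := hgs n x
    have h3 : 1 / ((m : ℝ) + 1) ≤ 1 / ((N : ℝ) + 1) := one_div_le_one_div_of_le (by positivity)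
      (by gcongr)
    have h4 : 1 / ((n : ℝ) + 1) ≤ 1 / ((N : ℝ) + 1) := one_div_le_one_div_of_le (by positivity)
      (by gcongr)
    calc ‖gs m x - gs n x‖ = ‖(g x - gs n x) - (g x - gs m x)‖ := by congr 1; abel
      _ ≤ ‖g x - gs n x‖ + ‖g x - gs m x‖ := norm_sub_le _ _
      _ ≤ 2 * (1 / ((N : ℝ) + 1)) := by linarith
  refine ⟨L, gs, Ls, hLs, Metric.tendstoUniformly_iff.mpr fun ε hε => ?_, hL⟩
  filter_upwards [(tendsto_one_div_add_atTop_nhds_zero_nat (𝕜 := ℝ)).eventually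
    (gt_mem_nhds hε)] with n hn x
  rw [dist_eq_norm]
  exact (hgs n x).trans hn

theorem isLocalized_Lambda [CompleteSpace K] (hρ : IsModule ρ) {g : X → Compacts K}
    (hg : StronglyMeasurable g) (hg1 : ∀ x, ‖g x‖ ≤ 1) :
    IsLocalized ρ (fun x => (g x : K →L[ℂ] K)) (Lambda ρ g) := by
  have h := exists_isLambda hρ hg hg1
  rw [Lambda, dif_pos h]
  exact h.choose_spec.isLocalized hρ

end Lambda

/-! ### Strongly quasi-local operators are quasi-local -/

section StrongToQuasi

open MeasureTheory

variable {X : Type*} [MetricSpace X] [ProperSpace X] [MeasurableSpace X] [BorelSpace X]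
  {H : Type*} [NormedAddCommGroup H] [InnerProductSpace ℂ H] [CompleteSpace H]
  {K : Type*} [NormedAddCommGroup K] [InnerProductSpace ℂ K] [CompleteSpace K]
  {ρ : C₀(X, ℂ) →⋆ₙₐ[ℂ] (H →L[ℂ] H)}

omit [CompleteSpace K] in
theorem isCompactOperator_smulRight (k : K) : IsCompactOperator ((innerSL ℂ k).smulRight k) :=
  ((isCompactOperator_id (E := ℂ)).comp_clm (innerSL ℂ k)).clm_comp
    (ContinuousLinearMap.toSpanSingleton ℂ k)

/-- `norm_nonneg` over an abstract normed space: unification is expensive on `HTensor H K`. -/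
theorem clm_norm_nonneg {Y : Type*} [NormedAddCommGroup Y] [NormedSpace ℂ Y] (T : Y →L[ℂ] Y) :
    0 ≤ ‖T‖ :=
  norm_nonneg T

/-- `norm_le_zero_iff` over an abstract normed space, for use on `HTensor H K`. -/
theorem clm_eq_zero_of_norm_le {Y : Type*} [NormedAddCommGroup Y] [NormedSpace ℂ Y]
    {T : Y →L[ℂ] Y} (h : ‖T‖ ≤ 0) : T = 0 :=
  norm_le_zero_iff.mp h

/-- If `L` vanishes on the range of `Q` and agrees with `p` after the projection `P`, then the corner
of `[T, L]` at `(P, Q)` is `-P p T Q`. -/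
theorem norm_le_norm_commutator {Y : Type*} [NormedAddCommGroup Y] [NormedSpace ℂ Y]
    {T L P Q p : Y →L[ℂ] Y} (hP : ‖P‖ ≤ 1) (hQ : ‖Q‖ ≤ 1) (hLQ : L * Q = 0) (hPL : P * L = P * p) :
    ‖P * p * T * Q‖ ≤ ‖T * L - L * T‖ := by
  have h1 : P * p * T * Q = -(P * (T * L - L * T) * Q) := by
    rw [mul_sub, sub_mul, ← mul_assoc P L T, hPL, mul_assoc P (T * L) Q, mul_assoc T L Q, hLQ]
    simp
  rw [h1, norm_neg]
  calc ‖P * (T * L - L * T) * Q‖ ≤ ‖P‖ * ‖T * L - L * T‖ * ‖Q‖ :=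
        (norm_mul_le _ _).trans (by gcongr; exact norm_mul_le _ _)
    _ ≤ 1 * ‖T * L - L * T‖ * 1 := by gcongr
    _ = _ := by ring

theorem norm_ofReal_smul_sub_le {E : Type*} [NormedAddCommGroup E] [NormedSpace ℂ E] (a b : ℝ)
    {p : E} (hp : ‖p‖ = 1) : ‖(a : ℂ) • p - (b : ℂ) • p‖ ≤ |a - b| := by
  rw [← sub_smul, norm_smul, hp, mul_one, ← Complex.ofReal_sub, Complex.norm_real, Real.norm_eq_abs]

omit [CompleteSpace H] [CompleteSpace K] in
theorem norm_le_norm_opTensor (S : H →L[ℂ] H) {p : K →L[ℂ] K} {k : K} (hk : ‖k‖ = 1)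
    (hp : p k = k) : ‖S‖ ≤ ‖opTensor S p‖ := by
  refine S.opNorm_le_bound (clm_norm_nonneg _) fun v => ?_
  have h := (opTensor S p).le_opNorm (tensorRight H k v)
  rwa [opTensor_tensorRight, hp, norm_tensorRight_apply, norm_tensorRight_apply, hk, mul_one,
    mul_one] at h

/-- If `d(A, B) > R`, then a Lipschitz function `f` with `f = 1` on `A` and `f = 0` on `B`, times a
rank one projection `p`, is a function of small variation whose commutator has the corner
`-χ_A T χ_B ⊗ p`. -/
theorem IsStronglyQuasiLocal.isQuasiLocal (hρ : IsModule ρ) (hK : ¬ FiniteDimensional ℂ K)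
    {T : H →L[ℂ] H} (hT : IsStronglyQuasiLocal K ρ T) : IsQuasiLocal ρ T := by
  intro ε hε
  obtain ⟨δ, hδ, R, hR, h⟩ := hT ε hε
  -- Over a gap of width `R / δ` the function `f` can have Lipschitz constant `δ / R`, so that it
  -- varies by less than `δ` on sets of diameter less than `R`.
  refine ⟨R / δ, by positivity, fun A B hA hB hAB => ?_⟩
  rcases A.eq_empty_or_nonempty with rfl | hAne
  · rw [chi_empty, zero_mul, zero_mul, norm_zero]
    exact hε
  have hKnt : Nontrivial K := by
    by_contra hn
    rw [not_nontrivial_iff_subsingleton] at hn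
    exact hK inferInstance
  obtain ⟨k, hk⟩ := exists_norm_eq K zero_le_one
  set p : Compacts K := ⟨(innerSL ℂ k).smulRight k, isCompactOperator_smulRight k⟩ with hp
  have hpk : (p : K →L[ℂ] K) k = k := by
    change inner ℂ k k • k = k
    rw [inner_self_eq_norm_sq_to_K, hk]
    simp
  have hpn : ‖p‖ = 1 := by
    change ‖(innerSL ℂ k).smulRight k‖ = 1
    rw [ContinuousLinearMap.norm_smulRight_apply, innerSL_apply_norm, hk, mul_one]
  set f : X → ℝ := fun x => max 0 (1 - Metric.infDist x A / (R / δ)) with hf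
  have hf01 : ∀ x, 0 ≤ f x ∧ f x ≤ 1 := fun x => by
    refine ⟨le_max_left _ _, max_le zero_le_one ?_⟩
    have : 0 ≤ Metric.infDist x A / (R / δ) := div_nonneg Metric.infDist_nonneg (by positivity)
    linarith
  have hfA : ∀ x ∈ A, f x = 1 := fun x hx => by
    simp [hf, Metric.infDist_zero_of_mem hx]
  have hfB : ∀ x ∈ B, f x = 0 := fun x hx => by
    have h1 : R / δ ≤ Metric.infDist x A := by
      refine (Metric.le_infDist hAne).mpr fun y hy => ?_
      have h2 : setDist A B ≤ edist y x := iInf₂_le_of_le y hy (iInf₂_le x hx)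
      have h3 := hAB.trans_le h2
      rw [edist_dist, dist_comm] at h3
      exact ((ENNReal.ofReal_lt_ofReal_iff_of_nonneg (by positivity)).mp h3).le
    refine max_eq_left ?_
    have : 1 ≤ Metric.infDist x A / (R / δ) := (one_le_div (by positivity)).mpr h1
    linarith
  have hflip : ∀ x y, |f x - f y| ≤ dist x y / (R / δ) := fun x y => by
    have h1 : |Metric.infDist x A - Metric.infDist y A| ≤ dist x y :=
      abs_sub_le_iff.mpr ⟨by linarith [Metric.infDist_le_infDist_add_dist (s := A) (x := x) (y := y)],
        by linarith [Metric.infDist_le_infDist_add_dist (s := A) (x := y) (y := x),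
          dist_comm x y]⟩
    refine (abs_max_sub_max_le_max _ _ _ _).trans ?_
    rw [sub_self, abs_zero, sub_sub_sub_cancel_left, ← sub_div, abs_div,
      abs_of_pos (show 0 < R / δ by positivity), abs_sub_comm]
    exact max_le (by positivity) (by gcongr)
  set g : X → Compacts K := fun x => (f x : ℂ) • p with hg
  have hgc : Continuous g := by
    have : Continuous f := by fun_prop
    fun_prop
  have := secondCountableTopologyEither_of_left X (Compacts K)
  have hgm : StronglyMeasurable g := hgc.stronglyMeasurable
  have hg1 : ∀ x, ‖g x‖ ≤ 1 := fun x => by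
    rw [hg, norm_smul, hpn, mul_one, Complex.norm_real, Real.norm_of_nonneg (hf01 x).1]
    exact (hf01 x).2
  have hgv : HasVariation g δ R := by
    intro x y hxy
    refine (norm_ofReal_smul_sub_le (f x) (f y) hpn).trans_lt ?_
    calc |f x - f y| ≤ dist x y / (R / δ) := hflip x y
      _ < R / (R / δ) := by gcongr
      _ = δ := by field_simp
  have hloc := isLocalized_Lambda hρ hgm hg1
  have hLB : Lambda ρ g * chiTensor K ρ B = 0 := by
    have h1 := hloc.norm_le hB 0 le_rfl fun x hx => by
      change ‖(((f x : ℂ) • p : Compacts K) : K →L[ℂ] K) - 0‖ ≤ 0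
      rw [hfB x hx]
      simp
    rw [opTensor_zero_right, sub_zero] at h1
    exact clm_eq_zero_of_norm_le h1
  have hAL : chiTensor K ρ A * Lambda ρ g
      = chiTensor K ρ A * opTensor 1 (p : K →L[ℂ] K) := by
    have h1 := hloc.norm_le hA (p : K →L[ℂ] K) le_rfl fun x hx => by
      change ‖(((f x : ℂ) • p : Compacts K) : K →L[ℂ] K) - p‖ ≤ 0
      rw [hfA x hx]
      simp
    rw [hloc.commute hA, chiTensor_commute_one]
    have h2 := clm_eq_zero_of_norm_le h1
    rwa [sub_mul, sub_eq_zero] at h2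
  have h2 := norm_le_norm_commutator (T := opTensor T (1 : K →L[ℂ] K)) (norm_chiTensor_le A)
    (norm_chiTensor_le B) hLB hAL
  rw [← opTensor_mul, ← opTensor_mul, ← opTensor_mul, mul_one, one_mul, mul_one, mul_one] at h2
  exact ((norm_le_norm_opTensor _ hk hpk).trans h2).trans_lt (h g hgm hg1 hgv)

end StrongToQuasi

/-! ### Cell decompositions of spaces of bounded geometry -/

section Cells

variable {X : Type*} [MetricSpace X]

/-- A countable Borel partition of `X` into cells of bounded radius around the points of a set `Γ`,
such that each ball contains a uniformly bounded number of points of `Γ`. -/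
structure CellDecomposition (X : Type*) [MetricSpace X] [MeasurableSpace X] where
  /-- The set of centres of the cells. -/
  Γ : Set X
  /-- The cell around a centre. -/
  cell : Γ → Set X
  /-- A bound for the radius of the cells. -/
  radius : ℝ
  countable : Countable Γ
  radius_pos : 0 < radius
  measurableSet_cell : ∀ γ, MeasurableSet (cell γ)
  disjoint_cell : Pairwise fun γ γ' => Disjoint (cell γ) (cell γ')
  iUnion_cell : ⋃ γ, cell γ = Set.univ
  dist_le : ∀ γ, ∀ x ∈ cell γ, dist x γ ≤ radius
  encard_le : ∀ R : ℝ, ∃ N : ℕ, ∀ γ : Γ, {γ' : Γ | dist (γ : X) γ' ≤ R}.encard ≤ N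

theorem BoundedGeometry.nonempty_cellDecomposition [MeasurableSpace X] [BorelSpace X]
    (hX : BoundedGeometry X) : Nonempty (CellDecomposition X) := by
  classical
  obtain ⟨Γ, -, ⟨C, hC, hnet⟩, hball⟩ := hX
  have hcard : ∀ R : ℝ, ∃ N : ℕ, ∀ γ : Γ, {γ' : Γ | dist (γ : X) γ' ≤ R}.encard ≤ N := by
    intro R
    obtain ⟨N, hN⟩ := hball (max R 0 + 1) (by positivity)
    refine ⟨N, fun γ => le_trans ?_ (hN γ γ.2)⟩
    rw [← Subtype.val_injective.encard_image]
    refine Set.encard_le_encard ?_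
    rintro _ ⟨γ', hγ', rfl⟩
    refine ⟨?_, γ'.2⟩
    rw [Metric.mem_ball, dist_comm]
    have h1 : dist (γ : X) γ' ≤ R := hγ'
    linarith [le_max_left R 0]
  have hcount : Γ.Countable := by
    rcases Γ.eq_empty_or_nonempty with rfl | ⟨x₀, hx₀⟩
    · exact Set.countable_empty
    have h1 : Γ ⊆ ⋃ n : ℕ, (Metric.ball x₀ n ∩ Γ) := fun x hx => by
      obtain ⟨n, hn⟩ := exists_nat_gt (dist x x₀)
      exact Set.mem_iUnion.mpr ⟨n, hn, hx⟩
    refine (Set.countable_iUnion fun n : ℕ => ?_).mono h1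
    obtain ⟨N, hN⟩ := hball n (by positivity)
    exact (Set.finite_of_encard_le_coe (hN x₀ hx₀)).countable
  have hcount' : Countable Γ := hcount.to_subtype
  obtain ⟨e, he⟩ := exists_injective_nat Γ
  -- The cell of `γ` is its closed ball of radius `C`, minus the balls of the earlier points of `Γ`.
  refine ⟨⟨Γ, fun γ => Metric.closedBall (γ : X) C \
    ⋃ γ' : {γ' : Γ // e γ' < e γ}, Metric.closedBall (γ' : X) C, C, hcount', hC, fun γ => ?_,
    fun γ γ' hne => ?_, ?_, fun γ x hx => hx.1, hcard⟩⟩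
  · exact Metric.isClosed_closedBall.measurableSet.diff
      (MeasurableSet.iUnion fun _ => Metric.isClosed_closedBall.measurableSet)
  · refine Set.disjoint_left.mpr ?_
    rintro x ⟨hx, hx'⟩ ⟨hy, hy'⟩
    rcases lt_or_gt_of_ne (he.ne hne) with hlt | hlt
    · exact hy' (Set.mem_iUnion.mpr ⟨⟨γ, hlt⟩, hx⟩)
    · exact hx' (Set.mem_iUnion.mpr ⟨⟨γ', hlt⟩, hy⟩)
  · refine Set.eq_univ_of_forall fun x => ?_
    have hex : ∃ n, ∃ γ : Γ, e γ = n ∧ dist x γ ≤ C := by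
      obtain ⟨y, hy, hxy⟩ := hnet x
      exact ⟨_, ⟨y, hy⟩, rfl, hxy⟩
    obtain ⟨γ, hγn, hγ⟩ := Nat.find_spec hex
    refine Set.mem_iUnion.mpr ⟨γ, hγ, fun hx => ?_⟩
    obtain ⟨⟨γ', hlt⟩, hγ'⟩ := Set.mem_iUnion.mp hx
    rw [hγn] at hlt
    exact Nat.find_min hex hlt ⟨γ', rfl, hγ'⟩

namespace CellDecomposition

variable [MeasurableSpace X] (𝓒 : CellDecomposition X)

instance : Countable 𝓒.Γ := 𝓒.countable

theorem finite_nbr (R : ℝ) (γ : 𝓒.Γ) : {γ' : 𝓒.Γ | dist (γ : X) γ' ≤ R}.Finite := by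
  obtain ⟨N, hN⟩ := 𝓒.encard_le R
  exact Set.finite_of_encard_le_coe (hN γ)

/-- The centres at distance at most `R` from a given one. -/
noncomputable def nbr (R : ℝ) (γ : 𝓒.Γ) : Finset 𝓒.Γ := (𝓒.finite_nbr R γ).toFinset

theorem mem_nbr {R : ℝ} {γ γ' : 𝓒.Γ} : γ' ∈ 𝓒.nbr R γ ↔ dist (γ : X) γ' ≤ R := by
  simp [nbr]

theorem exists_card_nbr_le (R : ℝ) : ∃ N : ℕ, ∀ γ, (𝓒.nbr R γ).card ≤ N := by
  obtain ⟨N, hN⟩ := 𝓒.encard_le R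
  refine ⟨N, fun γ => ?_⟩
  have h := hN γ
  rw [(𝓒.finite_nbr R γ).encard_eq_coe_toFinset_card] at h
  exact_mod_cast h

end CellDecomposition

end Cells

/-! ### Operators of finite propagation are strongly quasi-local -/

section Propagation

open MeasureTheory

variable {X : Type*} [MetricSpace X] [ProperSpace X] [MeasurableSpace X] [BorelSpace X]
  {H : Type*} [NormedAddCommGroup H] [InnerProductSpace ℂ H] [CompleteSpace H]
  {K : Type*} [NormedAddCommGroup K] [InnerProductSpace ℂ K] [CompleteSpace K]
  {ρ : C₀(X, ℂ) →⋆ₙₐ[ℂ] (H →L[ℂ] H)}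

theorem chi_union_mul_eq_zero {E F : Set X} (hE : MeasurableSet E) (hF : MeasurableSet F)
    {S : H →L[ℂ] H} (h1 : chi ρ E * S = 0) (h2 : chi ρ F * S = 0) : chi ρ (E ∪ F) * S = 0 := by
  rw [← Set.union_sdiff_self, chi_union (hF.diff hE) Set.disjoint_sdiff_right, add_mul, h1,
    zero_add, Set.sdiff_eq, Set.inter_comm, ← chi_mul_chi hE.compl hF, mul_assoc, h2, mul_zero]

theorem mul_chi_union_eq_zero {E F : Set X} (hE : MeasurableSet E) (hF : MeasurableSet F)
    {S : H →L[ℂ] H} (h1 : S * chi ρ E = 0) (h2 : S * chi ρ F = 0) : S * chi ρ (E ∪ F) = 0 := by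
  rw [← Set.union_sdiff_self, chi_union (hF.diff hE) Set.disjoint_sdiff_right, mul_add, h1,
    zero_add, Set.sdiff_eq, ← chi_mul_chi hF hE.compl, ← mul_assoc, h2, zero_mul]

omit [ProperSpace X] [MeasurableSpace X] [BorelSpace X] in
theorem chi_mul_eq_zero_of_subset {E F : Set X} (h : E ⊆ F) {S : H →L[ℂ] H}
    (hS : chi ρ F * S = 0) : chi ρ E * S = 0 := by
  have h1 : chi ρ E = chi ρ E * chi ρ F := by
    ext v
    exact (chi_chi_of_subset ρ h v).symm
  rw [h1, mul_assoc, hS, mul_zero]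

theorem mul_chi_eq_zero_of_subset {E F : Set X} (hE : MeasurableSet E) (hF : MeasurableSet F)
    (h : E ⊆ F) {S : H →L[ℂ] H} (hS : S * chi ρ F = 0) : S * chi ρ E = 0 := by
  rw [← Set.inter_eq_self_of_subset_right h, ← chi_mul_chi hF hE, ← mul_assoc, hS, zero_mul]

/-- Compact sets that are farther apart than the propagation of `T` do not interact: apply
compactness in each variable. -/
theorem chi_mul_mul_chi_eq_zero {T : H →L[ℂ] H} {r : ℝ} (hT : propagation ρ T ≤ ENNReal.ofReal r)
    (hr : 0 ≤ r) {A B : Set X} (hA : IsCompact A) (hB : IsCompact B)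
    (hAB : ∀ a ∈ A, ∀ b ∈ B, r < dist a b) : chi ρ A * T * chi ρ B = 0 := by
  have hpt : ∀ a ∈ A, ∀ b ∈ B, ∃ V U : Set X, IsOpen V ∧ a ∈ V ∧ IsOpen U ∧ b ∈ U ∧
      chi ρ V * T * chi ρ U = 0 := by
    intro a ha b hb
    have h1 : (a, b) ∉ opSupport ρ T := by
      intro h
      have h2 : edist a b ≤ propagation ρ T :=
        le_iSup₂_of_le (f := fun (p : X × X) (_ : p ∈ opSupport ρ T) => edist p.1 p.2) (a, b) h
          le_rfl
      have h3 := h2.trans hT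
      rw [edist_dist, ENNReal.ofReal_le_ofReal_iff hr] at h3
      linarith [hAB a ha b hb]
    simp only [opSupport, Set.mem_ofPred_eq, not_forall, not_not] at h1
    obtain ⟨U, V, hU, hbU, hV, haV, h⟩ := h1
    exact ⟨V, U, hV, haV, hU, hbU, h⟩
  have hcol : ∀ b ∈ B, ∃ U : Set X, IsOpen U ∧ b ∈ U ∧ chi ρ A * T * chi ρ U = 0 := by
    intro b hb
    obtain ⟨W, U, hW, hU, hAW, hbU, h⟩ := hA.induction_on
      (p := fun S => ∃ W U : Set X, IsOpen W ∧ IsOpen U ∧ S ⊆ W ∧ b ∈ U ∧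
        chi ρ W * (T * chi ρ U) = 0)
      ⟨∅, Set.univ, isOpen_empty, isOpen_univ, subset_rfl, Set.mem_univ _, by
        rw [chi_empty, zero_mul]⟩
      (fun s t hst ⟨W, U, hW, hU, h1, h2, h3⟩ => ⟨W, U, hW, hU, hst.trans h1, h2, h3⟩)
      (fun s t ⟨W, U, hW, hU, h1, h2, h3⟩ ⟨W', U', hW', hU', h1', h2', h3'⟩ => by
        refine ⟨W ∪ W', U ∩ U', hW.union hW', hU.inter hU', Set.union_subset_union h1 h1',
          ⟨h2, h2'⟩, ?_⟩
        refine chi_union_mul_eq_zero hW.measurableSet hW'.measurableSet ?_ ?_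
        · rw [← mul_assoc] at h3 ⊢
          exact mul_chi_eq_zero_of_subset (hU.inter hU').measurableSet hU.measurableSet
            Set.inter_subset_left h3
        · rw [← mul_assoc] at h3' ⊢
          exact mul_chi_eq_zero_of_subset (hU.inter hU').measurableSet hU'.measurableSet
            Set.inter_subset_right h3')
      (fun a ha => by
        obtain ⟨V, U, hV, haV, hU, hbU, h⟩ := hpt a ha b hb
        exact ⟨V, mem_nhdsWithin_of_mem_nhds (hV.mem_nhds haV), V, U, hV, hU, subset_rfl, hbU, by
          rwa [← mul_assoc]⟩)
    refine ⟨U, hU, hbU, ?_⟩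
    rw [mul_assoc]
    exact chi_mul_eq_zero_of_subset hAW h
  obtain ⟨U, hU, hBU, h⟩ := hB.induction_on
    (p := fun S => ∃ U : Set X, IsOpen U ∧ S ⊆ U ∧ chi ρ A * T * chi ρ U = 0)
    ⟨∅, isOpen_empty, subset_rfl, by rw [chi_empty, mul_zero]⟩
    (fun s t hst ⟨U, hU, h1, h2⟩ => ⟨U, hU, hst.trans h1, h2⟩)
    (fun s t ⟨U, hU, h1, h2⟩ ⟨U', hU', h1', h2'⟩ =>
      ⟨U ∪ U', hU.union hU', Set.union_subset_union h1 h1',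
        mul_chi_union_eq_zero hU.measurableSet hU'.measurableSet h2 h2'⟩)
    (fun b hb => by
      obtain ⟨U, hU, hbU, h⟩ := hcol b hb
      exact ⟨U, mem_nhdsWithin_of_mem_nhds (hU.mem_nhds hbU), U, hU, subset_rfl, h⟩)
  exact mul_chi_eq_zero_of_subset hB.measurableSet hU.measurableSet hBU h

/-- A block of `[T, L]` is small if `L` is close, on both blocks, to an operator `a` that commutes
with `T`. -/
theorem norm_mul_commutator_mul_le {Y : Type*} [NormedAddCommGroup Y] [NormedSpace ℂ Y]
    {T L P Q a : Y →L[ℂ] Y} {δ : ℝ} (hP : ‖P‖ ≤ 1) (hQ : ‖Q‖ ≤ 1) (hPL : P * L = L * P)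
    (hPa : P * a = a * P) (haT : a * T = T * a) (h1 : ‖(L - a) * P‖ ≤ δ)
    (h2 : ‖(L - a) * Q‖ ≤ δ) : ‖P * (T * L - L * T) * Q‖ ≤ 2 * ‖T‖ * δ := by
  have e : P * (T * L - L * T) * Q = P * T * ((L - a) * Q) - (L - a) * P * (T * Q) := by
    have e1 : (L - a) * P = P * (L - a) := by rw [sub_mul, mul_sub, hPL, hPa]
    rw [e1]
    have e2 : T * L - L * T = T * (L - a) - (L - a) * T := by
      rw [mul_sub, sub_mul, haT]
      abel
    rw [e2]
    noncomm_ring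
  have hδ : 0 ≤ δ := (norm_nonneg _).trans h1
  rw [e]
  calc _ ≤ ‖P * T * ((L - a) * Q)‖ + ‖(L - a) * P * (T * Q)‖ := norm_sub_le _ _
    _ ≤ (‖P‖ * ‖T‖) * ‖(L - a) * Q‖ + ‖(L - a) * P‖ * (‖T‖ * ‖Q‖) := by
      refine add_le_add ((norm_mul_le _ _).trans ?_) ((norm_mul_le _ _).trans ?_)
      · gcongr
        exact norm_mul_le _ _
      · gcongr
        exact norm_mul_le _ _
    _ ≤ (1 * ‖T‖) * δ + δ * (‖T‖ * 1) := by gcongr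
    _ = _ := by ring

theorem mul_commutator_mul_eq_zero {Y : Type*} [NormedAddCommGroup Y] [NormedSpace ℂ Y]
    {T L P Q : Y →L[ℂ] Y} (hPL : P * L = L * P) (hQL : Q * L = L * Q) (h : P * T * Q = 0) :
    P * (T * L - L * T) * Q = 0 := by
  have e1 : P * (T * L) * Q = P * T * Q * L := by
    rw [mul_assoc (P * T), hQL]; noncomm_ring
  have e2 : P * (L * T) * Q = L * (P * T * Q) := by
    rw [← mul_assoc, hPL]; noncomm_ring
  rw [mul_sub, sub_mul, e1, e2, h, zero_mul, mul_zero, sub_zero]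

/-- Over cells, the commutator `[T ⊗ 1, Λ(g)]` is a sparse block matrix with small blocks. -/
theorem isStronglyQuasiLocal_of_propagation (hρ : IsModule ρ) (𝓒 : CellDecomposition X)
    {T : H →L[ℂ] H} (hT : propagation ρ T < ⊤) : IsStronglyQuasiLocal K ρ T := by
  intro ε hε
  set r := (propagation ρ T).toReal with hr
  have hr0 : 0 ≤ r := ENNReal.toReal_nonneg
  have hTr : propagation ρ T ≤ ENNReal.ofReal r := by rw [hr, ENNReal.ofReal_toReal hT.ne]
  have hC := 𝓒.radius_pos
  obtain ⟨N, hN⟩ := 𝓒.exists_card_nbr_le (r + 2 * 𝓒.radius)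
  set δ := ε / (2 * N * ‖T‖ + 1) with hδ
  have hδ0 : 0 < δ := by positivity
  -- If the block at `(γ, γ')` does not vanish, then `d(γ, γ') ≤ r + 2 * radius`, so both cells lie
  -- within distance `r + 3 * radius` of `γ'`.
  refine ⟨δ, hδ0, r + 4 * 𝓒.radius, by positivity, fun g hgm hg1 hgv => ?_⟩
  have hloc := isLocalized_Lambda hρ hgm hg1
  have hres := isResolution_chiTensor (K := K) hρ 𝓒.measurableSet_cell 𝓒.disjoint_cell
    𝓒.iUnion_cell
  have hle := hres.norm_le_of_sparse
    (D := opTensor T (1 : K →L[ℂ] K) * Lambda ρ g - Lambda ρ g * opTensor T (1 : K →L[ℂ] K))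
    (c := 2 * ‖T‖ * δ) (by positivity) (𝓒.nbr (r + 2 * 𝓒.radius)) hN
    (fun γ γ' h => by rw [𝓒.mem_nbr] at h ⊢; rwa [dist_comm])
    (fun γ γ' h => ?_) (fun γ γ' h => ?_)
  · refine hle.trans_lt ?_
    calc (N : ℝ) * (2 * ‖T‖ * δ) = (2 * N * ‖T‖) * δ := by ring
      _ < (2 * N * ‖T‖ + 1) * δ := by gcongr; linarith
      _ = ε := by rw [hδ]; field_simp
  · refine mul_commutator_mul_eq_zero (hloc.commute (𝓒.measurableSet_cell γ))
      (hloc.commute (𝓒.measurableSet_cell γ')) ?_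
    rw [𝓒.mem_nbr, not_le] at h
    have h1 : chi ρ (Metric.closedBall (γ : X) 𝓒.radius) * T *
        chi ρ (Metric.closedBall (γ' : X) 𝓒.radius) = 0 := by
      refine chi_mul_mul_chi_eq_zero hTr hr0 (isCompact_closedBall _ _) (isCompact_closedBall _ _)
        fun a ha b hb => ?_
      rw [Metric.mem_closedBall] at ha hb
      have h2 := dist_triangle4 (γ : X) a b γ'
      rw [dist_comm (γ : X) a] at h2
      linarith
    have h2 : chi ρ (𝓒.cell γ) * T * chi ρ (𝓒.cell γ') = 0 := by
      refine mul_chi_eq_zero_of_subset (𝓒.measurableSet_cell γ') measurableSet_closedBall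
        (𝓒.dist_le γ') ?_
      rw [mul_assoc]
      refine chi_mul_eq_zero_of_subset (𝓒.dist_le γ) ?_
      rwa [← mul_assoc]
    rw [← opTensor_mul, ← opTensor_mul, h2, opTensor_zero_left]
  · rw [𝓒.mem_nbr] at h
    have hvar : ∀ x, dist x (γ' : X) < r + 4 * 𝓒.radius →
        ‖(g x : K →L[ℂ] K) - (g γ' : K →L[ℂ] K)‖ ≤ δ := fun x hx => (hgv x γ' hx).le
    have haT : opTensor (1 : H →L[ℂ] H) (g γ' : K →L[ℂ] K) * opTensor T (1 : K →L[ℂ] K)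
        = opTensor T (1 : K →L[ℂ] K) * opTensor (1 : H →L[ℂ] H) (g γ' : K →L[ℂ] K) := by
      rw [← opTensor_mul, ← opTensor_mul, one_mul, mul_one, one_mul, mul_one]
    refine (norm_mul_commutator_mul_le (norm_chiTensor_le _) (norm_chiTensor_le _)
      (hloc.commute (𝓒.measurableSet_cell γ)) (chiTensor_commute_one _ _) haT
      (hloc.norm_le (𝓒.measurableSet_cell γ) (g γ') hδ0.le fun x hx => hvar x ?_)
      (hloc.norm_le (𝓒.measurableSet_cell γ') (g γ') hδ0.le fun x hx => hvar x ?_)).trans ?_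
    · have h1 := 𝓒.dist_le γ x hx
      have h2 := dist_triangle x (γ : X) γ'
      linarith
    · have h1 := 𝓒.dist_le γ' x hx
      linarith
    · gcongr
      exact norm_opTensor_one_right_le T

theorem norm_commutator_le {Y : Type*} [NormedAddCommGroup Y] [NormedSpace ℂ Y]
    {T T' L : Y →L[ℂ] Y} (hL : ‖L‖ ≤ 1) :
    ‖T * L - L * T‖ ≤ ‖T' * L - L * T'‖ + 2 * ‖T - T'‖ := by
  have e : T * L - L * T = (T' * L - L * T') + ((T - T') * L - L * (T - T')) := by noncomm_ring
  rw [e]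
  refine (norm_add_le _ _).trans (add_le_add le_rfl ?_)
  calc _ ≤ ‖(T - T') * L‖ + ‖L * (T - T')‖ := norm_sub_le _ _
    _ ≤ ‖T - T'‖ * ‖L‖ + ‖L‖ * ‖T - T'‖ := add_le_add (norm_mul_le _ _) (norm_mul_le _ _)
    _ ≤ ‖T - T'‖ * 1 + 1 * ‖T - T'‖ := by gcongr
    _ = _ := by ring

theorem isStronglyQuasiLocal_of_mem_closure (hρ : IsModule ρ) {S : Set (H →L[ℂ] H)}
    (hS : ∀ T ∈ S, IsStronglyQuasiLocal K ρ T) {T : H →L[ℂ] H} (hT : T ∈ closure S) :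
    IsStronglyQuasiLocal K ρ T := by
  intro ε hε
  obtain ⟨T', hT', hd⟩ := Metric.mem_closure_iff.mp hT (ε / 3) (by linarith)
  obtain ⟨δ, hδ, R, hR, h⟩ := hS T' hT' (ε / 3) (by linarith)
  refine ⟨δ, hδ, R, hR, fun g hgm hg1 hgv => ?_⟩
  have hloc := isLocalized_Lambda hρ hgm hg1
  have h1 := norm_commutator_le (T := opTensor T (1 : K →L[ℂ] K))
    (T' := opTensor T' (1 : K →L[ℂ] K)) (hloc.norm_le_one hρ hg1)
  have h2 : ‖opTensor T (1 : K →L[ℂ] K) - opTensor T' (1 : K →L[ℂ] K)‖ ≤ ‖T - T'‖ := by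
    rw [← opTensor_sub_left]
    exact norm_opTensor_one_right_le _
  rw [dist_eq_norm] at hd
  linarith [h g hgm hg1 hgv]

omit [ProperSpace X] [MeasurableSpace X] [BorelSpace X] in
theorem isClosed_isLocallyCompact : IsClosed {T : H →L[ℂ] H | IsLocallyCompact ρ T} := by
  have h : {T : H →L[ℂ] H | IsLocallyCompact ρ T}
      = ⋂ f : C₀(X, ℂ), ((fun T => ρ f * T) ⁻¹' {S : H →L[ℂ] H | IsCompactOperator S}) ∩
        ((fun T => T * ρ f) ⁻¹' {S : H →L[ℂ] H | IsCompactOperator S}) := by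
    ext T
    simp [IsLocallyCompact]
  rw [h]
  exact isClosed_iInter fun f => (isClosed_setOfPred_isCompactOperator.preimage (by fun_prop)).inter
    (isClosed_setOfPred_isCompactOperator.preimage (by fun_prop))

theorem roeAlgebra_subset_stronglyQuasiLocalAlgebra (hρ : IsModule ρ) (hX : BoundedGeometry X) :
    roeAlgebra ρ ⊆ stronglyQuasiLocalAlgebra K ρ := by
  obtain ⟨𝓒⟩ := hX.nonempty_cellDecomposition
  intro T hT
  refine ⟨closure_minimal (fun S hS => hS.1) isClosed_isLocallyCompact hT, ?_⟩
  exact isStronglyQuasiLocal_of_mem_closure hρ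
    (fun S hS => isStronglyQuasiLocal_of_propagation hρ 𝓒 hS.2) hT

end Propagation

/-! ### Sparse decompositions from almost invariant finite sets -/

section Sparse

/-- Let each point `x` of a finite weighted set carry a finite set `A x` of labels that varies
slowly along a relation `adj`.  After removing a small part, each remaining point can be given
one of its labels so that points with different labels are not adjacent.  Averaging over the
labels `p` yields a set `{x | p ∈ A x}` with small boundary; it is split off, and the
process is repeated. -/
theorem exists_sparse_subset {α β : Type*} [DecidableEq α] [DecidableEq β] {adj : α → α → Prop}
    [DecidableRel adj] (hadj : ∀ x y, adj x y → adj y x) {A : α → Finset β}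
    (hA : ∀ x, (A x).Nonempty) {w : α → ℝ} (hw : ∀ x, 0 ≤ w x) {c : ℝ} (hc : 0 ≤ c) (F : Finset α)
    (h : ∀ x ∈ F, ∑ y ∈ F with adj x y, ((A y \ A x).card : ℝ) ≤ c * (A x).card) :
    ∃ F' ⊆ F, ∃ l : α → β, (∀ x ∈ F', l x ∈ A x) ∧
      (∀ x ∈ F', ∀ y ∈ F', l x ≠ l y → ¬ adj x y) ∧
      ∑ x ∈ F \ F', w x ≤ c * ∑ x ∈ F, w x := by
  induction F using Finset.strongInduction with
  | H F ih =>
  rcases F.eq_empty_or_nonempty with rfl | ⟨x₀, hx₀⟩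
  · exact ⟨∅, subset_rfl, fun x => (hA x).choose, by simp, by simp, by simp⟩
  set E : β → Finset α := fun p => {x ∈ F | p ∈ A x} with hE
  set D : β → Finset α := fun p => {x ∈ F | p ∉ A x ∧ ∃ y ∈ F, p ∈ A y ∧ adj x y} with hD
  set P : Finset β := F.biUnion A with hP
  have hPne : P.Nonempty := by
    obtain ⟨p, hp⟩ := hA x₀
    exact ⟨p, Finset.mem_biUnion.mpr ⟨x₀, hx₀, hp⟩⟩
  -- Summed over all labels, the weights of the boundaries `D p` are at most `c` times those of the
  -- sets `E p`, so some label `p` does no worse than the average.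
  have hsum : ∑ p ∈ P, ∑ x ∈ D p, w x ≤ ∑ p ∈ P, c * ∑ x ∈ E p, w x := by
    have h1 : ∑ p ∈ P, ∑ x ∈ D p, w x = ∑ x ∈ F, ∑ p ∈ P with x ∈ D p, w x :=
      Finset.sum_comm' fun p x => by
        simp only [Finset.mem_filter, hD]
        tauto
    have h2 : ∑ p ∈ P, ∑ x ∈ E p, w x = ∑ x ∈ F, ∑ p ∈ A x, w x :=
      Finset.sum_comm' fun p x => by
        simp only [Finset.mem_filter, hE, hP, Finset.mem_biUnion]
        constructor
        · rintro ⟨-, hx, hp⟩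
          exact ⟨hp, hx⟩
        · rintro ⟨hp, hx⟩
          exact ⟨⟨x, hx, hp⟩, hx, hp⟩
    rw [← Finset.mul_sum, h1, h2, Finset.mul_sum]
    refine Finset.sum_le_sum fun x hx => ?_
    rw [Finset.sum_const, Finset.sum_const, nsmul_eq_mul, nsmul_eq_mul, ← mul_assoc]
    refine mul_le_mul_of_nonneg_right (le_trans ?_ (h x hx)) (hw x)
    have h3 : {p ∈ P | x ∈ D p} ⊆ ({y ∈ F | adj x y}).biUnion fun y => A y \ A x := by
      intro p hp
      simp only [Finset.mem_filter, hD] at hp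
      obtain ⟨-, -, hpx, y, hy, hpy, hxy⟩ := hp
      simp only [Finset.mem_biUnion, Finset.mem_filter, Finset.mem_sdiff]
      exact ⟨y, ⟨hy, hxy⟩, hpy, hpx⟩
    exact_mod_cast (Finset.card_le_card h3).trans Finset.card_biUnion_le
  obtain ⟨p, hp, hpw⟩ := Finset.exists_le_of_sum_le hPne hsum
  obtain ⟨x₁, hx₁, hpx₁⟩ := Finset.mem_biUnion.mp hp
  set F₁ : Finset α := F \ (E p ∪ D p) with hF₁
  have hF₁F : F₁ ⊆ F := Finset.sdiff_subset
  have hss : F₁ ⊂ F := by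
    refine Finset.ssubset_iff_subset_ne.mpr ⟨hF₁F, fun h1 => ?_⟩
    have h2 : x₁ ∈ F₁ := h1 ▸ hx₁
    exact (Finset.mem_sdiff.mp h2).2
      (Finset.mem_union_left _ (Finset.mem_filter.mpr ⟨hx₁, hpx₁⟩))
  obtain ⟨F', hF', l, hl, hsep, hwt⟩ := ih F₁ hss fun x hx => by
    refine le_trans ?_ (h x (hF₁F hx))
    exact Finset.sum_le_sum_of_subset_of_nonneg (Finset.filter_subset_filter _ hF₁F)
      fun _ _ _ => Nat.cast_nonneg _
  have hnp : ∀ x ∈ F', p ∉ A x ∧ ∀ y ∈ E p, ¬ adj x y := by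
    intro x hx
    obtain ⟨hxF, hxn⟩ := Finset.mem_sdiff.mp (hF' hx)
    rw [Finset.mem_union, not_or] at hxn
    have h1 : p ∉ A x := fun h1 => hxn.1 (Finset.mem_filter.mpr ⟨hxF, h1⟩)
    refine ⟨h1, fun y hy hxy => hxn.2 (Finset.mem_filter.mpr ⟨hxF, h1, y, ?_⟩)⟩
    obtain ⟨hyF, hpy⟩ := Finset.mem_filter.mp hy
    exact ⟨hyF, hpy, hxy⟩
  refine ⟨E p ∪ F', Finset.union_subset (Finset.filter_subset _ _) (hF'.trans hF₁F),
    fun x => if p ∈ A x then p else l x, fun x hx => ?_, fun x hx y hy hne => ?_, ?_⟩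
  · dsimp only
    split_ifs with h1
    · exact h1
    · rcases Finset.mem_union.mp hx with h2 | h2
      · exact absurd (Finset.mem_filter.mp h2).2 h1
      · exact hl x h2
  · rcases Finset.mem_union.mp hx with h2 | h2 <;> rcases Finset.mem_union.mp hy with h3 | h3
    · simp [(Finset.mem_filter.mp h2).2, (Finset.mem_filter.mp h3).2] at hne
    · exact fun h4 => (hnp y h3).2 x h2 (hadj _ _ h4)
    · exact (hnp x h2).2 y h3
    · simp only [(hnp x h2).1, (hnp y h3).1, if_false] at hne
      exact hsep x h2 y h3 hne
  · have h1 : F \ (E p ∪ F') ⊆ D p ∪ (F₁ \ F') := by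
      intro x hx
      simp only [Finset.mem_sdiff, Finset.mem_union, hF₁] at hx ⊢
      tauto
    have h2 : ∑ x ∈ E p, w x + ∑ x ∈ F₁, w x ≤ ∑ x ∈ F, w x := by
      rw [← Finset.sum_union]
      · exact Finset.sum_le_sum_of_subset_of_nonneg
          (Finset.union_subset (Finset.filter_subset _ _) hF₁F) fun x _ _ => hw x
      · exact Finset.disjoint_left.mpr fun x hx hx' =>
          (Finset.mem_sdiff.mp hx').2 (Finset.mem_union_left _ hx)
    calc ∑ x ∈ F \ (E p ∪ F'), w x ≤ ∑ x ∈ D p ∪ (F₁ \ F'), w x :=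
          Finset.sum_le_sum_of_subset_of_nonneg h1 fun x _ _ => hw x
      _ ≤ ∑ x ∈ D p, w x + ∑ x ∈ F₁ \ F', w x := by
          rw [← Finset.sum_union_inter]
          exact le_add_of_nonneg_right (Finset.sum_nonneg fun x _ => hw x)
      _ ≤ c * ∑ x ∈ E p, w x + c * ∑ x ∈ F₁, w x := add_le_add hpw hwt
      _ ≤ c * ∑ x ∈ F, w x := by
          rw [← mul_add]
          exact mul_le_mul_of_nonneg_left h2 hc

/-- Averaging over all subsets `s` of `I`: an ordered pair `i ≠ j` is separated by a quarter of the
subsets. -/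
theorem norm_sum_offDiag_le {ι Y : Type*} [DecidableEq ι] [NormedAddCommGroup Y] [NormedSpace ℂ Y]
    (I : Finset ι) (x : ι → ι → Y) {ε : ℝ} (h : ∀ s ⊆ I, ‖∑ i ∈ s, ∑ j ∈ I \ s, x i j‖ ≤ ε) :
    ‖∑ p ∈ I.offDiag, x p.1 p.2‖ ≤ 4 * ε := by
  have hε : 0 ≤ ε := (norm_nonneg _).trans (h ∅ (Finset.empty_subset _))
  rcases I.offDiag.eq_empty_or_nonempty with h0 | ⟨⟨i₀, j₀⟩, h0⟩
  · rw [h0, Finset.sum_empty, norm_zero]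
    positivity
  obtain ⟨hi₀, hj₀, hij₀⟩ := Finset.mem_offDiag.mp h0
  have hcard2 : 2 ≤ I.card := Finset.one_lt_card.mpr ⟨i₀, hi₀, j₀, hj₀, hij₀⟩
  -- The subsets with `i ∈ s` and `j ∉ s` form the interval from `{i}` to `I \ {j}`.
  have hcount : ∀ p ∈ I.offDiag, ({s ∈ I.powerset | p.1 ∈ s ∧ p.2 ∉ s}).card = 2 ^ (I.card - 2) := by
    rintro ⟨i, j⟩ hp
    obtain ⟨hi, hj, hij⟩ := Finset.mem_offDiag.mp hp
    have h1 : {s ∈ I.powerset | i ∈ s ∧ j ∉ s} = Finset.Icc {i} (I.erase j) := by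
      ext s
      simp only [Finset.mem_filter, Finset.mem_powerset, Finset.mem_Icc,
        Finset.singleton_subset_iff, Finset.subset_erase]
      tauto
    rw [h1, Finset.card_Icc_finset
      (Finset.singleton_subset_iff.mpr (Finset.mem_erase.mpr ⟨hij, hi⟩)),
      Finset.card_erase_of_mem hj, Finset.card_singleton, Nat.sub_sub]
  have hsum : ∑ s ∈ I.powerset, ∑ i ∈ s, ∑ j ∈ I \ s, x i j
      = 2 ^ (I.card - 2) • ∑ p ∈ I.offDiag, x p.1 p.2 := by
    have h1 : ∀ s ∈ I.powerset, ∑ i ∈ s, ∑ j ∈ I \ s, x i j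
        = ∑ p ∈ I.offDiag with p.1 ∈ s ∧ p.2 ∉ s, x p.1 p.2 := by
      intro s hs
      rw [← Finset.sum_product']
      refine Finset.sum_congr ?_ fun _ _ => rfl
      ext ⟨i, j⟩
      have := @Finset.mem_powerset.mp hs i
      simp only [Finset.mem_product, Finset.mem_sdiff, Finset.mem_filter, Finset.mem_offDiag]
      constructor
      · rintro ⟨hi, hj, hjs⟩
        exact ⟨⟨this hi, hj, fun hij => hjs (hij ▸ hi)⟩, hi, hjs⟩
      · rintro ⟨⟨-, hj, -⟩, hi, hjs⟩
        exact ⟨hi, hj, hjs⟩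
    rw [Finset.sum_congr rfl h1, Finset.smul_sum]
    have h2 : ∑ s ∈ I.powerset, ∑ p ∈ I.offDiag with p.1 ∈ s ∧ p.2 ∉ s, x p.1 p.2
        = ∑ p ∈ I.offDiag, ∑ s ∈ I.powerset with p.1 ∈ s ∧ p.2 ∉ s, x p.1 p.2 :=
      Finset.sum_comm' fun s p => by
        simp only [Finset.mem_filter]
        tauto
    rw [h2]
    refine Finset.sum_congr rfl fun p hp => ?_
    rw [Finset.sum_const, hcount p hp]
  have hle : ‖∑ s ∈ I.powerset, ∑ i ∈ s, ∑ j ∈ I \ s, x i j‖ ≤ 2 ^ I.card * ε := by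
    refine (norm_sum_le_of_le _ fun s hs => h s (Finset.mem_powerset.mp hs)).trans ?_
    rw [Finset.sum_const, Finset.card_powerset, nsmul_eq_mul]
    push_cast
    rfl
  have h2 : (2 : ℝ) ^ I.card = 2 ^ (I.card - 2) * 4 := by
    rw [show (4 : ℝ) = 2 ^ 2 by norm_num, ← pow_add, Nat.sub_add_cancel hcard2]
  rw [hsum, ← Nat.cast_smul_eq_nsmul ℂ, norm_smul, h2, mul_assoc] at hle
  push_cast [norm_pow] at hle
  rw [Complex.norm_ofNat] at hle
  exact le_of_mul_le_mul_left hle (by positivity)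

end Sparse

/-! ### Localization of operator norms -/

section Localization

open MeasureTheory

theorem card_sdiff_le_card_symmDiff {β : Type*} (i j : DecidableEq β) (s t : Finset β) :
    (@SDiff.sdiff _ (@Finset.instSDiff β i) s t).card
      ≤ (@symmDiff _ _ (@Finset.instSDiff β j) s t).card := by
  cases Subsingleton.elim i j
  exact Finset.card_le_card fun p hp =>
    Finset.mem_symmDiff.mpr (Or.inl (Finset.mem_sdiff.mp hp))

/-- Property A in the form in which it is used: the sets `A x` are almost invariant, and `A x` lies
over a ball around `x`. -/
theorem PropertyA.exists_finset {X : Type*} [MetricSpace X] [DecidableEq (X × ℕ)]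
    (h : PropertyA X) {r ε : ℝ} (hr : 0 < r) (hε : 0 < ε) :
    ∃ A : X → Finset (X × ℕ), ∃ S : ℝ, 0 < S ∧ (∀ x, (x, 1) ∈ A x) ∧
      (∀ x y, dist x y ≤ r → ((A x \ A y).card : ℝ) ≤ ε * (A x ∩ A y).card) ∧
      ∀ x, ∀ p ∈ A x, dist x p.1 ≤ S := by
  obtain ⟨A, h1, h2, S, hS, h3⟩ := h r hr ε hε
  refine ⟨A, S, hS, h1, fun x y hxy => ?_, fun x p hp => h3 x _ (h1 x) p hp⟩
  have h4 := (h2 x y hxy).le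
  refine le_trans ?_ (h4.trans_eq ?_)
  · exact Nat.cast_le.mpr (card_sdiff_le_card_symmDiff _ _ _ _)
  · congr!

theorem lt_setDist_of_forall {X : Type*} [MetricSpace X] {A B : Set X} {R R' : ℝ} (hR' : 0 < R')
    (hR : R < R') (h : ∀ a ∈ A, ∀ b ∈ B, R' ≤ dist a b) : ENNReal.ofReal R < setDist A B := by
  refine ((ENNReal.ofReal_lt_ofReal_iff hR').mpr hR).trans_le ?_
  refine le_iInf₂ fun a ha => le_iInf₂ fun b hb => ?_
  rw [edist_dist]
  exact ENNReal.ofReal_le_ofReal (h a ha b hb)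

variable {X : Type*} [MetricSpace X] [ProperSpace X] [MeasurableSpace X] [BorelSpace X]
  {H : Type*} [NormedAddCommGroup H] [InnerProductSpace ℂ H] [CompleteSpace H]
  {ρ : C₀(X, ℂ) →⋆ₙₐ[ℂ] (H →L[ℂ] H)}

theorem inner_chi_chi_of_disjoint {E F : Set X} (hF : MeasurableSet F) (h : Disjoint E F)
    (u v : H) : inner ℂ (chi ρ E u) (chi ρ F v) = 0 := by
  rw [chi_inner, chi_chi_of_disjoint hF h, inner_zero_right]

theorem norm_chi_biUnion_sq {ι : Type*} {E : ι → Set X} (hE : ∀ i, MeasurableSet (E i))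
    {s : Finset ι} (hd : (s : Set ι).PairwiseDisjoint E) (v : H) :
    ‖chi ρ (⋃ i ∈ s, E i) v‖ ^ 2 = ∑ i ∈ s, ‖chi ρ (E i) v‖ ^ 2 := by
  rw [chi_biUnion hE s hd, sum_apply]
  exact norm_sum_sq_of_inner_eq_zero fun i hi j hj hij =>
    inner_chi_chi_of_disjoint (hE j) (hd hi hj hij) v v

/-- If `B` is almost block diagonal with respect to the pieces `Ω i` of the source and `N i` of the
target, then its norm on `⋃ Ω i` is controlled by the norms on the single pieces. -/
theorem norm_mul_chi_biUnion_le (hρ : IsModule ρ) {ι : Type*} [DecidableEq ι] {I : Finset ι}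
    {Ω N : ι → Set X} (hΩ : ∀ i, MeasurableSet (Ω i)) (hN : ∀ i, MeasurableSet (N i))
    (hΩd : (I : Set ι).PairwiseDisjoint Ω) (hNd : (I : Set ι).PairwiseDisjoint N)
    {B : H →L[ℂ] H} {ε η : ℝ} (hη : 0 ≤ η)
    (hoff : ∀ s ⊆ I, ‖chi ρ (⋃ i ∈ s, N i) * B * chi ρ (⋃ j ∈ I \ s, Ω j)‖ ≤ ε)
    (hout : ‖chi ρ (⋃ i ∈ I, N i)ᶜ * B * chi ρ (⋃ j ∈ I, Ω j)‖ ≤ ε)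
    (hdiag : ∀ i ∈ I, ‖B * chi ρ (Ω i)‖ ≤ η) : ‖B * chi ρ (⋃ i ∈ I, Ω i)‖ ≤ 5 * ε + η := by
  set x : ι → ι → H →L[ℂ] H := fun i j => chi ρ (N i) * B * chi ρ (Ω j) with hx
  have hblock : ∀ s ⊆ I, ∀ t ⊆ I,
      chi ρ (⋃ i ∈ s, N i) * B * chi ρ (⋃ j ∈ t, Ω j) = ∑ i ∈ s, ∑ j ∈ t, x i j := by
    intro s hs t ht
    rw [chi_biUnion hN s (hNd.subset hs), chi_biUnion hΩ t (hΩd.subset ht), Finset.sum_mul,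
      Finset.sum_mul]
    exact Finset.sum_congr rfl fun i _ => Finset.mul_sum _ _ _
  have hdec : B * chi ρ (⋃ i ∈ I, Ω i)
      = chi ρ (⋃ i ∈ I, N i)ᶜ * B * chi ρ (⋃ j ∈ I, Ω j) + ∑ i ∈ I, x i i
        + ∑ p ∈ I.offDiag, x p.1 p.2 := by
    have h1 : ∑ i ∈ I, ∑ j ∈ I, x i j = ∑ i ∈ I, x i i + ∑ p ∈ I.offDiag, x p.1 p.2 := by
      rw [← Finset.sum_product' I I x, ← Finset.diag_union_offDiag,
        Finset.sum_union (Finset.disjoint_diag_offDiag I), Finset.sum_diag]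
    rw [add_assoc, ← h1, ← hblock I subset_rfl I subset_rfl,
      chi_compl hρ (Finset.measurableSet_biUnion _ fun i _ => hN i)]
    noncomm_ring
  have hD : ‖∑ i ∈ I, x i i‖ ≤ η := by
    refine ContinuousLinearMap.opNorm_le_bound _ hη fun v => ?_
    refine le_of_sq_le_sq ?_ (by positivity)
    have hsq : ‖∑ i ∈ I, x i i v‖ ^ 2 = ∑ i ∈ I, ‖x i i v‖ ^ 2 :=
      norm_sum_sq_of_inner_eq_zero fun i hi j hj hij =>
        inner_chi_chi_of_disjoint (hN j) (hNd hi hj hij) _ _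
    rw [sum_apply, hsq]
    calc ∑ i ∈ I, ‖x i i v‖ ^ 2 ≤ ∑ i ∈ I, η ^ 2 * ‖chi ρ (Ω i) v‖ ^ 2 := by
          refine Finset.sum_le_sum fun i hi => ?_
          rw [← mul_pow]
          gcongr
          have h1 : x i i v = chi ρ (N i) ((B * chi ρ (Ω i)) (chi ρ (Ω i) v)) := by
            change _ = chi ρ (N i) (B (chi ρ (Ω i) (chi ρ (Ω i) v)))
            rw [chi_idem]
            rfl
          rw [h1]
          refine (norm_chi_apply_le ρ _ _).trans ((ContinuousLinearMap.le_opNorm _ _).trans ?_)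
          gcongr
          exact hdiag i hi
      _ = (η * ‖chi ρ (⋃ i ∈ I, Ω i) v‖) ^ 2 := by
          rw [← Finset.mul_sum, ← norm_chi_biUnion_sq hΩ hΩd, mul_pow]
      _ ≤ (η * ‖v‖) ^ 2 := by
          gcongr
          exact norm_chi_apply_le ρ _ _
  have hO : ‖∑ p ∈ I.offDiag, x p.1 p.2‖ ≤ 4 * ε := by
    refine norm_sum_offDiag_le I x fun s hs => ?_
    rw [← hblock s hs (I \ s) Finset.sdiff_subset]
    exact hoff s hs
  rw [hdec]
  refine (norm_add₃_le).trans ?_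
  linarith

/-- Under Property A, the norm of an operator with small entries far from the diagonal is detected,
up to a factor of two, on sets of a fixed diameter: every vector has a large part supported on a
union of far apart sets of bounded diameter. -/
theorem exists_norm_le_of_forall_norm_mul_chi_le (hρ : IsModule ρ) (𝓒 : CellDecomposition X)
    (hX : PropertyA X) {R : ℝ} (hR : 0 < R) :
    ∃ S : ℝ, 0 < S ∧ ∀ (B : H →L[ℂ] H) (ε η : ℝ), 0 ≤ η →
      (∀ E F : Set X, MeasurableSet E → MeasurableSet F → ENNReal.ofReal R < setDist E F →
        ‖chi ρ E * B * chi ρ F‖ ≤ ε) →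
      (∀ E : Set X, MeasurableSet E → (∀ x ∈ E, ∀ y ∈ E, dist x y ≤ S) → ‖B * chi ρ E‖ ≤ η) →
      ‖B‖ ≤ 2 * (5 * ε + η) := by
  classical
  have hC := 𝓒.radius_pos
  -- Cells whose centres are farther apart than `r` have disjoint `R + 1`-neighbourhoods.
  set r := 2 * (R + 1) + 2 * 𝓒.radius with hr
  obtain ⟨N, hN⟩ := 𝓒.exists_card_nbr_le r
  obtain ⟨A, S, hS, hmem, hA, hAS⟩ := hX.exists_finset (r := r) (ε := 1 / (8 * (N + 1)))
    (by positivity) (by positivity)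
  refine ⟨2 * S + 2 * 𝓒.radius, by positivity, fun B ε η hη hfar hnear => ?_⟩
  have hε : 0 ≤ ε := (norm_nonneg _).trans (hfar ∅ ∅ .empty .empty (by simp [setDist]))
  have hres := isResolution_chi hρ 𝓒.measurableSet_cell 𝓒.disjoint_cell 𝓒.iUnion_cell
  have hmain : ∀ v, ‖B v‖ ≤ (5 * ε + η) * ‖v‖ + ‖B‖ * (‖v‖ / 2) := by
    intro v
    rcases eq_or_ne v 0 with rfl | hv
    · simp
    have hv' : 0 < ‖v‖ := norm_pos_iff.mpr hv
    obtain ⟨F, hF⟩ : ∃ F : Finset 𝓒.Γ,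
        7 / 8 * ‖v‖ ^ 2 < ∑ γ ∈ F, ‖chi ρ (𝓒.cell γ) v‖ ^ 2 := by
      have h := hres.hasSum_norm_sq v
      simp only [HasSum, SummationFilter.unconditional_filter] at h
      exact (h.eventually (lt_mem_nhds (by nlinarith))).exists
    have hsum_le : ∀ s : Finset 𝓒.Γ, ∑ γ ∈ s, ‖chi ρ (𝓒.cell γ) v‖ ^ 2 ≤ ‖v‖ ^ 2 := fun s =>
      sum_le_hasSum s (fun _ _ => sq_nonneg _) (hres.hasSum_norm_sq v)
    obtain ⟨F', hF'F, l, hl, hsep, hwt⟩ := exists_sparse_subset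
      (adj := fun γ γ' : 𝓒.Γ => dist (γ : X) γ' ≤ r) (fun γ γ' h => by rwa [dist_comm])
      (A := fun γ : 𝓒.Γ => A γ) (fun γ => ⟨_, hmem γ⟩)
      (w := fun γ => ‖chi ρ (𝓒.cell γ) v‖ ^ 2) (fun γ => sq_nonneg _)
      (c := 1 / 8) (by norm_num) F (fun γ hγ => by
        calc ∑ γ' ∈ ({γ' ∈ F | dist (γ : X) (γ' : X) ≤ r} : Finset 𝓒.Γ), ((A γ' \ A γ).card : ℝ)
            ≤ ∑ γ' ∈ ({γ' ∈ F | dist (γ : X) (γ' : X) ≤ r} : Finset 𝓒.Γ), 1 / (8 * (N + 1)) * ((A γ).card : ℝ) := by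
              refine Finset.sum_le_sum fun γ' hγ' => ?_
              have h1 := (Finset.mem_filter.mp hγ').2
              rw [dist_comm] at h1
              refine (hA γ' γ h1).trans ?_
              gcongr
              exact Finset.inter_subset_right
          _ ≤ ∑ γ' ∈ 𝓒.nbr r γ, 1 / (8 * (N + 1)) * ((A γ).card : ℝ) := by
              refine Finset.sum_le_sum_of_subset_of_nonneg (fun γ' hγ' => ?_)
                fun _ _ _ => by positivity
              exact 𝓒.mem_nbr.mpr (Finset.mem_filter.mp hγ').2
          _ ≤ (N + 1) * (1 / (8 * (N + 1)) * ((A γ).card : ℝ)) := by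
              rw [Finset.sum_const, nsmul_eq_mul]
              gcongr
              have : ((𝓒.nbr r γ).card : ℝ) ≤ N := by exact_mod_cast hN γ
              linarith
          _ = 1 / 8 * ((A γ).card : ℝ) := by field_simp)
    set I := F'.image l with hI
    set Ω : X × ℕ → Set X := fun p => ⋃ γ ∈ {γ ∈ F' | l γ = p}, 𝓒.cell γ with hΩdef
    have hΩ : ∀ p, MeasurableSet (Ω p) := fun p =>
      Finset.measurableSet_biUnion _ fun γ _ => 𝓒.measurableSet_cell γ
    have hΩmem : ∀ p x, x ∈ Ω p ↔ ∃ γ ∈ F', l γ = p ∧ x ∈ 𝓒.cell γ := fun p x => by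
      simp [hΩdef, and_assoc]
    have hΩsep : ∀ p q, p ≠ q → ∀ x ∈ Ω p, ∀ y ∈ Ω q, 2 * (R + 1) < dist x y := by
      intro p q hpq x hx y hy
      obtain ⟨γ, hγ, rfl, hxγ⟩ := (hΩmem p x).mp hx
      obtain ⟨γ', hγ', rfl, hyγ⟩ := (hΩmem q y).mp hy
      have h1 := not_le.mp (hsep γ hγ γ' hγ' hpq)
      have h2 := dist_triangle4 (γ : X) x y γ'
      have h3 := 𝓒.dist_le γ x hxγ
      have h4 := 𝓒.dist_le γ' y hyγ
      rw [dist_comm (γ : X) x] at h2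
      linarith
    have hΩdiam : ∀ p, ∀ x ∈ Ω p, ∀ y ∈ Ω p, dist x y ≤ 2 * S + 2 * 𝓒.radius := by
      intro p x hx y hy
      obtain ⟨γ, hγ, hγp, hxγ⟩ := (hΩmem p x).mp hx
      obtain ⟨γ', hγ', hγp', hyγ⟩ := (hΩmem p y).mp hy
      have h1 := hAS γ p (hγp ▸ hl γ hγ)
      have h2 := hAS γ' p (hγp' ▸ hl γ' hγ')
      have h3 := 𝓒.dist_le γ x hxγ
      have h4 := 𝓒.dist_le γ' y hyγ
      have h5 := dist_triangle4 x (γ : X) γ' y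
      have h6 := dist_triangle_right (γ : X) γ' p.1
      rw [dist_comm (γ' : X) y] at h5
      linarith
    -- Up to an error `ε`, `B` maps the part over `Ω p` essentially into `M p`.
    set M : X × ℕ → Set X := fun p => Metric.thickening (R + 1) (Ω p) with hM
    have hMm : ∀ p, MeasurableSet (M p) := fun p => Metric.isOpen_thickening.measurableSet
    have hMsep : ∀ p q, p ≠ q → ∀ x ∈ M p, ∀ y ∈ Ω q, R + 1 ≤ dist x y := by
      intro p q hpq x hx y hy
      obtain ⟨z, hz, hxz⟩ := Metric.mem_thickening_iff.mp hx
      have h1 := hΩsep p q hpq z hz y hy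
      have h2 := dist_triangle_left z y x
      linarith
    have hΩd : (I : Set (X × ℕ)).PairwiseDisjoint Ω := fun p _ q _ hpq =>
      Set.disjoint_left.mpr fun x hx hy => by
        have := hΩsep p q hpq x hx x hy
        rw [dist_self] at this
        linarith
    have hMd : (I : Set (X × ℕ)).PairwiseDisjoint M := fun p _ q _ hpq =>
      Set.disjoint_left.mpr fun x hx hy => by
        obtain ⟨z, hz, hxz⟩ := Metric.mem_thickening_iff.mp hy
        linarith [hMsep p q hpq x hx z hz]
    have hkey := norm_mul_chi_biUnion_le hρ hΩ hMm hΩd hMd hη (B := B) (ε := ε)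
      (fun s hs => hfar _ _ (Finset.measurableSet_biUnion _ fun i _ => hMm i)
        (Finset.measurableSet_biUnion _ fun i _ => hΩ i)
        (lt_setDist_of_forall (R' := R + 1) (by linarith) (by linarith) fun a ha b hb => by
          obtain ⟨p, hp, hap⟩ := Set.mem_iUnion₂.mp ha
          obtain ⟨q, hq, hbq⟩ := Set.mem_iUnion₂.mp hb
          refine hMsep p q ?_ a hap b hbq
          rintro rfl
          exact (Finset.mem_sdiff.mp hq).2 hp))
      (hfar _ _ (Finset.measurableSet_biUnion _ fun i _ => hMm i).compl
        (Finset.measurableSet_biUnion _ fun i _ => hΩ i)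
        (lt_setDist_of_forall (R' := R + 1) (by linarith) (by linarith) fun a ha b hb => by
          obtain ⟨q, hq, hbq⟩ := Set.mem_iUnion₂.mp hb
          by_contra hlt
          exact ha (Set.mem_iUnion₂.mpr
            ⟨q, hq, Metric.mem_thickening_iff.mpr ⟨b, hbq, not_le.mp hlt⟩⟩)))
      (fun p _ => hnear _ (hΩ p) (hΩdiam p))
    set W := ⋃ p ∈ I, Ω p with hW
    have hWm : MeasurableSet W := Finset.measurableSet_biUnion _ fun i _ => hΩ i
    have hWcell : W = ⋃ γ ∈ F', 𝓒.cell γ := by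
      ext x
      simp only [hW, Set.mem_iUnion, hΩmem, hI, Finset.mem_image, exists_prop]
      constructor
      · rintro ⟨p, -, γ, hγ, -, hx⟩
        exact ⟨γ, hγ, hx⟩
      · rintro ⟨γ, hγ, hx⟩
        exact ⟨l γ, ⟨γ, hγ, rfl⟩, γ, hγ, rfl, hx⟩
    -- The cells of `F` carry `7 / 8` of `‖v‖²` and at most `1 / 8` is lost in passing to `F'`, so
    -- that `W` carries at least `3 / 4`.
    have hvW : ‖v - chi ρ W v‖ ≤ ‖v‖ / 2 := by
      have h1 : ‖v‖ ^ 2 = ‖chi ρ W v‖ ^ 2 + ‖v - chi ρ W v‖ ^ 2 := by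
        have h2 := norm_chi_union_sq (ρ := ρ) hWm.compl disjoint_compl_right v
        rw [Set.union_compl_self, chi_univ hρ, chi_compl hρ hWm] at h2
        exact h2
      have h2 : ‖chi ρ W v‖ ^ 2 = ∑ γ ∈ F', ‖chi ρ (𝓒.cell γ) v‖ ^ 2 := by
        rw [hWcell]
        exact norm_chi_biUnion_sq 𝓒.measurableSet_cell
          (fun γ _ γ' _ hne => 𝓒.disjoint_cell hne) v
      have h3 := Finset.sum_sdiff (f := fun γ => ‖chi ρ (𝓒.cell γ) v‖ ^ 2) hF'F
      refine le_of_sq_le_sq ?_ (by positivity)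
      have h4 := hsum_le F
      rw [div_pow]
      linarith
    calc ‖B v‖ = ‖(B * chi ρ W) v + B (v - chi ρ W v)‖ := by
          rw [map_sub]
          congr 1
          change B v = B (chi ρ W v) + _
          abel
      _ ≤ ‖(B * chi ρ W) v‖ + ‖B (v - chi ρ W v)‖ := norm_add_le _ _
      _ ≤ (5 * ε + η) * ‖v‖ + ‖B‖ * (‖v‖ / 2) := by
          refine add_le_add ((ContinuousLinearMap.le_opNorm _ _).trans (by gcongr))
            ((ContinuousLinearMap.le_opNorm _ _).trans (by gcongr))
  have h1 : ‖B‖ ≤ (5 * ε + η) + ‖B‖ / 2 :=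
    B.opNorm_le_bound (by positivity) fun v => (hmain v).trans_eq (by ring)
  linarith

end Localization

/-! ### Compression to finite propagation -/

section UnitVectors

/-- The normalized indicator vectors of finite sets `A x` in `ℓ²`. -/
theorem exists_inner_eq_card_inter {α β : Type*} [DecidableEq β] (A : α → Finset β) :
    ∃ e : α → lp (fun _ : β => ℂ) 2, ∀ x y, inner ℂ (e x) (e y)
      = (((A x ∩ A y).card / (√(A x).card * √(A y).card) : ℝ) : ℂ) := by
  refine ⟨fun x => ∑ p ∈ A x, lp.single 2 p ((1 / √(A x).card : ℝ) : ℂ), fun x y => ?_⟩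
  rw [sum_inner]
  have h1 : ∀ p ∈ A x, inner ℂ (lp.single 2 p ((1 / √(A x).card : ℝ) : ℂ) : lp (fun _ : β => ℂ) 2)
      (∑ q ∈ A y, lp.single 2 q ((1 / √(A y).card : ℝ) : ℂ))
      = if p ∈ A y then ((1 / (√(A x).card * √(A y).card) : ℝ) : ℂ) else 0 := by
    intro p _
    rw [inner_sum]
    have h2 : ∀ q ∈ A y, inner ℂ
        (lp.single 2 p ((1 / √(A x).card : ℝ) : ℂ) : lp (fun _ : β => ℂ) 2)
        (lp.single 2 q ((1 / √(A y).card : ℝ) : ℂ))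
        = if p = q then ((1 / (√(A x).card * √(A y).card) : ℝ) : ℂ) else 0 := by
      intro q _
      rw [lp.inner_single_left, lp.single_apply]
      by_cases hpq : p = q
      · subst hpq
        simp [mul_comm]
      · simp [hpq]
    rw [Finset.sum_congr rfl h2, Finset.sum_ite_eq]
  rw [Finset.sum_congr rfl h1, ← Finset.sum_filter, Finset.sum_const, Finset.filter_mem_eq_inter,
    nsmul_eq_mul]
  push_cast
  ring

/-- Almost invariant finite sets have almost equal normalized indicator vectors. -/
theorem exists_unit_vectors {α β : Type*} [DecidableEq β] {A : α → Finset β}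
    (hA : ∀ x, (A x).Nonempty) :
    ∃ e : α → lp (fun _ : β => ℂ) 2, (∀ x, ‖e x‖ = 1) ∧
      (∀ x y, Disjoint (A x) (A y) → inner ℂ (e x) (e y) = 0) ∧
      ∀ x y, ∀ ε : ℝ, 0 < ε → ((A x \ A y).card : ℝ) ≤ ε * (A x ∩ A y).card →
        ((A y \ A x).card : ℝ) ≤ ε * (A x ∩ A y).card → ‖e x - e y‖ ^ 2 ≤ 2 * ε := by
  obtain ⟨e, he⟩ := exists_inner_eq_card_inter A
  have hpos : ∀ x, (0 : ℝ) < (A x).card := fun x => Nat.cast_pos.mpr (hA x).card_pos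
  have hnorm : ∀ x, ‖e x‖ = 1 := by
    intro x
    have h := he x x
    rw [inner_self_eq_norm_sq_to_K, Finset.inter_self, Real.mul_self_sqrt (hpos x).le,
      div_self (hpos x).ne'] at h
    have h2 : ‖e x‖ ^ 2 = 1 := Complex.ofReal_injective (by push_cast; exact h)
    rwa [pow_eq_one_iff_of_nonneg (norm_nonneg _) two_ne_zero] at h2
  refine ⟨e, hnorm, fun x y hxy => ?_, fun x y ε hε hxy hyx => ?_⟩
  · rw [he, Finset.disjoint_iff_inter_eq_empty.mp hxy]
    simp
  · have hx : ((A x).card : ℝ) ≤ (1 + ε) * (A x ∩ A y).card := by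
      have : (((A x \ A y).card + (A x ∩ A y).card : ℕ) : ℝ) = (A x).card := by
        rw [Finset.card_sdiff_add_card_inter]
      push_cast at this
      linarith
    have hy : ((A y).card : ℝ) ≤ (1 + ε) * (A x ∩ A y).card := by
      have : (((A y \ A x).card + (A y ∩ A x).card : ℕ) : ℝ) = (A y).card := by
        rw [Finset.card_sdiff_add_card_inter]
      rw [Finset.inter_comm (A y)] at this
      push_cast at this
      linarith
    have hxy' : √(A x).card * √(A y).card ≤ (1 + ε) * (A x ∩ A y).card := by
      calc √(A x).card * √(A y).card
          ≤ √((1 + ε) * (A x ∩ A y).card) * √((1 + ε) * (A x ∩ A y).card) := by gcongr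
        _ = (1 + ε) * (A x ∩ A y).card := Real.mul_self_sqrt (by positivity)
    have hp : 0 < √((A x).card : ℝ) * √((A y).card : ℝ) :=
      mul_pos (Real.sqrt_pos.mpr (hpos x)) (Real.sqrt_pos.mpr (hpos y))
    -- The inner product is at least `1 / (1 + ε) ≥ 1 - ε`.
    have hq : 1 - ε ≤ (A x ∩ A y).card / (√(A x).card * √(A y).card) := by
      rw [le_div_iff₀ hp]
      rcases le_or_gt (1 - ε) 0 with h | h
      · exact (mul_nonpos_of_nonpos_of_nonneg h hp.le).trans (Nat.cast_nonneg _)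
      · calc (1 - ε) * (√(A x).card * √(A y).card)
            ≤ (1 - ε) * ((1 + ε) * (A x ∩ A y).card) := by gcongr
          _ = (1 - ε ^ 2) * (A x ∩ A y).card := by ring
          _ ≤ 1 * (A x ∩ A y).card := by
            gcongr
            nlinarith
          _ = _ := one_mul _
    rw [@norm_sub_sq ℂ, hnorm, hnorm, he]
    have : RCLike.re ((((A x ∩ A y).card / (√(A x).card * √(A y).card) : ℝ) : ℂ))
        = (A x ∩ A y).card / (√(A x).card * √(A y).card) := Complex.ofReal_re _
    rw [this]
    linarith

end UnitVectors

section Compression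

variable {H : Type*} [NormedAddCommGroup H] [InnerProductSpace ℂ H] [CompleteSpace H]

omit [CompleteSpace H] in
theorem norm_le_of_forall_norm_inner_le {x : H} {c : ℝ} (hc : 0 ≤ c)
    (h : ∀ w, ‖inner ℂ w x‖ ≤ c * ‖w‖) : ‖x‖ ≤ c := by
  rcases eq_or_ne x 0 with rfl | hx
  · rwa [norm_zero]
  have h1 := h x
  rw [inner_self_eq_norm_sq_to_K, norm_pow, RCLike.norm_ofReal, abs_norm, pow_two] at h1
  exact le_of_mul_le_mul_right h1 (norm_pos_iff.mpr hx)

/-- `S'` is the compression `V* S V` of the operator `S`. -/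
def IsCompression {Y : Type*} [NormedAddCommGroup Y] [InnerProductSpace ℂ Y] (V : H →L[ℂ] Y)
    (S : Y →L[ℂ] Y) (S' : H →L[ℂ] H) : Prop :=
  ∀ w u, inner ℂ w (S' u) = inner ℂ (V w) (S (V u))

theorem exists_isCompression {Y : Type*} [NormedAddCommGroup Y] [InnerProductSpace ℂ Y]
    [CompleteSpace Y] (V : H →L[ℂ] Y) (S : Y →L[ℂ] Y) : ∃ S', IsCompression V S S' :=
  ⟨ContinuousLinearMap.adjoint V ∘L S ∘L V, fun w u =>
    ContinuousLinearMap.adjoint_inner_right V w (S (V u))⟩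

omit [CompleteSpace H] in
/-- Compressions by two contractions that are close on the range of `P` and `Q` are close between
these ranges. -/
theorem IsCompression.norm_inner_sub_le {Y : Type*} [NormedAddCommGroup Y] [InnerProductSpace ℂ Y]
    {V W : H →L[ℂ] Y} {S : Y →L[ℂ] Y} {T T' : H →L[ℂ] H} (hW : IsCompression W S T)
    (hV : IsCompression V S T') (hV1 : ∀ u, ‖V u‖ ≤ ‖u‖) (hW1 : ∀ u, ‖W u‖ ≤ ‖u‖) {c δ : ℝ}
    (hS : ‖S‖ ≤ c) {w u : H} (hw : ‖V w - W w‖ ≤ δ * ‖w‖) (hu : ‖V u - W u‖ ≤ δ * ‖u‖) :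
    ‖inner ℂ w ((T - T') u)‖ ≤ 2 * δ * c * ‖w‖ * ‖u‖ := by
  have e : inner ℂ w ((T - T') u)
      = -(inner ℂ (V w - W w) (S (W u)) + inner ℂ (V w) (S (V u - W u))) := by
    rw [sub_apply, inner_sub_right, hW, hV, map_sub, inner_sub_left, inner_sub_right]
    ring
  have hc : 0 ≤ c := (norm_nonneg _).trans hS
  rw [e, norm_neg]
  calc _ ≤ ‖V w - W w‖ * ‖S (W u)‖ + ‖V w‖ * ‖S (V u - W u)‖ :=
        (norm_add_le _ _).trans (add_le_add (norm_inner_le_norm _ _) (norm_inner_le_norm _ _))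
    _ ≤ (δ * ‖w‖) * (c * ‖u‖) + ‖w‖ * (c * (δ * ‖u‖)) := by
        have h1 : ‖S (W u)‖ ≤ c * ‖u‖ := S.le_of_opNorm_le_of_le hS (hW1 u)
        have h2 : ‖S (V u - W u)‖ ≤ c * (δ * ‖u‖) := S.le_of_opNorm_le_of_le hS hu
        have h3 := hV1 w
        have h4 : 0 ≤ δ * ‖w‖ := (norm_nonneg _).trans hw
        gcongr
    _ = _ := by ring

omit [CompleteSpace H] in
/-- Corners of the compression are bounded by the corresponding corners of `S`, if `V` intertwines
the projections `p`, `q` with `P`, `Q`. -/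
theorem IsCompression.norm_mul_mul_le {Y : Type*} [NormedAddCommGroup Y] [InnerProductSpace ℂ Y]
    {V : H →L[ℂ] Y} {S P Q : Y →L[ℂ] Y} {T' p q : H →L[ℂ] H} (hV : IsCompression V S T')
    (hV1 : ∀ u, ‖V u‖ ≤ ‖u‖) (hp : ∀ u v, inner ℂ (p u) v = inner ℂ u (p v))
    (hP : ∀ u v, inner ℂ (P u) v = inner ℂ u (P v)) (hPV : ∀ u, P (V u) = V (p u))
    (hQV : ∀ u, Q (V u) = V (q u)) {c : ℝ} (hc : ‖P * S * Q‖ ≤ c) : ‖p * T' * q‖ ≤ c := by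
  have hc0 : 0 ≤ c := (norm_nonneg _).trans hc
  refine ContinuousLinearMap.opNorm_le_bound _ hc0 fun u => ?_
  refine norm_le_of_forall_norm_inner_le (by positivity) fun w => ?_
  have e : inner ℂ w ((p * T' * q) u) = inner ℂ (V w) ((P * S * Q) (V u)) := by
    change inner ℂ w (p (T' (q u))) = inner ℂ (V w) (P (S (Q (V u))))
    rw [← hp, hV, ← hP, hPV, hQV]
  rw [e]
  calc _ ≤ ‖V w‖ * ‖(P * S * Q) (V u)‖ := norm_inner_le_norm _ _
    _ ≤ ‖w‖ * (c * ‖u‖) := by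
      have h1 := hV1 w
      have h2 : ‖(P * S * Q) (V u)‖ ≤ c * ‖u‖ :=
        ContinuousLinearMap.le_of_opNorm_le_of_le _ hc (hV1 u)
      gcongr
    _ = _ := by ring

variable {X : Type*} [MetricSpace X] [ProperSpace X] [MeasurableSpace X] [BorelSpace X]
  {K : Type*} [NormedAddCommGroup K] [InnerProductSpace ℂ K]
  {ρ : C₀(X, ℂ) →⋆ₙₐ[ℂ] (H →L[ℂ] H)} {𝓒 : CellDecomposition X}

variable (ρ) in
/-- `V` is the operator `u ↦ ∑ χ_γ u ⊗ e γ` from `H` to `H ⊗ K`, where `γ` runs over the cells: it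
intertwines the projections `χ_E` and `χ_E ⊗ 1`, and it is given by tensoring with `e γ` over the
cell of `γ`. -/
def IsCellEmbedding (e : 𝓒.Γ → K) (V : H →L[ℂ] HTensor H K) : Prop :=
  (∀ E, MeasurableSet E → ∀ u, chiTensor K ρ E (V u) = V (chi ρ E u)) ∧
  ∀ γ u, V (chi ρ (𝓒.cell γ) u) = tensorRight H (e γ) (chi ρ (𝓒.cell γ) u)

theorem exists_isCellEmbedding (hρ : IsModule ρ) {e : 𝓒.Γ → K} (he : ∀ γ, ‖e γ‖ = 1) :
    ∃ V : H →L[ℂ] HTensor H K, IsCellEmbedding ρ e V := by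
  have hres := isResolution_chi hρ 𝓒.measurableSet_cell 𝓒.disjoint_cell 𝓒.iUnion_cell
  have hresT := isResolution_chiTensor (K := K) hρ 𝓒.measurableSet_cell 𝓒.disjoint_cell
    𝓒.iUnion_cell
  obtain ⟨V, hV⟩ := hresT.exists_strongSum hres
    (S := fun γ => tensorRight H (e γ) ∘L chi ρ (𝓒.cell γ)) (M := 1)
    (fun γ u => by
      change chiTensor K ρ (𝓒.cell γ) (tensorRight H (e γ) (chi ρ (𝓒.cell γ) u)) = _
      rw [opTensor_tensorRight, chi_idem]
      rfl)
    (fun γ u => by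
      change tensorRight H (e γ) (chi ρ (𝓒.cell γ) (chi ρ (𝓒.cell γ) u)) = _
      rw [chi_idem]
      rfl)
    (fun γ => ContinuousLinearMap.opNorm_le_bound _ zero_le_one fun u => by
      change ‖tensorRight H (e γ) (chi ρ (𝓒.cell γ) u)‖ ≤ _
      rw [norm_tensorRight_apply, he, mul_one, one_mul]
      exact norm_chi_apply_le ρ _ _)
  refine ⟨V, fun E hE u => ?_, fun γ u => ?_⟩
  · have h1 := (hV u).mapL (chiTensor K ρ E)
    refine h1.unique ?_
    have h2 : ∀ γ, chiTensor K ρ E ((tensorRight H (e γ) ∘L chi ρ (𝓒.cell γ)) u)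
        = (tensorRight H (e γ) ∘L chi ρ (𝓒.cell γ)) (chi ρ E u) := by
      intro γ
      change chiTensor K ρ E (tensorRight H (e γ) (chi ρ (𝓒.cell γ) u))
        = tensorRight H (e γ) (chi ρ (𝓒.cell γ) (chi ρ E u))
      rw [opTensor_tensorRight, chi_chi hE (𝓒.measurableSet_cell γ),
        chi_chi (𝓒.measurableSet_cell γ) hE, Set.inter_comm]
      rfl
    simp only [h2]
    exact hV _
  · refine (hV _).unique ?_
    have h1 : tensorRight H (e γ) (chi ρ (𝓒.cell γ) u)
        = (tensorRight H (e γ) ∘L chi ρ (𝓒.cell γ)) (chi ρ (𝓒.cell γ) u) := by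
      change _ = tensorRight H (e γ) (chi ρ (𝓒.cell γ) (chi ρ (𝓒.cell γ) u))
      rw [chi_idem]
    rw [h1]
    refine hasSum_single γ fun γ' hne => ?_
    change tensorRight H (e γ') (chi ρ (𝓒.cell γ') (chi ρ (𝓒.cell γ) u)) = 0
    rw [chi_chi_of_disjoint (𝓒.measurableSet_cell γ) (𝓒.disjoint_cell hne), map_zero]

theorem IsCellEmbedding.norm_apply_le (hρ : IsModule ρ) {e : 𝓒.Γ → K} (he : ∀ γ, ‖e γ‖ = 1)
    {V : H →L[ℂ] HTensor H K} (hV : IsCellEmbedding ρ e V) (u : H) : ‖V u‖ ≤ ‖u‖ := by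
  have hres := isResolution_chi hρ 𝓒.measurableSet_cell 𝓒.disjoint_cell 𝓒.iUnion_cell
  have hresT := isResolution_chiTensor (K := K) hρ 𝓒.measurableSet_cell 𝓒.disjoint_cell
    𝓒.iUnion_cell
  have h := hresT.norm_le_of_forall hres zero_le_one (x := V u) (y := u) fun γ => by
    rw [hV.1 _ (𝓒.measurableSet_cell γ), hV.2, norm_tensorRight_apply, he, mul_one, one_mul]
  rwa [one_mul] at h

/-- Over a set that meets only cells with `e γ` close to `k`, the cell embedding is close to
`u ↦ u ⊗ k`. -/
theorem IsCellEmbedding.norm_sub_le (hρ : IsModule ρ) {e : 𝓒.Γ → K}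
    {V : H →L[ℂ] HTensor H K} (hV : IsCellEmbedding ρ e V) {N : Set X} (hN : MeasurableSet N)
    {k : K} {δ : ℝ} (hδ : 0 ≤ δ) (h : ∀ γ, (𝓒.cell γ ∩ N).Nonempty → ‖e γ - k‖ ≤ δ) (u : H) :
    ‖V (chi ρ N u) - tensorRight H k (chi ρ N u)‖ ≤ δ * ‖chi ρ N u‖ := by
  have hres := isResolution_chi hρ 𝓒.measurableSet_cell 𝓒.disjoint_cell 𝓒.iUnion_cell
  have hresT := isResolution_chiTensor (K := K) hρ 𝓒.measurableSet_cell 𝓒.disjoint_cell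
    𝓒.iUnion_cell
  refine hresT.norm_le_of_forall hres hδ fun γ => ?_
  have h1 : chiTensor K ρ (𝓒.cell γ) (V (chi ρ N u) - tensorRight H k (chi ρ N u))
      = tensorRight H (e γ - k) (chi ρ (𝓒.cell γ) (chi ρ N u)) := by
    rw [map_sub, hV.1 _ (𝓒.measurableSet_cell γ), hV.2, opTensor_tensorRight, tensorRight_sub]
    rfl
  rw [h1, norm_tensorRight_apply, mul_comm]
  rcases (𝓒.cell γ ∩ N).eq_empty_or_nonempty with h0 | h0
  · rw [chi_chi (𝓒.measurableSet_cell γ) hN, h0, chi_empty]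
    simp
  · gcongr
    exact h γ h0

omit [ProperSpace X] [BorelSpace X] in
/-- The compression is a Schur multiplier: it multiplies the `(γ, γ')` entry of `T` by
`⟪e γ, e γ'⟫`. -/
theorem IsCellEmbedding.compression_cell {e : 𝓒.Γ → K} {V : H →L[ℂ] HTensor H K}
    (hV : IsCellEmbedding ρ e V) {T T' : H →L[ℂ] H}
    (hT' : IsCompression V (opTensor T (1 : K →L[ℂ] K)) T') (γ γ' : 𝓒.Γ) :
    chi ρ (𝓒.cell γ) * T' * chi ρ (𝓒.cell γ')
      = (inner ℂ (e γ) (e γ') : ℂ) • (chi ρ (𝓒.cell γ) * T * chi ρ (𝓒.cell γ')) := by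
  ext u
  refine ext_inner_left ℂ fun w => ?_
  change inner ℂ w (chi ρ (𝓒.cell γ) (T' (chi ρ (𝓒.cell γ') u)))
    = inner ℂ w ((inner ℂ (e γ) (e γ') : ℂ) • chi ρ (𝓒.cell γ) (T (chi ρ (𝓒.cell γ') u)))
  rw [inner_smul_right, ← chi_inner, ← chi_inner, hT', hV.2, hV.2, opTensor_tensorRight,
    inner_tensorRight, mul_comm]
  rfl

end Compression

/-! ### Quasi-local operators under Property A -/

section QuasiLocal

variable {X : Type*} [MetricSpace X] [ProperSpace X] [MeasurableSpace X] [BorelSpace X]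
  {H : Type*} [NormedAddCommGroup H] [InnerProductSpace ℂ H] [CompleteSpace H]
  {ρ : C₀(X, ℂ) →⋆ₙₐ[ℂ] (H →L[ℂ] H)}

omit [ProperSpace X] [BorelSpace X] in
theorem CellDecomposition.finite_inter_nonempty (𝓒 : CellDecomposition X) {U : Set X}
    (hU : Bornology.IsBounded U) : {γ | (𝓒.cell γ ∩ U).Nonempty}.Finite := by
  rcases Set.eq_empty_or_nonempty {γ | (𝓒.cell γ ∩ U).Nonempty} with h | ⟨γ₀, x₀, hx₀, hxU₀⟩
  · rw [h]
    exact Set.finite_empty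
  obtain ⟨D, hD⟩ := Metric.isBounded_iff.mp hU
  refine (𝓒.nbr (D + 2 * 𝓒.radius) γ₀).finite_toSet.subset ?_
  rintro γ ⟨x, hx, hxU⟩
  refine 𝓒.mem_nbr.mpr ?_
  have h1 := dist_triangle4 (γ₀ : X) x₀ x γ
  have h2 := 𝓒.dist_le _ _ hx
  have h3 := 𝓒.dist_le _ _ hx₀
  have h4 := hD hxU₀ hxU
  rw [dist_comm (γ₀ : X) x₀] at h1
  linarith

theorem CellDecomposition.chi_eq_sum (hρ : IsModule ρ) (𝓒 : CellDecomposition X) {U : Set X}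
    (hU : Bornology.IsBounded U) (hUm : MeasurableSet U) :
    ∃ s : Finset 𝓒.Γ, chi ρ U = ∑ γ ∈ s, chi ρ (𝓒.cell γ) * chi ρ U := by
  refine ⟨(𝓒.finite_inter_nonempty hU).toFinset, ?_⟩
  ext u
  rw [sum_apply]
  refine (isResolution_chi hρ 𝓒.measurableSet_cell 𝓒.disjoint_cell
    𝓒.iUnion_cell).eq_sum_of_forall_notMem fun γ hγ => ?_
  rw [Set.Finite.mem_toFinset, Set.mem_ofPred_eq, Set.not_nonempty_iff_eq_empty] at hγ
  rw [chi_chi (𝓒.measurableSet_cell γ) hUm, hγ, chi_empty, zero_apply]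

omit [CompleteSpace H] in
theorem isCompactOperator_sum {ι : Type*} {s : Finset ι} {S : ι → H →L[ℂ] H}
    (h : ∀ i ∈ s, IsCompactOperator (S i)) : IsCompactOperator (∑ i ∈ s, S i : H →L[ℂ] H) :=
  Submodule.sum_mem (compactOperator (RingHom.id ℂ) H H) h

omit [CompleteSpace H] in
theorem isCompactOperator_mul_left {S : H →L[ℂ] H} (h : IsCompactOperator S) (T : H →L[ℂ] H) :
    IsCompactOperator (T * S : H →L[ℂ] H) :=
  h.clm_comp T

omit [CompleteSpace H] in
theorem isCompactOperator_mul_right {S : H →L[ℂ] H} (h : IsCompactOperator S) (T : H →L[ℂ] H) :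
    IsCompactOperator (S * T : H →L[ℂ] H) :=
  h.comp_clm T

omit [MeasurableSpace X] [BorelSpace X] in
/-- For bounded `E` there is `f ∈ C₀(X)` with `f = 1` near `E`, so that `ρ(f) χ_E = χ_E`. -/
theorem IsLocallyCompact.isCompactOperator_chi {T : H →L[ℂ] H} (hT : IsLocallyCompact ρ T)
    {E : Set X} (hE : Bornology.IsBounded E) :
    IsCompactOperator (chi ρ E * T : H →L[ℂ] H) ∧ IsCompactOperator (T * chi ρ E : H →L[ℂ] H) := by
  obtain ⟨f, r, -, hfr, -, hr1, -⟩ := exists_bump (K := Metric.cthickening 1 E)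
    (Metric.isCompact_of_isClosed_isBounded Metric.isClosed_cthickening hE.cthickening) isOpen_univ
    (Set.subset_univ _)
  have hf : ∀ x ∈ Metric.thickening 1 E, f x = 1 := fun x hx => by
    rw [hfr, hr1 x (Metric.thickening_subset_cthickening _ _ hx), Complex.ofReal_one]
  have hEU := Metric.self_subset_thickening one_pos E
  constructor
  · rw [← chi_rep_of_eq_one Metric.isOpen_thickening hEU hf, mul_assoc]
    exact isCompactOperator_mul_left (hT f).1 _
  · rw [← rep_chi_of_eq_one Metric.isOpen_thickening hEU hf, ← mul_assoc]
    exact isCompactOperator_mul_right (hT f).2 _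

/-- Functions in `C₀(X)` are approximated by functions of compact support. -/
theorem isLocallyCompact_of_isCompactOperator_chi {T : H →L[ℂ] H}
    (hT : ∀ E : Set X, Bornology.IsBounded E → MeasurableSet E →
      IsCompactOperator (chi ρ E * T : H →L[ℂ] H) ∧
      IsCompactOperator (T * chi ρ E : H →L[ℂ] H)) : IsLocallyCompact ρ T := by
  intro f
  have happrox : f ∈ closure {g : C₀(X, ℂ) | HasCompactSupport g} := by
    refine Metric.mem_closure_iff.mpr fun ε hε => ?_
    obtain ⟨g, hg, hfg⟩ := exists_hasCompactSupport_norm_sub_le f (half_pos hε)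
    exact ⟨g, hg, by rw [dist_eq_norm]; linarith⟩
  have hρc := continuous_rep ρ
  have hcl : IsClosed {S : H →L[ℂ] H | IsCompactOperator S} := isClosed_setOfPred_isCompactOperator
  have hzero : ∀ g : C₀(X, ℂ), ∀ x ∉ tsupport g, g x = 0 := fun g x hx =>
    image_eq_zero_of_notMem_tsupport hx
  have hm : ∀ g : C₀(X, ℂ), MeasurableSet (tsupport g) := fun g =>
    (isClosed_tsupport g).measurableSet
  constructor
  · refine closure_minimal (t := (fun g => ρ g * T) ⁻¹' {S : H →L[ℂ] H | IsCompactOperator S})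
      (fun g hg => ?_) (hcl.preimage (by fun_prop)) happrox
    have hg' : HasCompactSupport g := hg
    change IsCompactOperator (ρ g * T : H →L[ℂ] H)
    rw [← rep_chi_of_eq_zero (hzero g), mul_assoc]
    exact isCompactOperator_mul_left (hT _ hg'.isCompact.isBounded (hm g)).1 _
  · refine closure_minimal (t := (fun g => T * ρ g) ⁻¹' {S : H →L[ℂ] H | IsCompactOperator S})
      (fun g hg => ?_) (hcl.preimage (by fun_prop)) happrox
    have hg' : HasCompactSupport g := hg
    change IsCompactOperator (T * ρ g : H →L[ℂ] H)
    rw [← chi_rep_of_eq_zero (hzero g), ← mul_assoc]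
    exact isCompactOperator_mul_right (hT _ hg'.isCompact.isBounded (hm g)).2 _

/-- An operator of finite propagation with respect to the cells is locally compact if all its
entries are compact. -/
theorem isLocallyCompact_of_cells (hρ : IsModule ρ) (𝓒 : CellDecomposition X) {L : ℝ}
    {T : H →L[ℂ] H}
    (hT : ∀ γ γ' : 𝓒.Γ, L < dist (γ : X) γ' → chi ρ (𝓒.cell γ) * T * chi ρ (𝓒.cell γ') = 0)
    (hc : ∀ γ γ', IsCompactOperator (chi ρ (𝓒.cell γ) * T * chi ρ (𝓒.cell γ') : H →L[ℂ] H)) :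
    IsLocallyCompact ρ T := by
  have hres := isResolution_chi hρ 𝓒.measurableSet_cell 𝓒.disjoint_cell 𝓒.iUnion_cell
  have hcol : ∀ γ', IsCompactOperator (T * chi ρ (𝓒.cell γ') : H →L[ℂ] H) := by
    intro γ'
    have h : T * chi ρ (𝓒.cell γ')
        = ∑ γ ∈ 𝓒.nbr L γ', chi ρ (𝓒.cell γ) * T * chi ρ (𝓒.cell γ') := by
      ext u
      rw [sum_apply]
      refine hres.eq_sum_of_forall_notMem fun γ hγ => ?_
      rw [𝓒.mem_nbr, not_le, dist_comm] at hγ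
      exact congrArg (fun S : H →L[ℂ] H => S u) (hT γ γ' hγ)
    rw [h]
    exact isCompactOperator_sum fun γ _ => hc γ γ'
  have hrow : ∀ γ, IsCompactOperator (chi ρ (𝓒.cell γ) * T : H →L[ℂ] H) := by
    intro γ
    have h : chi ρ (𝓒.cell γ) * T
        = ∑ γ' ∈ 𝓒.nbr L γ, chi ρ (𝓒.cell γ) * T * chi ρ (𝓒.cell γ') := by
      rw [← Finset.mul_sum]
      refine hres.ext_right fun δ u => ?_
      change (chi ρ (𝓒.cell γ) * T * chi ρ (𝓒.cell δ)) u
        = (chi ρ (𝓒.cell γ) * T) ((∑ γ' ∈ 𝓒.nbr L γ, chi ρ (𝓒.cell γ')) (chi ρ (𝓒.cell δ) u))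
      rw [sum_apply]
      by_cases hδ : δ ∈ 𝓒.nbr L γ
      · rw [Finset.sum_eq_single δ, chi_idem]
        · rfl
        · intro γ' _ hne
          exact chi_chi_of_disjoint (𝓒.measurableSet_cell δ) (𝓒.disjoint_cell hne) u
        · exact fun h => absurd hδ h
      · rw [Finset.sum_eq_zero, map_zero]
        · rw [𝓒.mem_nbr, not_le] at hδ
          rw [hT γ δ hδ, zero_apply]
        · intro γ' hγ'
          refine chi_chi_of_disjoint (𝓒.measurableSet_cell δ) (𝓒.disjoint_cell ?_) u
          rintro rfl
          exact hδ hγ'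
    rw [h]
    exact isCompactOperator_sum fun γ' _ => hc γ γ'
  refine isLocallyCompact_of_isCompactOperator_chi fun E hE hEm => ?_
  obtain ⟨s, hs⟩ := 𝓒.chi_eq_sum hρ hE hEm
  constructor
  · have hs' : chi ρ E = ∑ γ ∈ s, chi ρ E * chi ρ (𝓒.cell γ) := by
      refine hs.trans (Finset.sum_congr rfl fun γ _ => ?_)
      rw [chi_mul_chi (𝓒.measurableSet_cell γ) hEm, chi_mul_chi hEm (𝓒.measurableSet_cell γ),
        Set.inter_comm]
    rw [hs', Finset.sum_mul]
    refine isCompactOperator_sum fun γ _ => ?_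
    rw [mul_assoc]
    exact isCompactOperator_mul_left (hrow γ) _
  · rw [hs, Finset.mul_sum]
    refine isCompactOperator_sum fun γ _ => ?_
    rw [← mul_assoc]
    exact isCompactOperator_mul_right (hcol γ) _

theorem propagation_lt_top_of_cells (hρ : IsModule ρ) (𝓒 : CellDecomposition X) {L : ℝ}
    {T : H →L[ℂ] H}
    (hT : ∀ γ γ' : 𝓒.Γ, L < dist (γ : X) γ' → chi ρ (𝓒.cell γ) * T * chi ρ (𝓒.cell γ') = 0) :
    propagation ρ T < ⊤ := by
  have hres := isResolution_chi hρ 𝓒.measurableSet_cell 𝓒.disjoint_cell 𝓒.iUnion_cell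
  refine lt_of_le_of_lt (b := ENNReal.ofReal (L + 2 * 𝓒.radius + 2)) (iSup₂_le ?_)
    ENNReal.ofReal_lt_top
  rintro ⟨y, x⟩ hyx
  change edist y x ≤ _
  rw [edist_dist]
  refine ENNReal.ofReal_le_ofReal (le_of_not_gt fun hlt => ?_)
  refine hyx (Metric.ball x 1) (Metric.ball y 1) Metric.isOpen_ball (Metric.mem_ball_self one_pos)
    Metric.isOpen_ball (Metric.mem_ball_self one_pos) ?_
  refine hres.ext_left fun γ u => ?_
  rw [zero_apply, map_zero]
  have h0 : chi ρ (𝓒.cell γ) * (chi ρ (Metric.ball y 1) * T * chi ρ (Metric.ball x 1)) = 0 := by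
    refine hres.ext_right fun γ' u => ?_
    have hcomm1 : chi ρ (𝓒.cell γ) * chi ρ (Metric.ball y 1)
        = chi ρ (𝓒.cell γ ∩ Metric.ball y 1) :=
      chi_mul_chi (𝓒.measurableSet_cell γ) measurableSet_ball
    have hcomm2 : chi ρ (Metric.ball x 1) * chi ρ (𝓒.cell γ')
        = chi ρ (𝓒.cell γ' ∩ Metric.ball x 1) := by
      rw [chi_mul_chi measurableSet_ball (𝓒.measurableSet_cell γ'), Set.inter_comm]
    have h1 : chi ρ (𝓒.cell γ ∩ Metric.ball y 1) * T * chi ρ (𝓒.cell γ' ∩ Metric.ball x 1) = 0 := by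
      rcases (𝓒.cell γ ∩ Metric.ball y 1).eq_empty_or_nonempty with h | ⟨a, ha, hay⟩
      · rw [h, chi_empty, zero_mul, zero_mul]
      rcases (𝓒.cell γ' ∩ Metric.ball x 1).eq_empty_or_nonempty with h | ⟨b, hb, hbx⟩
      · rw [h, chi_empty, mul_zero]
      refine mul_chi_eq_zero_of_subset ((𝓒.measurableSet_cell γ').inter measurableSet_ball)
        (𝓒.measurableSet_cell γ') Set.inter_subset_left ?_
      rw [mul_assoc]
      refine chi_mul_eq_zero_of_subset Set.inter_subset_left ?_
      rw [← mul_assoc]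
      refine hT γ γ' ?_
      have h2 := 𝓒.dist_le _ _ ha
      have h3 := 𝓒.dist_le _ _ hb
      have h4 := dist_triangle4 y a b x
      have h5 := dist_triangle4 a (γ : X) γ' b
      rw [Metric.mem_ball] at hay hbx
      rw [dist_comm y a] at h4
      rw [dist_comm (γ' : X) b] at h5
      linarith
    change (chi ρ (𝓒.cell γ) * (chi ρ (Metric.ball y 1) * T * chi ρ (Metric.ball x 1))
      * chi ρ (𝓒.cell γ')) u = 0
    rw [mul_assoc (chi ρ (𝓒.cell γ)), mul_assoc _ _ (chi ρ (𝓒.cell γ')), hcomm2,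
      ← mul_assoc, ← mul_assoc, hcomm1, h1, zero_apply]
  exact congrArg (fun S : H →L[ℂ] H => S u) h0

/-- The compression of `T ⊗ 1` by the cell embedding of slowly varying unit vectors `e γ` is close
to `T` on sets `E` of small diameter. -/
theorem norm_sub_compression_mul_chi_le (hρ : IsModule ρ) {𝓒 : CellDecomposition X}
    {K : Type*} [NormedAddCommGroup K] [InnerProductSpace ℂ K] {e : 𝓒.Γ → K} (he : ∀ γ, ‖e γ‖ = 1)
    {V : H →L[ℂ] HTensor H K} (hV : IsCellEmbedding ρ e V) {T T' : H →L[ℂ] H}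
    (hT' : IsCompression V (opTensor T (1 : K →L[ℂ] K)) T') {E N : Set X} (hE : MeasurableSet E)
    (hN : MeasurableSet N) (hEN : E ⊆ N) {k : K} (hk : ‖k‖ = 1) {δ ε : ℝ} (hδ : 0 ≤ δ)
    (hek : ∀ γ, (𝓒.cell γ ∩ N).Nonempty → ‖e γ - k‖ ≤ δ)
    (hout : ‖chi ρ Nᶜ * (T - T') * chi ρ E‖ ≤ ε) :
    ‖(T - T') * chi ρ E‖ ≤ 2 * δ * ‖T‖ + ε := by
  -- `T` itself is the compression of `T ⊗ 1` by the isometry `u ↦ u ⊗ k`.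
  have hj : IsCompression (tensorRight H k) (opTensor T (1 : K →L[ℂ] K)) T := fun w u => by
    rw [opTensor_tensorRight, inner_tensorRight]
    change _ = _ * inner ℂ k k
    rw [inner_self_eq_norm_sq_to_K, hk]
    simp
  have hj1 : ∀ u, ‖tensorRight H k u‖ ≤ ‖u‖ := fun u => by rw [norm_tensorRight_apply, hk, mul_one]
  have hin : ‖chi ρ N * (T - T') * chi ρ E‖ ≤ 2 * δ * ‖T‖ := by
    refine ContinuousLinearMap.opNorm_le_bound _ (by positivity) fun u => ?_
    refine norm_le_of_forall_norm_inner_le (by positivity) fun w => ?_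
    change ‖inner ℂ w (chi ρ N ((T - T') (chi ρ E u)))‖ ≤ _
    rw [← chi_inner]
    refine (hj.norm_inner_sub_le hT' (hV.norm_apply_le hρ he) hj1 (norm_opTensor_one_right_le T)
      (hV.norm_sub_le hρ hN hδ hek w) (hV.norm_sub_le hρ hE hδ
        (fun γ hγ => hek γ (hγ.mono (Set.inter_subset_inter_right _ hEN))) u)).trans ?_
    calc 2 * δ * ‖T‖ * ‖chi ρ N w‖ * ‖chi ρ E u‖ ≤ 2 * δ * ‖T‖ * ‖w‖ * ‖u‖ := by
          gcongr
          · exact norm_chi_apply_le ρ _ _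
          · exact norm_chi_apply_le ρ _ _
      _ = _ := by ring
  have hsplit : (T - T') * chi ρ E
      = chi ρ N * (T - T') * chi ρ E + chi ρ Nᶜ * (T - T') * chi ρ E := by
    rw [chi_compl hρ hN]
    noncomm_ring
  rw [hsplit]
  exact (norm_add_le _ _).trans (add_le_add hin hout)

/-- Under Property A, a locally compact quasi-local operator `T` is a limit of locally compact
operators of finite propagation, namely of the operators with entries
`⟪e γ, e γ'⟫ χ_γ T χ_γ'`, where the `e γ` are slowly varying unit vectors. -/
theorem quasiLocalAlgebra_subset_roeAlgebra (hρ : IsModule ρ) (hX : BoundedGeometry X)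
    (hA : PropertyA X) : quasiLocalAlgebra ρ ⊆ roeAlgebra ρ := by
  classical
  obtain ⟨𝓒⟩ := hX.nonempty_cellDecomposition
  rintro T ⟨hTc, hTq⟩
  refine Metric.mem_closure_iff.mpr fun ε hε => ?_
  have hC := 𝓒.radius_pos
  -- The final estimate is `2 * (5 * (2 * ε') + 4 * ε') = 28 * ε'`.
  set ε' := ε / 30 with hε'
  have hε'0 : 0 < ε' := by positivity
  obtain ⟨R, hR, hTR⟩ := hTq ε' hε'0
  obtain ⟨S, hS, hloc⟩ := exists_norm_le_of_forall_norm_mul_chi_le hρ 𝓒 hA hR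
  set δ := ε' / (‖T‖ + 1) with hδ
  have hδ0 : 0 < δ := by positivity
  have hδT : δ * ‖T‖ ≤ ε' := by
    rw [hδ, div_mul_eq_mul_div, div_le_iff₀ (by positivity)]
    nlinarith [norm_nonneg T]
  obtain ⟨A, L, hL, hmem, hvar, hdiam⟩ := hA.exists_finset (r := R + 1 + S + 2 * 𝓒.radius)
    (ε := δ ^ 2 / 2) (by positivity) (by positivity)
  obtain ⟨e, he1, he0, hed⟩ := exists_unit_vectors (A := A) fun x => ⟨_, hmem x⟩
  have heδ : ∀ x y, dist x y ≤ R + 1 + S + 2 * 𝓒.radius → ‖e x - e y‖ ≤ δ := by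
    intro x y hxy
    refine le_of_sq_le_sq ((hed x y (δ ^ 2 / 2) (by positivity) (hvar x y hxy) ?_).trans_eq
      (by ring)) hδ0.le
    rw [Finset.inter_comm]
    exact hvar y x (by rwa [dist_comm])
  obtain ⟨V, hV⟩ := exists_isCellEmbedding (ρ := ρ) (𝓒 := 𝓒) hρ (e := fun γ => e γ)
    fun γ => he1 γ
  have hV1 := hV.norm_apply_le hρ fun γ => he1 γ
  obtain ⟨T', hT'⟩ := exists_isCompression V
    (opTensor T (1 : lp (fun _ : X × ℕ => ℂ) 2 →L[ℂ] lp (fun _ : X × ℕ => ℂ) 2))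
  have hentry := hV.compression_cell hT'
  have hfar : ∀ γ γ' : 𝓒.Γ, 2 * L < dist (γ : X) γ' →
      chi ρ (𝓒.cell γ) * T' * chi ρ (𝓒.cell γ') = 0 := by
    intro γ γ' h
    rw [hentry, he0, zero_smul]
    refine Finset.disjoint_left.mpr fun p hp hp' => ?_
    have h1 := hdiam γ p hp
    have h2 := hdiam γ' p hp'
    have h3 := dist_triangle_right (γ : X) γ' p.1
    linarith
  have hbdd : ∀ γ, Bornology.IsBounded (𝓒.cell γ) := fun γ =>
    Metric.isBounded_closedBall.subset (𝓒.dist_le γ)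
  have hT'c : IsLocallyCompact ρ T' := by
    refine isLocallyCompact_of_cells hρ 𝓒 hfar fun γ γ' => ?_
    rw [hentry]
    refine Submodule.smul_mem (compactOperator (RingHom.id ℂ) H H) _ ?_
    rw [mul_assoc]
    exact isCompactOperator_mul_left (hTc.isCompactOperator_chi (hbdd γ')).2 _
  have hdiff : ∀ E F : Set X, MeasurableSet E → MeasurableSet F →
      ENNReal.ofReal R < setDist E F → ‖chi ρ E * (T - T') * chi ρ F‖ ≤ 2 * ε' := by
    intro E F hE hF hEF
    have h1 := hTR E F hE hF hEF
    have h2 : ‖chi ρ E * T' * chi ρ F‖ ≤ ε' := by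
      refine hT'.norm_mul_mul_le hV1 (chi_inner ρ E)
        (formalAdjoint_opTensor (chi_inner ρ E) formalAdjoint_one) (hV.1 E hE) (hV.1 F hF) ?_
      rw [← opTensor_mul, ← opTensor_mul, mul_one, mul_one]
      exact (norm_opTensor_one_right_le _).trans h1.le
    rw [mul_sub, sub_mul]
    refine (norm_sub_le _ _).trans ?_
    linarith
  have hnear : ∀ E : Set X, MeasurableSet E → (∀ x ∈ E, ∀ y ∈ E, dist x y ≤ S) →
      ‖(T - T') * chi ρ E‖ ≤ 4 * ε' := by
    intro E hE hES
    rcases E.eq_empty_or_nonempty with rfl | ⟨x₀, hx₀⟩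
    · rw [chi_empty, mul_zero, norm_zero]
      positivity
    -- All cells that meet the `R + 1`-neighbourhood of `E` have their centres within distance
    -- `R + 1 + S + 2 * radius` of the centre `γ₀` of a cell that meets `E`.
    obtain ⟨γ₀, hγ₀⟩ := Set.mem_iUnion.mp (𝓒.iUnion_cell.ge (Set.mem_univ x₀))
    have hN : MeasurableSet (Metric.thickening (R + 1) E) :=
      Metric.isOpen_thickening.measurableSet
    refine (norm_sub_compression_mul_chi_le hρ (fun γ => he1 γ) hV hT' hE hN
      (Metric.self_subset_thickening (by linarith) E) (he1 γ₀) hδ0.le (fun γ hγ => ?_)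
      (hdiff _ _ hN.compl hE (lt_setDist_of_forall (R' := R + 1) (by linarith) (by linarith)
        fun a ha b hb => ?_))).trans ?_
    · obtain ⟨z, hz, hzN⟩ := hγ
      obtain ⟨y, hy, hzy⟩ := Metric.mem_thickening_iff.mp hzN
      refine heδ γ γ₀ ?_
      have h1 := 𝓒.dist_le γ z hz
      have h2 := 𝓒.dist_le γ₀ x₀ hγ₀
      have h3 := hES y hy x₀ hx₀
      have h4 := dist_triangle4 (γ : X) z y γ₀
      have h5 := dist_triangle y x₀ (γ₀ : X)
      rw [dist_comm (γ : X) z] at h4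
      linarith
    · by_contra hlt
      exact ha (Metric.mem_thickening_iff.mpr ⟨b, hb, not_le.mp hlt⟩)
    · linarith
  refine ⟨T', ⟨hT'c, propagation_lt_top_of_cells hρ 𝓒 hfar⟩, ?_⟩
  rw [dist_eq_norm]
  refine (hloc (T - T') (2 * ε') (4 * ε') (by positivity) hdiff hnear).trans_lt ?_
  linarith

end QuasiLocal

end CoarseRoe

theorem mainTheorem4
    {X : Type*} [MetricSpace X] [ProperSpace X] [MeasurableSpace X] [BorelSpace X]
    {H : Type*} [NormedAddCommGroup H] [InnerProductSpace ℂ H] [CompleteSpace H]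
    (K : Type*) [NormedAddCommGroup K] [InnerProductSpace ℂ K] [CompleteSpace K]
    [TopologicalSpace.SeparableSpace K] (hK : ¬ FiniteDimensional ℂ K)
    (ρ : C₀(X, ℂ) →⋆ₙₐ[ℂ] (H →L[ℂ] H)) (hρ : CoarseRoe.IsAmpleModule ρ) :
    CoarseRoe.stronglyQuasiLocalAlgebra K ρ ⊆ CoarseRoe.quasiLocalAlgebra ρ ∧
    (CoarseRoe.BoundedGeometry X →
      CoarseRoe.roeAlgebra ρ ⊆ CoarseRoe.stronglyQuasiLocalAlgebra K ρ) ∧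
    (CoarseRoe.BoundedGeometry X → CoarseRoe.PropertyA X →
      CoarseRoe.roeAlgebra ρ = CoarseRoe.stronglyQuasiLocalAlgebra K ρ ∧
      CoarseRoe.stronglyQuasiLocalAlgebra K ρ = CoarseRoe.quasiLocalAlgebra ρ) := by
  have hm := hρ.toIsModule
  have h1 : CoarseRoe.stronglyQuasiLocalAlgebra K ρ ⊆ CoarseRoe.quasiLocalAlgebra ρ :=
    fun T hT => ⟨hT.1, hT.2.isQuasiLocal hm hK⟩
  refine ⟨h1, fun hX => CoarseRoe.roeAlgebra_subset_stronglyQuasiLocalAlgebra hm hX,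
    fun hX hA => ?_⟩
  have h2 := CoarseRoe.roeAlgebra_subset_stronglyQuasiLocalAlgebra (K := K) hm hX
  have h3 := CoarseRoe.quasiLocalAlgebra_subset_roeAlgebra hm hX hA
  exact ⟨h2.antisymm (h1.trans h3), h1.antisymm (h3.trans h2)⟩
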